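/- **Setting.** Let $m\ge 0$, $s\ge 1$. A framed metric structure $(\phi,\xi_\alpha,\eta_\alpha,g)$, $\alpha\in\{1,\dots,s\}$, on a $(2m+s)$-dimensional manifold $M$ consists of a $(1,1)$-tensor field $\phi$ of rank $2m$, vector fields $\xi_\alpha$, 1-forms $\eta_\alpha$ and a Riemannian metric $g$ (all smooth) with $\phi^2X=-X+\sum_\alpha\eta_\alpha(X)\xi_\alpha$, $\eta_\alpha(\phi X)=0$, $\eta_\alpha(\xi_\beta)=\delta_{\alpha\beta}$, $\phi\xi_\alpha=0$, $g(X,Y)=g(\phi X,\phi Y)+\sum_\alpha\eta_\alpha(X)\eta_\alpha(Y)$, $\eta_\alpha(X)=g(X,\xi_\alpha)$ and $d\eta_\alpha(X,Y)=g(X,\phi Y)$, where $2\,d\eta(X,Y)=X(\eta(Y))-Y(\eta(X))-\eta([X,Y])$. It is an $\mathcal S$-structure if $[\phi,\phi]=-2\sum_\alpha d\eta_\alpha\otimes\xi_\alpha$, where $[\phi,\phi](X,Y)=\phi^2[X,Y]+[\phi X,\phi Y]-\phi[\phi X,Y]-\phi[X,\phi Y]$. It is an $\mathcal S$-space form $M(c)$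 if moreover every plane $\mathrm{span}\{X,\phi X\}$, with $X\ne0$ orthogonal to all $\xi_\alpha$, has sectional curvature $c$. Let $\nabla$ be the Levi-Civita connection and $R(X,Y)=[\nabla_X,\nabla_Y]-\nabla_{[X,Y]}$. A unit-speed curve $\gamma:J\to M$ on a nonempty open interval $J$, with $T=\gamma'$, is a Frenet curve of osculating order $r$ if there are smooth $g$-orthonormal vector fields $V_1=T,V_2,\dots,V_r$ along $\gamma$ and smooth positive functions $k_1,\dots,k_{r-1}$ with $\nabla_TV_j=-k_{j-1}V_{j-1}+k_jV_{j+1}$ for $1\le j\le r$; here $k_0=0$, and $k_j=0$, $V_{j+1}=0$ for $j\ge r$. It is $\theta_\alpha$-slant if $\eta_\alpha(T)=\cos\theta_\alpha$ for constants $\theta_1,\dots,\theta_s$; put $a=\sum_\alpha\cos^2\theta_\alpha$, $b=\sum_\alpha\cos\theta_\alpha$. For a $C^2$ function $f:J\to(0,\infty)$, $\gamma$ is $f$-biharmonic if $$f\,(\nabla_T\nabla_T\nabla_TT-R(T,\nabla_TT)T)+2f'\,\nabla_T\nabla_TT+f''\,\nabla_TT=0,$$ biharmonic if this holds with $f\equiv1$,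 and proper $f$-biharmonic if it is $f$-biharmonic but not biharmonic. **Theorem.** Let $\gamma:J\to M$ be a $\theta_\alpha$-slant Frenet curve of osculating order $r\ge3$ in an $\mathcal S$-space form $M(c)$ with $c\ne s$. Let $\beta:J\to\mathbb R$ be a differentiable function with $g(\phi T,V_2)=\sqrt{1-a}\cos\beta$, and suppose that at every $t\in J$ the number $g(\phi T,V_2)$ is different from $0$ and from $\pm\sqrt{1-a}$. Let $w(t)\in[0,\pi]$ be the angle between $V_3$ and the orthogonal projection of $\phi T$ onto $\mathrm{span}\{V_3,V_4\}$. Let $f:J\to(0,\infty)$ be of class $C^2$. Then $\gamma$ is proper $f$-biharmonic if and only if $k_1$ is not constant, $f=c_1k_1^{-3/2}$ for a constant $c_1>0$, and the following holds. (i) If $\beta$ is constant: there are a constant $c_2>0$ and a sign $\varepsilon\in\{1,-1\}$ such that on $J$ $$\frac{k_2}{k_1}=c_2,\qquad 3(k_1')^2-2k_1k_1''=4k_1^2\Big\{(1+c_2^2)k_1^2-\Big[b^2+\tfrac{c+3s+3(c-s)\cos^2\beta}{4}(1-a)\Big]\Big\},$$ $$k_2k_3=-\varepsilon\,\frac{3(c-s)\sin2\beta}{8}(1-a),\qquad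 \phi T=\sqrt{1-a}\,(\cos\beta\,V_2+\varepsilon\sin\beta\,V_4).$$ (ii) If $\beta$ is not constant: there are a differentiable function $\mu:J\to\mathbb R$ and signs $\varepsilon_1,\varepsilon_2\in\{1,-1\}$ such that on $J$ $$\mu'=-\frac{3(c-s)}{2}(1-a)\frac{\cos^2\beta\,k_1'}{k_1^3},\qquad k_2^2=-\frac{3(c-s)}{4}(1-a)\cos^2\beta+\mu k_1^2,$$ $$3(k_1')^2-2k_1k_1''=4k_1^2\Big\{(1+\mu)k_1^2-\Big[b^2+\tfrac{c+3s+6(c-s)\cos^2\beta}{4}(1-a)\Big]\Big\},$$ $$k_2k_3=-\varepsilon_2\,\frac{3(c-s)\sin2\beta\sin w}{8}(1-a),\qquad \cos w=-\varepsilon_1\frac{\beta'}{k_2},$$ $$\phi T=\sqrt{1-a}\,(\cos\beta\,V_2+\varepsilon_1\sin\beta\cos w\,V_3+\varepsilon_2\sin\beta\sin w\,V_4).$$ -/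

import Mathlib

open scoped Manifold ContDiff

noncomputable section

namespace SSpaceForm

/-! ### Riemannian calculus on an open subset of a vector space

A metric is given there by its coefficient function `G : E → E →L[ℝ] E →L[ℝ] ℝ`. -/

section Coordinates

variable {E : Type*} [NormedAddCommGroup E] [NormedSpace ℝ E]

/-- The Christoffel symbol `Γ_x(u, v) = ∇_u v` (`u`, `v` constant vector fields) of the Levi-Civita
connection of `G`, that is, the vector determined by
`2 G(Γ(u, v), w) = D_u G(v, w) + D_v G(u, w) - D_w G(u, v)` for all `w`. -/
def christoffel (G : E → E →L[ℝ] E →L[ℝ] ℝ) (x u v : E) : E :=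
  (G x).inverse ((1 / 2 : ℝ) •
    (fderiv ℝ G x u v + fderiv ℝ G x v u - ((fderiv ℝ G x).flip u).flip v))

/-- The curvature `R(u, v)w = ∇_u ∇_v w - ∇_v ∇_u w` at `x`, where `u`, `v`, `w` are extended as
constant vector fields (so that `[u, v] = 0`). -/
def coordCurvature (G : E → E →L[ℝ] E →L[ℝ] ℝ) (x u v w : E) : E :=
  fderiv ℝ (fun y => christoffel G y v w) x u - fderiv ℝ (fun y => christoffel G y u w) x v
    + christoffel G x u (christoffel G x v w) - christoffel G x v (christoffel G x u w)

/-- The exterior derivative of a 1-form, with the convention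
`2 dη(X, Y) = X(η(Y)) - Y(η(X)) - η([X, Y])`. -/
def coordExtDeriv (η : E → E →L[ℝ] ℝ) (x u v : E) : ℝ :=
  (1 / 2) * (fderiv ℝ η x u v - fderiv ℝ η x v u)

/-- The Nijenhuis tensor
`[A, A](X, Y) = A²[X, Y] + [AX, AY] - A[AX, Y] - A[X, AY]` of a (1,1)-tensor field, evaluated on
the constant vector fields `X = u`, `Y = v`. -/
def coordNijenhuis (A : E → E →L[ℝ] E) (x u v : E) : E :=
  let X : E → E := fun _ => u
  let Y : E → E := fun _ => v
  let AX : E → E := fun y => A y u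
  let AY : E → E := fun y => A y v
  A x (A x (VectorField.lieBracket ℝ X Y x)) + VectorField.lieBracket ℝ AX AY x
    - A x (VectorField.lieBracket ℝ AX Y x) - A x (VectorField.lieBracket ℝ X AY x)

end Coordinates

/-! ### Tensors on a manifold and their coordinate expressions -/

section Manifold

variable {E : Type*} [NormedAddCommGroup E] [NormedSpace ℝ E]
  {M : Type*} [TopologicalSpace M] [ChartedSpace E M]

/-- The differential at `p` of the chart centred at `q`: it sends a tangent vector at `p` to its
coordinates in that chart. -/
def chartD (q p : M) : TangentSpace 𝓘(ℝ, E) p →L[ℝ] E :=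
  mfderiv 𝓘(ℝ, E) 𝓘(ℝ, E) (extChartAt 𝓘(ℝ, E) q) p

/-- The differential at `y` of the inverse of the chart centred at `q`. -/
def chartSymmD (q : M) (y : E) :
    E →L[ℝ] TangentSpace 𝓘(ℝ, E) ((extChartAt 𝓘(ℝ, E) q).symm y) :=
  mfderiv 𝓘(ℝ, E) 𝓘(ℝ, E) (extChartAt 𝓘(ℝ, E) q).symm y

/-- The expression of a vector field in the chart centred at `q`. -/
def vectorIn (X : ∀ p : M, TangentSpace 𝓘(ℝ, E) p) (q : M) (y : E) : E :=
  chartD q _ (X ((extChartAt 𝓘(ℝ, E) q).symm y))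

/-- The expression of a 1-form in the chart centred at `q`. -/
def formIn (η : ∀ p : M, TangentSpace 𝓘(ℝ, E) p →L[ℝ] ℝ) (q : M) (y : E) : E →L[ℝ] ℝ :=
  (η ((extChartAt 𝓘(ℝ, E) q).symm y)).comp (chartSymmD q y)

/-- The expression of a (1,1)-tensor field in the chart centred at `q`. -/
def endoIn (A : ∀ p : M, TangentSpace 𝓘(ℝ, E) p →L[ℝ] TangentSpace 𝓘(ℝ, E) p) (q : M) (y : E) :
    E →L[ℝ] E :=
  (chartD q ((extChartAt 𝓘(ℝ, E) q).symm y)).comp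
    ((A ((extChartAt 𝓘(ℝ, E) q).symm y)).comp (chartSymmD q y))

variable [IsManifold 𝓘(ℝ, E) ∞ M]

/-- A smooth Riemannian metric on `M`. -/
abbrev Metric (E : Type*) [NormedAddCommGroup E] [NormedSpace ℝ E] (M : Type*)
    [TopologicalSpace M] [ChartedSpace E M] [IsManifold 𝓘(ℝ, E) ∞ M] :=
  Bundle.ContMDiffRiemannianMetric 𝓘(ℝ, E) ∞ E (fun p : M => TangentSpace 𝓘(ℝ, E) p)

/-- The expression of a Riemannian metric in the chart centred at `q`. -/
def metricIn (g : Metric E M) (q : M) (y : E) : E →L[ℝ] E →L[ℝ] ℝ :=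
  ((chartSymmD q y).precomp ℝ).comp
    ((g.inner ((extChartAt 𝓘(ℝ, E) q).symm y)).comp (chartSymmD q y))

/-- The Riemann curvature tensor `R(u, v)w` at `p`, computed in the chart centred at `p`. -/
def curvature (g : Metric E M) (p : M) (u v w : TangentSpace 𝓘(ℝ, E) p) : TangentSpace 𝓘(ℝ, E) p :=
  (chartD (E := E) p p).inverse
    (coordCurvature (metricIn g p) (extChartAt 𝓘(ℝ, E) p p)
      (chartD p p u) (chartD p p v) (chartD p p w))

/-- The sectional curvature of the plane spanned by two independent tangent vectors. -/
def sectionalCurvature (g : Metric E M) (p : M) (u v : TangentSpace 𝓘(ℝ, E) p) : ℝ :=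
  g.inner p (curvature g p u v v) u /
    (g.inner p u u * g.inner p v v - g.inner p u v ^ 2)

/-- The angle, in `[0, π]`, between two nonzero tangent vectors. -/
def angle (g : Metric E M) (p : M) (u v : TangentSpace 𝓘(ℝ, E) p) : ℝ :=
  Real.arccos (g.inner p u v / (√(g.inner p u u) * √(g.inner p v v)))

/-! ### Curves -/

/-- The velocity `γ'(t)`. -/
def velocity (E : Type*) [NormedAddCommGroup E] [NormedSpace ℝ E] {M : Type*}
    [TopologicalSpace M] [ChartedSpace E M] (γ : ℝ → M) (t : ℝ) :
    TangentSpace 𝓘(ℝ, E) (γ t) :=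
  (mfderiv 𝓘(ℝ, ℝ) 𝓘(ℝ, E) γ t : ℝ →L[ℝ] TangentSpace 𝓘(ℝ, E) (γ t)) 1

/-- The covariant derivative `∇_T V` (`T = γ'`) of a vector field `V` along `γ` for the Levi-Civita
connection: at time `t` it is `v' + Γ(y', v)`, where `y` and `v` are the expressions of `γ` and `V`
in the chart centred at `γ(t)`. -/
def covDeriv (g : Metric E M) (γ : ℝ → M) (V : ∀ t, TangentSpace 𝓘(ℝ, E) (γ t)) (t : ℝ) :
    TangentSpace 𝓘(ℝ, E) (γ t) :=
  let y : ℝ → E := fun τ => extChartAt 𝓘(ℝ, E) (γ t) (γ τ)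
  let v : ℝ → E := fun τ => chartD (γ t) (γ τ) (V τ)
  (chartD (E := E) (γ t) (γ t)).inverse
    (deriv v t + christoffel (metricIn g (γ t)) (y t) (deriv y t) (v t))

/-- The tension field `τ(γ) = ∇_T T`. -/
def tension (g : Metric E M) (γ : ℝ → M) : ∀ t, TangentSpace 𝓘(ℝ, E) (γ t) :=
  covDeriv g γ (velocity E γ)

/-- The bitension field `τ₂(γ) = ∇_T ∇_T τ(γ) - R(T, τ(γ))T`. -/
def bitension (g : Metric E M) (γ : ℝ → M) (t : ℝ) : TangentSpace 𝓘(ℝ, E) (γ t) :=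
  covDeriv g γ (covDeriv g γ (tension g γ)) t
    - curvature g (γ t) (velocity E γ t) (tension g γ t) (velocity E γ t)

/-- `γ` is biharmonic on the interval `J`. -/
def IsBiharmonic (g : Metric E M) (γ : ℝ → M) (J : Set ℝ) : Prop :=
  ∀ t ∈ J, bitension g γ t = 0

/-- `γ` is `f`-biharmonic on the interval `J`:
`f (∇_T∇_T∇_T T - R(T, ∇_T T)T) + 2 f' ∇_T∇_T T + f'' ∇_T T = 0`. -/
def IsFBiharmonic (g : Metric E M) (γ : ℝ → M) (f : ℝ → ℝ) (J : Set ℝ) : Prop :=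
  ∀ t ∈ J, f t • bitension g γ t + (2 * deriv f t) • covDeriv g γ (tension g γ) t
    + deriv (deriv f) t • tension g γ t = 0

/-- Proper `f`-biharmonic: `f`-biharmonic but not biharmonic. -/
def IsProperFBiharmonic (g : Metric E M) (γ : ℝ → M) (f : ℝ → ℝ) (J : Set ℝ) : Prop :=
  IsFBiharmonic g γ f J ∧ ¬ IsBiharmonic g γ J

/-- `γ : J → M` is a (unit speed) Frenet curve of osculating order `r` with Frenet frame
`V 1, …, V r` and curvatures `k 1, …, k (r - 1)`. By convention `V j = 0` for `j > r`, and `k j = 0`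
for `j = 0` and for `j ≥ r`, so that the Frenet equations take the same form for all
`1 ≤ j ≤ r`. -/
structure IsFrenetCurve (g : Metric E M) (γ : ℝ → M) (J : Set ℝ) (r : ℕ)
    (V : ℕ → ∀ t, TangentSpace 𝓘(ℝ, E) (γ t)) (k : ℕ → ℝ → ℝ) : Prop where
  one_le : 1 ≤ r
  smooth : ContMDiffOn 𝓘(ℝ, ℝ) 𝓘(ℝ, E) ∞ γ J
  smooth_V : ∀ j, 1 ≤ j → j ≤ r →
    ContMDiffOn 𝓘(ℝ, ℝ) 𝓘(ℝ, E).tangent ∞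
      (fun t => (⟨γ t, V j t⟩ : TangentBundle 𝓘(ℝ, E) M)) J
  smooth_k : ∀ j, 1 ≤ j → j < r → ContDiffOn ℝ ∞ (k j) J
  V_one : ∀ t ∈ J, V 1 t = velocity E γ t
  orthonormal : ∀ i j, 1 ≤ i → i ≤ r → 1 ≤ j → j ≤ r → ∀ t ∈ J,
    g.inner (γ t) (V i t) (V j t) = if i = j then 1 else 0
  k_pos : ∀ j, 1 ≤ j → j < r → ∀ t ∈ J, 0 < k j t
  V_eq_zero : ∀ j, r < j → ∀ t ∈ J, V j t = 0
  k_zero : ∀ t ∈ J, k 0 t = 0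
  k_eq_zero : ∀ j, r ≤ j → ∀ t ∈ J, k j t = 0
  frenet : ∀ j, 1 ≤ j → j ≤ r → ∀ t ∈ J,
    covDeriv g γ (V j) t = -(k (j - 1) t) • V (j - 1) t + k j t • V (j + 1) t

/-! ### Framed metric manifolds and 𝒮-space forms -/

/-- A framed metric structure `(φ, ξ_α, η_α, g)`, `α ∈ {1, …, s}`, with `φ` of rank `2m`, including
the condition `dη_α(X, Y) = g(X, φY)`. Tensor identities that involve derivatives are required in
every chart `chartAt q`, at all points of its target. -/
structure FramedMetricStructure (E : Type*) [NormedAddCommGroup E] [NormedSpace ℝ E]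
    (M : Type*) [TopologicalSpace M] [ChartedSpace E M] [IsManifold 𝓘(ℝ, E) ∞ M]
    (m s : ℕ) where
  g : Metric E M
  φ : ∀ p : M, TangentSpace 𝓘(ℝ, E) p →L[ℝ] TangentSpace 𝓘(ℝ, E) p
  ξ : Fin s → ∀ p : M, TangentSpace 𝓘(ℝ, E) p
  η : Fin s → ∀ p : M, TangentSpace 𝓘(ℝ, E) p →L[ℝ] ℝ
  smooth_φ : ∀ q : M, ContDiffOn ℝ ∞ (endoIn φ q) (extChartAt 𝓘(ℝ, E) q).target
  smooth_ξ : ∀ α, ∀ q : M, ContDiffOn ℝ ∞ (vectorIn (ξ α) q) (extChartAt 𝓘(ℝ, E) q).target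
  smooth_η : ∀ α, ∀ q : M, ContDiffOn ℝ ∞ (formIn (η α) q) (extChartAt 𝓘(ℝ, E) q).target
  rank_φ : ∀ p, Module.finrank ℝ (φ p).range = 2 * m
  φ_φ : ∀ p (X : TangentSpace 𝓘(ℝ, E) p), φ p (φ p X) = -X + ∑ α, η α p X • ξ α p
  η_φ : ∀ α p (X : TangentSpace 𝓘(ℝ, E) p), η α p (φ p X) = 0
  η_ξ : ∀ α β p, η α p (ξ β p) = if α = β then 1 else 0
  φ_ξ : ∀ α p, φ p (ξ α p) = 0
  g_compat : ∀ p (X Y : TangentSpace 𝓘(ℝ, E) p),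
    g.inner p X Y = g.inner p (φ p X) (φ p Y) + ∑ α, η α p X * η α p Y
  η_eq : ∀ α p (X : TangentSpace 𝓘(ℝ, E) p), η α p X = g.inner p X (ξ α p)
  d_η : ∀ α, ∀ q : M, ∀ y ∈ (extChartAt 𝓘(ℝ, E) q).target, ∀ u v : E,
    coordExtDeriv (formIn (η α) q) y u v = metricIn g q y u (endoIn φ q y v)

namespace FramedMetricStructure

variable {m s : ℕ}

/-- The structure is an 𝒮-structure: `[φ, φ] = -2 ∑_α dη_α ⊗ ξ_α`. -/
def IsSStructure (S : FramedMetricStructure E M m s) : Prop :=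
  ∀ q : M, ∀ y ∈ (extChartAt 𝓘(ℝ, E) q).target, ∀ u v : E,
    coordNijenhuis (endoIn S.φ q) y u v =
      (-2 : ℝ) • ∑ α, coordExtDeriv (formIn (S.η α) q) y u v • vectorIn (S.ξ α) q y

/-- `(M, φ, ξ_α, η_α, g)` is an 𝒮-space form `M(c)`: an 𝒮-manifold all of whose `φ`-sections
`span{X, φX}`, where `X ≠ 0` is orthogonal to all `ξ_α`, have sectional curvature `c`. -/
def IsSSpaceForm (S : FramedMetricStructure E M m s) (c : ℝ) : Prop :=
  S.IsSStructure ∧ ∀ p (X : TangentSpace 𝓘(ℝ, E) p), X ≠ 0 → (∀ α, S.g.inner p X (S.ξ α p) = 0) →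
    sectionalCurvature S.g p X (S.φ p X) = c

/-- `γ` is a `θ_α`-slant curve with contact angles `θ_α`: `η_α(T) = cos θ_α` along `γ`. -/
def IsSlant (S : FramedMetricStructure E M m s) (γ : ℝ → M) (J : Set ℝ) (θ : Fin s → ℝ) : Prop :=
  ∀ α, ∀ t ∈ J, S.η α (γ t) (velocity E γ t) = Real.cos (θ α)

end FramedMetricStructure

end Manifold

end SSpaceForm

end

/-! The f-biharmonic equation is computed in the Frenet frame; an explicit curvature formula for
𝒮-space forms makes this possible.

Geometry of M. Differentiating the algebraic identities of the structure, and using dη_α(X, Y) =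
g(X, φY), the closedness of this 2-form and normality, one gets ∇_X ξ_α = -φX (`nablaVec_ξ_eq`) and
(∇_X φ)Y = ∑_α (g(φX, φY) ξ_α + η_α(Y) φ²X) (`nablaEndo_eq`). The Ricci identity then gives R(·,
·)ξ_α and the commutator of R with φ. On the orthogonal complement of the ξ_α, R minus a model
tensor is Kähler-like with zero holomorphic curvature, so its Jacobi operators vanish
(`kahler_tensor_eq_zero`). Hence, for Y orthogonal to X and to all ξ_α, R(X, Y)X = -((∑ η_α(X))² +
(c+3s)/4 |φX|²) Y - 3(c-s)/4 g(φX, Y) φX (`curvature_smul_add`).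

The curve. Slantness gives η_α(V₂) = 0 (`η_V_two`), so the formula applies to X = T, Y = k₁V₂. Put
x_j = g(φT, V_j), Q = 3(c-s)/4, P = b² + (c+3s)(1-a)/4. The equation becomes a linear relation
between V₁, …, V₄ and φT in which φT has the nonzero coefficient f Q k₁ x₂. So φT lies in span{V₂,
V₃, V₄}, and scalar equations remain (`fBiharmonic_iff_components`). The V₁-equation says that f²k₁³
is constant; with it f can be eliminated from the others, leaving 3k₁'² - 2k₁k₁'' = 4k₁²(k₁² + k₂² -
P - Q x₂²), k₁k₂' - k₁'k₂ + Q k₁x₂x₃ = 0, k₂k₃ + Q x₂x₄ = 0. Biharmonicity makes k₁ constant, and an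
f-biharmonic curve with constant k₁ has constant f, so is biharmonic: properness is the nonconstancy
of k₁.

The angle. Here x₂ = √(1-a) cos β, x₂' = k₂x₃ and |φT|² = 1-a, whence x₃² + x₄² = (1-a) sin²β. If β
is constant, then x₃ = 0 and k₂/k₁ is constant. In general the V₃-equation times k₂ says that μ =
(k₂² + Q(1-a) cos²β)/k₁² has derivative -2Q(1-a) cos²β k₁'/k₁³. The signs are constant because sin β
has no zero on the interval and x₄ vanishes either everywhere (r = 3) or nowhere. -/

noncomputable section

namespace SSpaceForm

/-! ### Levi-Civita connection of a metric on an open subset of a vector space -/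

section LocalMetric

set_option maxSynthPendingDepth 3

variable {E : Type*} [NormedAddCommGroup E] [NormedSpace ℝ E]

/-- The Christoffel symbol as a field of bilinear maps. -/
def christoffelL (G : E → E →L[ℝ] E →L[ℝ] ℝ) (x : E) : E →L[ℝ] E →L[ℝ] E :=
  (ContinuousLinearMap.compL ℝ E (E →L[ℝ] ℝ) E (G x).inverse).comp
    ((1 / 2 : ℝ) • (fderiv ℝ G x + (fderiv ℝ G x).flip
      - ((ContinuousLinearMap.flipₗᵢ ℝ E E ℝ).toContinuousLinearEquiv :
          (E →L[ℝ] E →L[ℝ] ℝ) →L[ℝ] (E →L[ℝ] E →L[ℝ] ℝ)).comp (fderiv ℝ G x).flip))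

theorem christoffelL_apply (G : E → E →L[ℝ] E →L[ℝ] ℝ) (x u v : E) :
    christoffelL G x u v = christoffel G x u v := rfl

/-- The coefficient function of a smooth Riemannian metric on an open set. -/
structure IsLocalMetric (G : E → E →L[ℝ] E →L[ℝ] ℝ) (U : Set E) : Prop where
  isOpen : IsOpen U
  smooth : ContDiffOn ℝ ∞ G U
  symm : ∀ x ∈ U, ∀ u v, G x u v = G x v u
  pos : ∀ x ∈ U, ∀ u, u ≠ 0 → 0 < G x u u

namespace IsLocalMetric

variable {G : E → E →L[ℝ] E →L[ℝ] ℝ} {U : Set E} {x : E}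

theorem ext (hG : IsLocalMetric G U) (hx : x ∈ U) {a b : E} (h : ∀ w, G x a w = G x b w) :
    a = b := by
  by_contra hab
  have h1 := hG.pos x hx (a - b) (sub_ne_zero.2 hab)
  have h2 := h (a - b)
  simp only [map_sub, _root_.sub_apply] at h1 h2
  linarith

theorem contDiffAt (hG : IsLocalMetric G U) (hx : x ∈ U) : ContDiffAt ℝ ∞ G x :=
  hG.smooth.contDiffAt (hG.isOpen.mem_nhds hx)

theorem differentiableAt (hG : IsLocalMetric G U) (hx : x ∈ U) : DifferentiableAt ℝ G x :=
  (hG.contDiffAt hx).differentiableAt (by simp)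

theorem fderiv_symm (hG : IsLocalMetric G U) (hx : x ∈ U) (w u v : E) :
    fderiv ℝ G x w u v = fderiv ℝ G x w v u := by
  have h : (fun y => G y u v) =ᶠ[nhds x] fun y => G y v u := by
    filter_upwards [hG.isOpen.mem_nhds hx] with y hy using hG.symm y hy u v
  have key : ∀ a b : E, fderiv ℝ (fun y => G y a b) x w = fderiv ℝ G x w a b := by
    intro a b
    have h1 := hG.differentiableAt hx
    have h2 : HasFDerivAt (fun y => G y a b) _ x :=
      ((h1.hasFDerivAt.clm_apply (hasFDerivAt_const a x)).clm_apply (hasFDerivAt_const b x))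
    rw [h2.fderiv]; simp
  rw [← key, ← key, h.fderiv_eq]

variable [FiniteDimensional ℝ E]

/-- Positivity gives injectivity and a dimension count the rest. Without this,
`ContinuousLinearMap.inverse` takes its default value 0 and `christoffel` says nothing about the
metric. -/
theorem isInvertible (hG : IsLocalMetric G U) (hx : x ∈ U) : (G x).IsInvertible := by
  have hinj : Function.Injective (G x : E →ₗ[ℝ] E →L[ℝ] ℝ) := fun a b h =>
    hG.ext hx fun w => by
      have : G x a = G x b := h
      rw [this]
  have hrank : Module.finrank ℝ E = Module.finrank ℝ (E →L[ℝ] ℝ) := by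
    rw [← (LinearMap.toContinuousLinearMap (𝕜 := ℝ) (E := E) (F' := ℝ)).finrank_eq]
    exact (Subspace.dual_finrank_eq (K := ℝ) (V := E)).symm
  refine ⟨(LinearEquiv.ofInjectiveOfFinrankEq (G x : E →ₗ[ℝ] E →L[ℝ] ℝ) hinj
    hrank).toContinuousLinearEquiv, ?_⟩
  ext u v
  rfl

theorem apply_inverse (hG : IsLocalMetric G U) (hx : x ∈ U) (l : E →L[ℝ] ℝ) :
    G x ((G x).inverse l) = l := by
  obtain ⟨e, he⟩ := hG.isInvertible hx
  rw [← he, ContinuousLinearMap.inverse_equiv]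
  simp

theorem apply_christoffel (hG : IsLocalMetric G U) (hx : x ∈ U) (u v w : E) :
    G x (christoffel G x u v) w =
      (1 / 2) * (fderiv ℝ G x u v w + fderiv ℝ G x v u w - fderiv ℝ G x w u v) := by
  rw [christoffel, hG.apply_inverse hx]
  rfl

theorem christoffel_symm (hG : IsLocalMetric G U) (hx : x ∈ U) (u v : E) :
    christoffel G x u v = christoffel G x v u := by
  refine hG.ext hx fun w => ?_
  rw [hG.apply_christoffel hx, hG.apply_christoffel hx, hG.fderiv_symm hx w u v]
  ring

/-- Metric compatibility: in the two Koszul formulas the other derivatives of G cancel in pairs. -/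
theorem fderiv_eq (hG : IsLocalMetric G U) (hx : x ∈ U) (w u v : E) :
    fderiv ℝ G x w u v = G x (christoffel G x w u) v + G x u (christoffel G x w v) := by
  rw [hG.symm x hx u, hG.apply_christoffel hx, hG.apply_christoffel hx,
    hG.fderiv_symm hx w v u, hG.fderiv_symm hx u w v, hG.fderiv_symm hx v w u]
  ring

theorem contDiffOn_christoffelL (hG : IsLocalMetric G U) :
    ContDiffOn ℝ ∞ (christoffelL G) U := by
  have hD : ContDiffOn ℝ ∞ (fderiv ℝ G) U :=
    hG.smooth.fderiv_of_isOpen hG.isOpen (by simp)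
  have hinv : ContDiffOn ℝ ∞ (fun x => (G x).inverse) U := by
    intro x hx
    obtain ⟨e, he⟩ := hG.isInvertible hx
    have h1 : ContDiffAt ℝ ∞ ContinuousLinearMap.inverse (G x) := by
      rw [← he]; exact contDiffAt_map_inverse e
    exact (h1.comp x (hG.contDiffAt hx)).contDiffWithinAt
  have hflip : ContDiffOn ℝ ∞ (fun x => (fderiv ℝ G x).flip) U :=
    (ContinuousLinearMap.flipₗᵢ ℝ E E (E →L[ℝ] ℝ)).toContinuousLinearEquiv.contDiff.comp_contDiffOn
      hD
  exact ((ContinuousLinearMap.contDiff _).comp_contDiffOn hinv).clm_comp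
    (((hD.add hflip).sub (contDiffOn_const.clm_comp hflip)).const_smul _)

theorem differentiableAt_christoffelL (hG : IsLocalMetric G U) (hx : x ∈ U) :
    DifferentiableAt ℝ (christoffelL G) x :=
  (hG.contDiffOn_christoffelL.contDiffAt (hG.isOpen.mem_nhds hx)).differentiableAt (by simp)

theorem hasFDerivAt_christoffel (hG : IsLocalMetric G U) (hx : x ∈ U) {X Y : E → E}
    {X' Y' : E →L[ℝ] E} (hX : HasFDerivAt X X' x) (hY : HasFDerivAt Y Y' x) (u : E) :
    fderiv ℝ (fun y => christoffel G y (X y) (Y y)) x u =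
      fderiv ℝ (christoffelL G) x u (X x) (Y x) + christoffel G x (X' u) (Y x)
        + christoffel G x (X x) (Y' u) := by
  have h : HasFDerivAt (fun y => christoffelL G y (X y) (Y y)) _ x :=
    ((hG.differentiableAt_christoffelL hx).hasFDerivAt.clm_apply hX).clm_apply hY
  have h' : fderiv ℝ (fun y => christoffel G y (X y) (Y y)) x = _ := h.fderiv
  rw [h']
  simp [christoffelL_apply]
  abel

theorem coordCurvature_eq (hG : IsLocalMetric G U) (hx : x ∈ U) (u v w : E) :
    coordCurvature G x u v w =
      fderiv ℝ (christoffelL G) x u v w - fderiv ℝ (christoffelL G) x v u w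
        + christoffelL G x u (christoffelL G x v w)
        - christoffelL G x v (christoffelL G x u w) := by
  have h : ∀ a b c : E, fderiv ℝ (fun y => christoffel G y a b) x c =
      fderiv ℝ (christoffelL G) x c a b := by
    intro a b c
    rw [hG.hasFDerivAt_christoffel hx (hasFDerivAt_const a x) (hasFDerivAt_const b x)]
    simp [← christoffelL_apply]
  simp only [coordCurvature, h, christoffelL_apply]

/-- The Riemann tensor of type (0,4). -/
def riemann (G : E → E →L[ℝ] E →L[ℝ] ℝ) (x u v w z : E) : ℝ :=
  G x (coordCurvature G x u v w) z

end IsLocalMetric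
end LocalMetric
-- Ricci identity and symmetries of the Riemann tensor
section RiemannTensor

set_option maxSynthPendingDepth 3

variable {E : Type*} [NormedAddCommGroup E] [NormedSpace ℝ E]

namespace IsLocalMetric

variable {G : E → E →L[ℝ] E →L[ℝ] ℝ} {U : Set E} {x : E}

theorem fderiv_apply_apply (hG : IsLocalMetric G U) (hx : x ∈ U) {X Y : E → E}
    (hX : DifferentiableAt ℝ X x) (hY : DifferentiableAt ℝ Y x) (u : E) :
    fderiv ℝ (fun y => G y (X y) (Y y)) x u =
      fderiv ℝ G x u (X x) (Y x) + G x (fderiv ℝ X x u) (Y x) + G x (X x) (fderiv ℝ Y x u) := by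
  have h : HasFDerivAt (fun y => G y (X y) (Y y)) _ x :=
    ((hG.differentiableAt hx).hasFDerivAt.clm_apply hX.hasFDerivAt).clm_apply hY.hasFDerivAt
  rw [h.fderiv]
  simp
  ring

theorem fderiv_fderiv_symm {F : Type*} [NormedAddCommGroup F] [NormedSpace ℝ F] {X : E → F}
    (hX : ContDiffAt ℝ ∞ X x) (u v : E) :
    fderiv ℝ (fderiv ℝ X) x u v = fderiv ℝ (fderiv ℝ X) x v u :=
  (hX.isSymmSndFDerivAt (by simp only [minSmoothness_of_isRCLikeNormedField]; exact ENat.LEInfty.out)) u v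

/-- The covariant derivative `∇_u X` of a vector field. -/
def covField (G : E → E →L[ℝ] E →L[ℝ] ℝ) (X : E → E) (x u : E) : E :=
  fderiv ℝ X x u + christoffel G x u (X x)

theorem differentiableAt_fderiv {F : Type*} [NormedAddCommGroup F] [NormedSpace ℝ F] {X : E → F}
    (hX : ContDiffAt ℝ ∞ X x) : DifferentiableAt ℝ (fderiv ℝ X) x :=
  (hX.fderiv_right (m := ∞) (by simp)).differentiableAt (by simp)

theorem riemann_antisymm_left (u v w z : E) :
    riemann G x u v w z = -riemann G x v u w z := by
  have : coordCurvature G x u v w = -coordCurvature G x v u w := by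
    simp only [coordCurvature]; abel
  simp [riemann, this]

variable [FiniteDimensional ℝ E]

theorem fderiv_metric_fields (hG : IsLocalMetric G U) (hx : x ∈ U) {X Y : E → E}
    (hX : DifferentiableAt ℝ X x) (hY : DifferentiableAt ℝ Y x) (u : E) :
    fderiv ℝ (fun y => G y (X y) (Y y)) x u =
      G x (covField G X x u) (Y x) + G x (X x) (covField G Y x u) := by
  rw [hG.fderiv_apply_apply hx hX hY, hG.fderiv_eq hx]
  simp only [covField, map_add, add_apply]
  ring

/-- The Ricci identity for a vector field. -/
theorem ricci_identity (hG : IsLocalMetric G U) (hx : x ∈ U) {X : E → E}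
    (hX : ContDiffAt ℝ ∞ X x) (u v : E) :
    coordCurvature G x u v (X x) =
      covField G (fun y => covField G X y v) x u - covField G (fun y => covField G X y u) x v := by
  have hd : DifferentiableAt ℝ X x := hX.differentiableAt (by simp)
  have h1 : ∀ a b : E, fderiv ℝ (fun y => covField G X y a) x b =
      fderiv ℝ (fderiv ℝ X) x b a + fderiv ℝ (christoffelL G) x b a (X x)
        + christoffel G x a (fderiv ℝ X x b) := by
    intro a b
    have h2 : HasFDerivAt (fun y => fderiv ℝ X y a + christoffelL G y a (X y)) _ x :=
      ((differentiableAt_fderiv hX).hasFDerivAt.clm_apply (hasFDerivAt_const a x)).add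
        (((hG.differentiableAt_christoffelL hx).hasFDerivAt.clm_apply
          (hasFDerivAt_const a x)).clm_apply hd.hasFDerivAt)
    have h3 : (fun y => covField G X y a) =
      fun y => fderiv ℝ X y a + christoffelL G y a (X y) := rfl
    rw [h3, h2.fderiv]
    simp [christoffelL_apply]
    abel
  simp only [covField] at h1 ⊢
  rw [h1, h1, hG.coordCurvature_eq hx, fderiv_fderiv_symm hX u v]
  simp only [← christoffelL_apply, map_add]
  rw [christoffelL_apply G x u (fderiv ℝ X x v), christoffelL_apply G x v (fderiv ℝ X x u)]
  abel

theorem riemann_bianchi (hG : IsLocalMetric G U) (hx : x ∈ U) (u v w z : E) :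
    riemann G x u v w z + riemann G x v w u z + riemann G x w u v z = 0 := by
  have hs : ∀ a b c : E, fderiv ℝ (fun y => christoffel G y a b) x c =
      fderiv ℝ (fun y => christoffel G y b a) x c := by
    intro a b c
    have : (fun y => christoffel G y a b) =ᶠ[nhds x] fun y => christoffel G y b a := by
      filter_upwards [hG.isOpen.mem_nhds hx] with y hy using hG.christoffel_symm hy a b
    rw [this.fderiv_eq]
  have : coordCurvature G x u v w + coordCurvature G x v w u + coordCurvature G x w u v = 0 := by
    simp only [coordCurvature]
    rw [hs v w u, hs u w v, hs v u w, hG.christoffel_symm hx v w, hG.christoffel_symm hx u w,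
      hG.christoffel_symm hx v u]
    abel
  simp only [riemann, ← add_apply, ← map_add, this, map_zero, zero_apply]

/-- Applying metric compatibility twice expresses the second derivatives of G(w, z) by the
connection; their symmetry is then the skewness of R(u, v). -/
theorem riemann_antisymm_right (hG : IsLocalMetric G U) (hx : x ∈ U) (u v w z : E) :
    riemann G x u v w z = -riemann G x u v z w := by
  have hGd : ∀ y ∈ U, DifferentiableAt ℝ G y := fun y hy => hG.differentiableAt hy
  have hcov : ∀ (a b : E), DifferentiableAt ℝ (fun y => christoffel G y a b) x := by
    intro a b
    exact ((hG.differentiableAt_christoffelL hx).clm_apply (differentiableAt_const a)).clm_apply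
      (differentiableAt_const b)
  have key : ∀ a b : E, fderiv ℝ (fderiv ℝ G) x a b w z =
      G x (covField G (fun y => christoffel G y b w) x a) z
        + G x (christoffel G x b w) (christoffel G x a z)
        + (G x (christoffel G x a w) (christoffel G x b z)
        + G x w (covField G (fun y => christoffel G y b z) x a)) := by
    intro a b
    have e1 : (fun y => fderiv ℝ G y b w z) =ᶠ[nhds x] fun y =>
        G y (christoffel G y b w) z + G y w (christoffel G y b z) := by
      filter_upwards [hG.isOpen.mem_nhds hx] with y hy using hG.fderiv_eq hy b w z
    have e2 : HasFDerivAt (fun y => fderiv ℝ G y b w z) _ x :=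
      (((differentiableAt_fderiv (hG.contDiffAt hx)).hasFDerivAt.clm_apply
        (hasFDerivAt_const b x)).clm_apply (hasFDerivAt_const w x)).clm_apply
          (hasFDerivAt_const z x)
    have e3 : fderiv ℝ (fun y => fderiv ℝ G y b w z) x a = fderiv ℝ (fderiv ℝ G) x a b w z := by
      rw [e2.fderiv]; simp
    have hGx := hG.differentiableAt hx
    have d1 : DifferentiableAt ℝ (fun y => G y (christoffel G y b w) z) x :=
      (hGx.clm_apply (hcov b w)).clm_apply (differentiableAt_const z)
    have d2 : DifferentiableAt ℝ (fun y => G y w (christoffel G y b z)) x :=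
      (hGx.clm_apply (differentiableAt_const w)).clm_apply (hcov b z)
    rw [← e3, e1.fderiv_eq, fderiv_fun_add d1 d2, add_apply,
      hG.fderiv_metric_fields hx (hcov b w) (differentiableAt_const z),
      hG.fderiv_metric_fields hx (differentiableAt_const w) (hcov b z)]
    simp [covField]
  have hR : ∀ c : E, coordCurvature G x u v c =
      covField G (fun y => christoffel G y v c) x u
        - covField G (fun y => christoffel G y u c) x v := by
    intro c
    simp only [coordCurvature, covField]
    abel
  have h := congrArg (fun B => B w z) (fderiv_fderiv_symm (hG.contDiffAt hx) u v)
  simp only [key] at h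
  simp only [riemann, hR, map_sub, _root_.sub_apply]
  rw [hG.symm x hx _ w, hG.symm x hx _ w]
  linarith

/-- The octahedron argument: the four Bianchi identities on cyclic shifts of u, v, w, z, combined by
means of the two antisymmetries. -/
theorem riemann_pair_symm (hG : IsLocalMetric G U) (hx : x ∈ U) (u v w z : E) :
    riemann G x u v w z = riemann G x w z u v := by
  have b1 := hG.riemann_bianchi hx u v w z
  have b2 := hG.riemann_bianchi hx v w z u
  have b3 := hG.riemann_bianchi hx w z u v
  have b4 := hG.riemann_bianchi hx z u v w
  have r := hG.riemann_antisymm_right hx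
  have l := riemann_antisymm_left (G := G) (x := x)
  rw [r v w u z, r w u v z, l w u z v] at b1
  rw [r z v w u, l z v u w, r w z v u] at b2
  rw [l z u w v, l u w z v] at b3
  rw [r u v z w, r v z u w, l z u v w, r u z v w] at b4
  linarith [r w u v z, l w u v z, l v z u w, r v z u w, r v w z u, l u z v w, r u z w v,
    r u w z v]

end IsLocalMetric
end RiemannTensor
-- Linear algebra determining ∇ξ_α and ∇φ on one tangent space
section PointwiseAlgebra

set_option maxSynthPendingDepth 3

variable {E : Type*} [NormedAddCommGroup E] [NormedSpace ℝ E] {s : ℕ}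

/-- The algebraic identities of a framed metric structure on a single tangent space. -/
structure IsFramedAlgebra (g : E →L[ℝ] E →L[ℝ] ℝ) (φ : E →L[ℝ] E) (ξ : Fin s → E)
    (η : Fin s → E →L[ℝ] ℝ) : Prop where
  symm : ∀ u v, g u v = g v u
  pos : ∀ u, u ≠ 0 → 0 < g u u
  φ_φ : ∀ u, φ (φ u) = -u + ∑ α, η α u • ξ α
  η_φ : ∀ α u, η α (φ u) = 0
  η_ξ : ∀ α β, η α (ξ β) = if α = β then 1 else 0
  φ_ξ : ∀ α, φ (ξ α) = 0
  compat : ∀ u v, g u v = g (φ u) (φ v) + ∑ α, η α u * η α v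
  η_eq : ∀ α u, η α u = g u (ξ α)

namespace IsFramedAlgebra

variable {g : E →L[ℝ] E →L[ℝ] ℝ} {φ : E →L[ℝ] E} {ξ : Fin s → E} {η : Fin s → E →L[ℝ] ℝ}

theorem ext (h : IsFramedAlgebra g φ ξ η) {a b : E} (hab : ∀ w, g a w = g b w) : a = b := by
  by_contra hne
  have h1 := h.pos (a - b) (sub_ne_zero.2 hne)
  have h2 := hab (a - b)
  simp only [map_sub, _root_.sub_apply] at h1 h2
  linarith

theorem g_φ_ξ (h : IsFramedAlgebra g φ ξ η) (u : E) (α : Fin s) : g (φ u) (ξ α) = 0 := by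
  rw [← h.η_eq, h.η_φ]

theorem g_ξ_φ (h : IsFramedAlgebra g φ ξ η) (u : E) (α : Fin s) : g (ξ α) (φ u) = 0 := by
  rw [h.symm, h.g_φ_ξ]

theorem skew (h : IsFramedAlgebra g φ ξ η) (u v : E) : g (φ u) v = -g u (φ v) := by
  rw [h.compat (φ u) v, h.φ_φ]
  simp [h.η_φ, h.g_ξ_φ]

theorem eq_neg_φ_φ_add (h : IsFramedAlgebra g φ ξ η) (u : E) :
    u = -φ (φ u) + ∑ α, η α u • ξ α := by
  rw [h.φ_φ]; abel

/-- A vector is determined by its products with the image of `φ` and with the `ξ α`. -/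
theorem ext' (h : IsFramedAlgebra g φ ξ η) {a b : E} (h1 : ∀ w, g a (φ w) = g b (φ w))
    (h2 : ∀ α, g a (ξ α) = g b (ξ α)) : a = b := by
  refine h.ext fun w => ?_
  rw [h.eq_neg_φ_φ_add w]
  simp only [map_add, map_neg, map_sum, map_smul, h1, h2]

theorem φ_φ_φ (h : IsFramedAlgebra g φ ξ η) (u : E) : φ (φ (φ u)) = -φ u := by
  rw [h.φ_φ (φ u)]; simp [h.η_φ]

section FirstOrder

variable {N : Fin s → E →L[ℝ] E} {P : E →L[ℝ] E →L[ℝ] E}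

/-- The covariant derivatives `N α = ∇ξ_α` of the structure vector fields vanish on the structure
vector fields. -/
theorem N_ξ (h : IsFramedAlgebra g φ ξ η)
    (hb : ∀ α u v, g (N α u) v - g (N α v) u = 2 * g u (φ v))
    (he : ∀ u α, P u (ξ α) + φ (N α u) = 0)
    (hf : ∀ α β u, g (N α u) (ξ β) + g (N β u) (ξ α) = 0)
    (hh : ∀ u v, P (φ u) v - P (φ v) u - φ (P u v) + φ (P v u)
      = (-2 : ℝ) • ∑ α, g u (φ v) • ξ α) (α β : Fin s) : N β (ξ α) = 0 := by
  have s1 : ∀ α β u, g (N β (ξ α)) u = g (N β u) (ξ α) := by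
    intro α β u
    have := hb β u (ξ α)
    rw [h.φ_ξ, map_zero] at this
    linarith
  have s2 : ∀ α β, N α (ξ β) = -N β (ξ α) := by
    intro α β
    refine h.ext fun w => ?_
    have := hf α β w
    rw [map_neg, neg_apply, s1 β α, s1 α β]
    linarith
  have t1 : ∀ α β γ, g (N α (ξ β)) (ξ γ) = -g (N β (ξ α)) (ξ γ) := by
    intro α β γ
    rw [s2 α β, map_neg, neg_apply]
  -- The number g(N_β ξ_α, ξ_γ) is symmetric in α, γ by `s1` and antisymmetric in α, β by `s2`;
  -- these two symmetries together force it to vanish.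
  have s3 : ∀ γ, η γ (N β (ξ α)) = 0 := by
    intro γ
    rw [h.η_eq]
    linarith [t1 β α γ, s1 α β (ξ γ), s1 β α (ξ γ), s1 α γ (ξ β), t1 γ α β, t1 γ β α]
  -- Normality at (ξ_α, ξ_β): its right side is zero because φξ_β = 0, and the left side adds up to
  -- 2φ²(N_β ξ_α).
  have s4 : φ (φ (N β (ξ α))) = 0 := by
    have h1 := hh (ξ α) (ξ β)
    have e1 := eq_neg_of_add_eq_zero_left (he (ξ α) β)
    have e2 := eq_neg_of_add_eq_zero_left (he (ξ β) α)
    rw [h.φ_ξ, h.φ_ξ, e1, e2, s2 α β] at h1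
    simp only [map_zero, zero_apply, map_neg, neg_neg, zero_smul, Finset.sum_const_zero,
      smul_zero, sub_zero, zero_sub] at h1
    have h2 : (2 : ℝ) • φ (φ (N β (ξ α))) = 0 := by rw [two_smul]; exact h1
    simpa using h2
  rw [h.eq_neg_φ_φ_add (N β (ξ α)), s4]
  simp [s3]

/-- By `hb` the antisymmetric part of N_α is -φ, so the claim is that the symmetric part h vanishes
(ξ_α is Killing). Closedness at ξ_α together with `hd` gives ∇_{ξ_α} φ = -(hφ + φh) (this is `pa`),
and normality at (u, ξ_α) then reduces to φhφ = 0 (this is `key`). On the ξ_β the value is zero by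
`N_ξ`. -/
theorem N_eq (h : IsFramedAlgebra g φ ξ η)
    (hb : ∀ α u v, g (N α u) v - g (N α v) u = 2 * g u (φ v))
    (hd : ∀ α u v, g (N α u) (φ v) + η α (P u v) = 0)
    (he : ∀ u α, P u (ξ α) + φ (N α u) = 0)
    (hf : ∀ α β u, g (N α u) (ξ β) + g (N β u) (ξ α) = 0)
    (hh : ∀ u v, P (φ u) v - P (φ v) u - φ (P u v) + φ (P v u)
      = (-2 : ℝ) • ∑ α, g u (φ v) • ξ α)
    (hi : ∀ u v w, g v (P u w) + g w (P v u) + g u (P w v) = 0) (α : Fin s) (u : E) :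
    N α u = -φ u := by
  have hNξ := h.N_ξ hb he hf hh
  have s5 : ∀ u β, g (N α u) (ξ β) = 0 := by
    intro u β
    have := hb α u (ξ β)
    rw [h.φ_ξ, map_zero, hNξ] at this
    simpa using this
  have heN : ∀ u, P u (ξ α) = -φ (N α u) := fun u => eq_neg_of_add_eq_zero_left (he u α)
  have pa : ∀ v w, g v (P (ξ α) w) = g w (φ (N α v)) + g (N α w) (φ v) := by
    intro v w
    have h1 := hi (ξ α) v w
    have h2 := hd α w v
    rw [h.η_eq, h.symm _ (ξ α)] at h2
    rw [heN, map_neg] at h1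
    linarith
  have key : ∀ u v, g (N α (φ u)) (φ v) = g (-φ (φ u)) (φ v) := by
    intro u v
    have h1 := congrArg (fun a => g a v) (hh u (ξ α))
    simp only [h.φ_ξ, heN, map_zero, zero_apply, map_neg, sub_zero, zero_smul, smul_zero,
      Finset.sum_const_zero, map_add, add_apply, neg_apply,
      sub_neg_eq_add] at h1
    have h2 := pa (φ v) u
    have h3 := hb α (φ u) (φ v)
    have e1 := h.skew (P (ξ α) u) v
    have e2 := h.skew (N α (φ u)) v
    have e3 := h.skew (φ (N α u)) v
    have e4 := h.skew (N α u) (φ v)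
    have e5 := h.skew u (N α (φ v))
    have e6 := h.symm (φ u) (N α (φ v))
    have e7 := h.symm (P (ξ α) u) (φ v)
    have e8 := h.skew (φ u) (φ v)
    rw [map_neg, neg_apply]
    linarith
  have hφ : ∀ u, N α (φ u) = -φ (φ u) := by
    intro u
    refine h.ext' (key u) fun β => ?_
    rw [s5, map_neg, neg_apply, h.g_φ_ξ, neg_zero]
  conv_lhs => rw [h.eq_neg_φ_φ_add u]
  simp [hφ, hNξ, h.φ_φ_φ]

/-- The analogue of the fact that an integrable almost Hermitian structure with closed fundamental
form has parallel J: normality, closedness and the derivative of the formula for φ² determine P. The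
right side is what the ξ_α-components contribute. -/
theorem P_eq (h : IsFramedAlgebra g φ ξ η) (hN : ∀ α u, N α u = -φ u)
    (hc : ∀ u v, P u (φ v) + φ (P u v) = ∑ α, (g (N α u) v • ξ α + η α v • N α u))
    (he : ∀ u α, P u (ξ α) + φ (N α u) = 0)
    (hg : ∀ u v w, g (P u v) w = -g v (P u w))
    (hh : ∀ u v, P (φ u) v - P (φ v) u - φ (P u v) + φ (P v u)
      = (-2 : ℝ) • ∑ α, g u (φ v) • ξ α)
    (hi : ∀ u v w, g v (P u w) + g w (P v u) + g u (P w v) = 0) (u v : E) :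
    P u v = ∑ α, (g (φ u) (φ v) • ξ α + η α v • φ (φ u)) := by
  let e : E → ℝ := fun w => ∑ α, η α w
  have eφ : ∀ w, e (φ w) = 0 := fun w => by simp [e, h.η_φ]
  have sk : ∀ u v w, g (P u v) w = -g (P u w) v := fun u v w => by rw [hg, h.symm]
  have cyc : ∀ u v w, g (P u w) v + g (P v u) w + g (P w v) u = 0 := by
    intro u v w
    have := hi u v w
    rw [h.symm v, h.symm w, h.symm u] at this
    exact this
  have c : ∀ u v w, g (P u (φ v)) w - g (P u v) (φ w) = -(g (φ u) v * e w) - g (φ u) w * e v := by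
    intro u v w
    have h1 := congrArg (fun a => g a w) (hc u v)
    simp only [hN, map_add, add_apply, h.skew (P u v) w, map_sum, map_smul, map_neg, neg_apply,
      smul_apply, _root_.sum_apply, smul_eq_mul, h.symm (ξ _) w, ← h.η_eq, Finset.sum_add_distrib,
      ← Finset.mul_sum, ← Finset.sum_mul, mul_neg, Finset.sum_neg_distrib] at h1
    simp only [e]
    linarith
  have hh' : ∀ u v w, g (P (φ u) v) w - g (P (φ v) u) w + g (P u v) (φ w) - g (P v u) (φ w)
      = -2 * (g u (φ v) * e w) := by
    intro u v w
    have h1 := congrArg (fun a => g a w) (hh u v)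
    simp only [map_add, map_sub, add_apply, _root_.sub_apply, h.skew (P u v) w, h.skew (P v u) w,
      map_sum, map_smul, smul_apply, _root_.sum_apply, smul_eq_mul, h.symm (ξ _) w, ← h.η_eq,
      ← Finset.mul_sum] at h1
    simp only [e]
    linarith
  have gφφ : ∀ u v, g (φ u) (φ (φ v)) = -g (φ u) v := by
    intro u v
    rw [h.φ_φ]
    simp [h.g_φ_ξ]
  -- Closedness on the triples (φu, v, w) and (φv, u, w), with normality at (u, v), isolates P w (φ
  -- v). Arguments in the image of φ suffice, since `he` and `hN` give the values on the ξ_α.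
  have key : ∀ w v u, g (P w (φ v)) u = -(g (φ w) v * e u) := by
    intro w v u
    have h1 := hh' u v w
    have c1 := cyc (φ u) v w
    have c2 := cyc (φ v) u w
    have k1 := c v u w
    have k2 := c u v w
    have k3 := c w u v
    have k4 := c w v u
    have k5 := sk v (φ u) w
    have k6 := sk u (φ v) w
    have k7 := sk w (φ v) u
    have k8 := sk w u (φ v)
    have k9 := sk w (φ u) v
    have e1 := h.skew u v
    have e2 := h.skew v u
    have e3 := h.skew w u
    have e4 := h.skew w v
    have s1 := h.symm (φ u) v
    have s2 := h.symm (φ u) w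
    have s3 := h.symm (φ v) w
    have s4 := h.symm (φ v) u
    have l1 := sk (φ u) w v
    have l2 := sk (φ v) w u
    have l3 := sk v w (φ u)
    have l4 := sk u w (φ v)
    have m1 : g (φ v) u = - g (φ u) v := by linarith
    have m2 : g u (φ v) = - g (φ u) v := by linarith
    have m3 : g (φ w) u = - g (φ u) w := by linarith
    have m4 : g (φ w) v = - g (φ v) w := by linarith
    simp only [m1, m2, m3, m4] at h1 k1 k2 k3 k4 ⊢
    linarith
  have hPφ : ∀ v, P u (φ v) = ∑ α, g (φ u) (φ (φ v)) • ξ α := by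
    intro v
    refine h.ext fun w => ?_
    rw [key u v w, gφφ]
    simp only [map_sum, map_smul, smul_apply, _root_.sum_apply, smul_eq_mul, h.symm (ξ _) w,
      ← h.η_eq, ← Finset.mul_sum, e]
    ring
  conv_lhs => rw [h.eq_neg_φ_φ_add v]
  have hξ : ∀ α, P u (ξ α) = φ (φ u) := by
    intro α
    rw [eq_neg_of_add_eq_zero_left (he u α), hN, map_neg, neg_neg]
  simp only [map_add, map_neg, hPφ, map_sum, map_smul, hξ, gφφ, Finset.sum_add_distrib, neg_smul,
    Finset.sum_neg_distrib, neg_neg]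

end FirstOrder
end IsFramedAlgebra
end PointwiseAlgebra
-- Covariant derivatives of the structure tensors of an 𝒮-structure
section LocalSStructure

set_option maxSynthPendingDepth 3

variable {E : Type*} [NormedAddCommGroup E] [NormedSpace ℝ E] {s : ℕ}

/-- The coordinate expression on an open set of an 𝒮-structure. -/
structure IsLocalSStructure (G : E → E →L[ℝ] E →L[ℝ] ℝ) (A : E → E →L[ℝ] E) (ξ : Fin s → E → E)
    (η : Fin s → E → E →L[ℝ] ℝ) (U : Set E) : Prop where
  metric : IsLocalMetric G U
  smooth_A : ContDiffOn ℝ ∞ A U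
  smooth_ξ : ∀ α, ContDiffOn ℝ ∞ (ξ α) U
  smooth_η : ∀ α, ContDiffOn ℝ ∞ (η α) U
  algebra : ∀ x ∈ U, IsFramedAlgebra (G x) (A x) (fun α => ξ α x) (fun α => η α x)
  d_η : ∀ α, ∀ x ∈ U, ∀ u v, coordExtDeriv (η α) x u v = G x u (A x v)
  nijenhuis : ∀ x ∈ U, ∀ u v, coordNijenhuis A x u v =
    (-2 : ℝ) • ∑ α, coordExtDeriv (η α) x u v • ξ α x

namespace IsLocalSStructure

open IsLocalMetric

variable {G : E → E →L[ℝ] E →L[ℝ] ℝ} {A : E → E →L[ℝ] E} {ξ : Fin s → E → E}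
  {η : Fin s → E → E →L[ℝ] ℝ} {U : Set E} {x : E}

theorem mem_nhds (h : IsLocalSStructure G A ξ η U) (hx : x ∈ U) : U ∈ nhds x :=
  h.metric.isOpen.mem_nhds hx

theorem contDiffAt_A (h : IsLocalSStructure G A ξ η U) (hx : x ∈ U) : ContDiffAt ℝ ∞ A x :=
  h.smooth_A.contDiffAt (h.mem_nhds hx)

theorem contDiffAt_ξ (h : IsLocalSStructure G A ξ η U) (hx : x ∈ U) (α : Fin s) :
    ContDiffAt ℝ ∞ (ξ α) x :=
  (h.smooth_ξ α).contDiffAt (h.mem_nhds hx)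

theorem contDiffAt_η (h : IsLocalSStructure G A ξ η U) (hx : x ∈ U) (α : Fin s) :
    ContDiffAt ℝ ∞ (η α) x :=
  (h.smooth_η α).contDiffAt (h.mem_nhds hx)

theorem hasFDerivAt_A (h : IsLocalSStructure G A ξ η U) (hx : x ∈ U) :
    HasFDerivAt A (fderiv ℝ A x) x :=
  ((h.contDiffAt_A hx).differentiableAt (by simp)).hasFDerivAt

theorem hasFDerivAt_ξ (h : IsLocalSStructure G A ξ η U) (hx : x ∈ U) (α : Fin s) :
    HasFDerivAt (ξ α) (fderiv ℝ (ξ α) x) x :=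
  ((h.contDiffAt_ξ hx α).differentiableAt (by simp)).hasFDerivAt

theorem hasFDerivAt_η (h : IsLocalSStructure G A ξ η U) (hx : x ∈ U) (α : Fin s) :
    HasFDerivAt (η α) (fderiv ℝ (η α) x) x :=
  ((h.contDiffAt_η hx α).differentiableAt (by simp)).hasFDerivAt

/-- The covariant derivative `∇ξ` as a linear map. -/
def nablaVec (G : E → E →L[ℝ] E →L[ℝ] ℝ) (X : E → E) (x : E) : E →L[ℝ] E :=
  fderiv ℝ X x + (christoffelL G x).flip (X x)

/-- The covariant derivative of a (1,1)-tensor field, `(u, v) ↦ (∇_u A) v`. -/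
def nablaEndo (G : E → E →L[ℝ] E →L[ℝ] ℝ) (A : E → E →L[ℝ] E) (x : E) : E →L[ℝ] E →L[ℝ] E :=
  fderiv ℝ A x + ((christoffelL G x).flip.comp (A x)).flip
    - (ContinuousLinearMap.compL ℝ E E E (A x)).comp (christoffelL G x)

theorem nablaVec_apply (X : E → E) (u : E) :
    nablaVec G X x u = fderiv ℝ X x u + christoffel G x u (X x) := rfl

theorem nablaEndo_apply (u v : E) :
    nablaEndo G A x u v =
      fderiv ℝ A x u v + christoffel G x u (A x v) - A x (christoffel G x u v) := rfl

theorem fderiv_A_apply (G : E → E →L[ℝ] E →L[ℝ] ℝ) (A : E → E →L[ℝ] E) (x u v : E) :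
    fderiv ℝ A x u v = nablaEndo G A x u v - christoffel G x u (A x v)
      + A x (christoffel G x u v) := by
  rw [nablaEndo_apply]; abel

theorem fderiv_A_const (h : IsLocalSStructure G A ξ η U) (hx : x ∈ U) (u v : E) :
    fderiv ℝ (fun y => A y v) x u = fderiv ℝ A x u v := by
  have h2 : HasFDerivAt (fun y => A y v) _ x := (h.hasFDerivAt_A hx).clm_apply (hasFDerivAt_const v x)
  rw [h2.fderiv]; simp

theorem differentiableAt_A_const (h : IsLocalSStructure G A ξ η U) (hx : x ∈ U) (v : E) :
    DifferentiableAt ℝ (fun y => A y v) x :=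
  ((h.hasFDerivAt_A hx).clm_apply (hasFDerivAt_const v x)).differentiableAt

theorem fderiv_η_const (h : IsLocalSStructure G A ξ η U) (hx : x ∈ U) (α : Fin s) (u v : E) :
    fderiv ℝ (fun y => η α y v) x u = fderiv ℝ (η α) x u v := by
  have h2 : HasFDerivAt (fun y => η α y v) _ x :=
    (h.hasFDerivAt_η hx α).clm_apply (hasFDerivAt_const v x)
  rw [h2.fderiv]; simp

variable [FiniteDimensional ℝ E]

theorem fderiv_η (h : IsLocalSStructure G A ξ η U) (hx : x ∈ U) (α : Fin s) (u v : E) :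
    fderiv ℝ (η α) x u v = η α x (christoffel G x u v) + G x (nablaVec G (ξ α) x u) v := by
  have e : (fun y => η α y v) =ᶠ[nhds x] fun y => G y v (ξ α y) := by
    filter_upwards [h.mem_nhds hx] with y hy using (h.algebra y hy).η_eq α v
  rw [← h.fderiv_η_const hx, e.fderiv_eq,
    h.metric.fderiv_metric_fields hx (differentiableAt_const v)
      (h.hasFDerivAt_ξ hx α).differentiableAt,
    (h.algebra x hx).η_eq, h.metric.symm x hx v, nablaVec_apply]
  simp [covField]

/-- From here to `nablaEndo_closed`, each lemma is the covariant derivative of one structure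
identity, or dη_α or normality rewritten with ∇. Together they supply the hypotheses `hb` to `hi` of
`N_eq` and `P_eq`. -/
theorem nablaVec_antisymm (h : IsLocalSStructure G A ξ η U) (hx : x ∈ U) (α : Fin s) (u v : E) :
    G x (nablaVec G (ξ α) x u) v - G x (nablaVec G (ξ α) x v) u = 2 * G x u (A x v) := by
  rw [← h.d_η α x hx, coordExtDeriv, h.fderiv_η hx, h.fderiv_η hx,
    h.metric.christoffel_symm hx v u]
  ring

theorem nablaEndo_φ_φ (h : IsLocalSStructure G A ξ η U) (hx : x ∈ U) (u v : E) :
    nablaEndo G A x u (A x v) + A x (nablaEndo G A x u v) =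
      ∑ α, (G x (nablaVec G (ξ α) x u) v • ξ α x + η α x v • nablaVec G (ξ α) x u) := by
  have e : (fun y => A y (A y v)) =ᶠ[nhds x] fun y => -v + ∑ α, η α y v • ξ α y := by
    filter_upwards [h.mem_nhds hx] with y hy using (h.algebra y hy).φ_φ v
  have hA := h.hasFDerivAt_A hx
  have d1 : HasFDerivAt (fun y => A y (A y v)) _ x :=
    hA.clm_apply (hA.clm_apply (hasFDerivAt_const v x))
  have d2 : HasFDerivAt (fun y => -v + ∑ α, η α y v • ξ α y) _ x :=
    (hasFDerivAt_const (-v) x).add (HasFDerivAt.fun_sum (u := Finset.univ) fun α _ =>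
      ((h.hasFDerivAt_η hx α).clm_apply (hasFDerivAt_const v x)).smul (h.hasFDerivAt_ξ hx α))
  have key := congrArg (fun l : E →L[ℝ] E => l u) e.fderiv_eq
  simp only [d1.fderiv, d2.fderiv] at key
  simp only [ContinuousLinearMap.comp_zero, zero_add, _root_.add_apply,
    ContinuousLinearMap.comp_apply, ContinuousLinearMap.flip_apply,
    _root_.sum_apply, _root_.smul_apply,
    ContinuousLinearMap.smulRight_apply, h.fderiv_η hx, add_smul, Finset.sum_add_distrib] at key
  have alg := (h.algebra x hx).φ_φ
  have e3 : christoffel G x u (A x (A x v)) =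
      -christoffel G x u v + ∑ α, η α x v • christoffel G x u (ξ α x) := by
    rw [alg]; simp only [← christoffelL_apply, map_add, map_neg, map_sum, map_smul]
  simp only [nablaEndo_apply, nablaVec_apply, map_add, map_sub, smul_add, e3,
    Finset.sum_add_distrib, alg (christoffel G x u v)] at key ⊢
  rw [← sub_eq_zero] at key ⊢
  rw [← key]
  simp only [add_apply, add_smul, Finset.sum_add_distrib]
  abel

theorem nablaVec_η_φ (h : IsLocalSStructure G A ξ η U) (hx : x ∈ U) (α : Fin s) (u v : E) :
    G x (nablaVec G (ξ α) x u) (A x v) + η α x (nablaEndo G A x u v) = 0 := by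
  have e : (fun y => η α y (A y v)) =ᶠ[nhds x] fun _ => 0 := by
    filter_upwards [h.mem_nhds hx] with y hy using (h.algebra y hy).η_φ α v
  have d1 : HasFDerivAt (fun y => η α y (A y v)) _ x :=
    (h.hasFDerivAt_η hx α).clm_apply ((h.hasFDerivAt_A hx).clm_apply (hasFDerivAt_const v x))
  have key := congrArg (fun l : E →L[ℝ] ℝ => l u) e.fderiv_eq
  simp only [d1.fderiv] at key
  have := (h.algebra x hx).η_φ α (christoffel G x u v)
  simp [h.fderiv_η hx] at key
  simp only [nablaEndo_apply, map_add, map_sub, this]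
  linarith

theorem nablaEndo_ξ (h : IsLocalSStructure G A ξ η U) (hx : x ∈ U) (u : E) (α : Fin s) :
    nablaEndo G A x u (ξ α x) + A x (nablaVec G (ξ α) x u) = 0 := by
  have e : (fun y => A y (ξ α y)) =ᶠ[nhds x] fun _ => 0 := by
    filter_upwards [h.mem_nhds hx] with y hy using (h.algebra y hy).φ_ξ α
  have d1 : HasFDerivAt (fun y => A y (ξ α y)) _ x :=
    (h.hasFDerivAt_A hx).clm_apply (h.hasFDerivAt_ξ hx α)
  have key := congrArg (fun l : E →L[ℝ] E => l u) e.fderiv_eq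
  simp only [d1.fderiv] at key
  simp at key
  simp only [nablaEndo_apply, nablaVec_apply, (h.algebra x hx).φ_ξ, map_add]
  rw [← christoffelL_apply G x u 0, map_zero]
  refine Eq.trans ?_ key
  abel

theorem nablaVec_η_ξ (h : IsLocalSStructure G A ξ η U) (hx : x ∈ U) (α β : Fin s) (u : E) :
    G x (nablaVec G (ξ α) x u) (ξ β x) + G x (nablaVec G (ξ β) x u) (ξ α x) = 0 := by
  have e : (fun y => G y (ξ α y) (ξ β y)) =ᶠ[nhds x] fun _ => if β = α then 1 else 0 := by
    filter_upwards [h.mem_nhds hx] with y hy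
    rw [← (h.algebra y hy).η_eq, (h.algebra y hy).η_ξ]
  have key := congrArg (fun l : E →L[ℝ] ℝ => l u) e.fderiv_eq
  simp only [h.metric.fderiv_metric_fields hx (h.hasFDerivAt_ξ hx α).differentiableAt
    (h.hasFDerivAt_ξ hx β).differentiableAt] at key
  rw [h.metric.symm x hx (nablaVec G (ξ β) x u)]
  simpa [nablaVec_apply, covField] using key

theorem nablaEndo_skew (h : IsLocalSStructure G A ξ η U) (hx : x ∈ U) (u v w : E) :
    G x (nablaEndo G A x u v) w = -G x v (nablaEndo G A x u w) := by
  have e : (fun y => G y (A y v) w) =ᶠ[nhds x] fun y => -G y v (A y w) := by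
    filter_upwards [h.mem_nhds hx] with y hy using (h.algebra y hy).skew v w
  have key := congrArg (fun l : E →L[ℝ] ℝ => l u) e.fderiv_eq
  simp only [fderiv_fun_neg, neg_apply, h.metric.fderiv_metric_fields hx
    (h.differentiableAt_A_const hx _) (differentiableAt_const _), h.metric.fderiv_metric_fields hx
    (differentiableAt_const _) (h.differentiableAt_A_const hx _), covField, h.fderiv_A_const hx,
    fderiv_A_apply G A x] at key
  have e1 := (h.algebra x hx).skew (christoffel G x u v) w
  have e2 := (h.algebra x hx).skew v (christoffel G x u w)
  simp [map_add, map_sub] at key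
  linarith

/-- Since the connection is torsion-free, the Christoffel terms cancel when partial derivatives in
the Nijenhuis tensor are replaced by covariant ones. -/
theorem nijenhuis_nablaEndo (h : IsLocalSStructure G A ξ η U) (hx : x ∈ U) (u v : E) :
    nablaEndo G A x (A x u) v - nablaEndo G A x (A x v) u - A x (nablaEndo G A x u v)
      + A x (nablaEndo G A x v u) = (-2 : ℝ) • ∑ α, G x u (A x v) • ξ α x := by
  have key := h.nijenhuis x hx u v
  simp only [h.d_η _ x hx] at key
  rw [← key]
  simp only [coordNijenhuis, VectorField.lieBracket, h.fderiv_A_const hx, nablaEndo_apply,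
    fderiv_fun_const]
  simp only [Pi.zero_apply, zero_apply, map_zero, map_sub, map_add, sub_zero, zero_sub, map_neg]
  rw [h.metric.christoffel_symm hx (A x u) (A x v), h.metric.christoffel_symm hx (A x v) u,
    h.metric.christoffel_symm hx (A x u) v, h.metric.christoffel_symm hx u v]
  abel

/-- The 2-form g(·, φ·) equals dη_α, hence is closed; at least one index α is needed for this. -/
theorem nablaEndo_closed (h : IsLocalSStructure G A ξ η U) (hs : 1 ≤ s) (hx : x ∈ U)
    (u v w : E) :
    G x v (nablaEndo G A x u w) + G x w (nablaEndo G A x v u) + G x u (nablaEndo G A x w v)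
      = 0 := by
  let α : Fin s := ⟨0, hs⟩
  have hη := differentiableAt_fderiv (h.contDiffAt_η hx α)
  have key : ∀ a b c : E, G x (christoffel G x a b) (A x c) + G x b (nablaEndo G A x a c)
      + G x b (A x (christoffel G x a c)) =
      (1 / 2) * (fderiv ℝ (fderiv ℝ (η α)) x a b c - fderiv ℝ (fderiv ℝ (η α)) x a c b) := by
    intro a b c
    have e : (fun y => G y b (A y c)) =ᶠ[nhds x]
        fun y => (1 / 2) * (fderiv ℝ (η α) y b c - fderiv ℝ (η α) y c b) := by
      filter_upwards [h.mem_nhds hx] with y hy using (h.d_η α y hy b c).symm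
    have d : HasFDerivAt (fun y => (1 / 2 : ℝ) * (fderiv ℝ (η α) y b c - fderiv ℝ (η α) y c b)) _ x :=
      (((hη.hasFDerivAt.clm_apply (hasFDerivAt_const b x)).clm_apply (hasFDerivAt_const c x)).sub
        ((hη.hasFDerivAt.clm_apply (hasFDerivAt_const c x)).clm_apply
          (hasFDerivAt_const b x))).const_mul (1 / 2)
    have k := congrArg (fun l : E →L[ℝ] ℝ => l a) e.fderiv_eq
    simp only [d.fderiv, h.metric.fderiv_metric_fields hx
      (differentiableAt_const _) (h.differentiableAt_A_const hx _), covField, h.fderiv_A_const hx,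
      fderiv_A_apply G A x] at k
    simp at k
    linarith
  have sk := (h.algebra x hx).skew
  have sy := fderiv_fderiv_symm (h.contDiffAt_η hx α)
  have k1 := key u v w
  have k2 := key v w u
  have k3 := key w u v
  rw [sy u v, sy v w, sy w u, h.metric.christoffel_symm hx u v,
    h.metric.christoffel_symm hx v w, h.metric.christoffel_symm hx w u] at *
  have q1 := sk v (christoffel G x u w)
  have q2 := sk w (christoffel G x v u)
  have q3 := sk u (christoffel G x w v)
  rw [h.metric.christoffel_symm hx w v] at q3
  rw [h.metric.symm x hx] at q1 q2 q3
  rw [h.metric.christoffel_symm hx w v] at *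
  linarith

/-- `∇_u ξ_α = -φ u`. -/
theorem nablaVec_ξ_eq (h : IsLocalSStructure G A ξ η U) (hs : 1 ≤ s) (hx : x ∈ U) (α : Fin s)
    (u : E) : nablaVec G (ξ α) x u = -A x u :=
  (h.algebra x hx).N_eq (N := fun α => nablaVec G (ξ α) x) (P := nablaEndo G A x)
    (h.nablaVec_antisymm hx) (h.nablaVec_η_φ hx) (h.nablaEndo_ξ hx) (h.nablaVec_η_ξ hx)
    (h.nijenhuis_nablaEndo hx) (h.nablaEndo_closed hs hx) α u

/-- `(∇_u φ) v = ∑_α (g(φu, φv) ξ_α + η_α(v) φ²u)`. -/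
theorem nablaEndo_eq (h : IsLocalSStructure G A ξ η U) (hs : 1 ≤ s) (hx : x ∈ U) (u v : E) :
    nablaEndo G A x u v =
      ∑ α, (G x (A x u) (A x v) • ξ α x + η α x v • A x (A x u)) :=
  (h.algebra x hx).P_eq (N := fun α => nablaVec G (ξ α) x) (P := nablaEndo G A x)
    (h.nablaVec_ξ_eq hs hx) (h.nablaEndo_φ_φ hx) (h.nablaEndo_ξ hx) (h.nablaEndo_skew hx)
    (h.nijenhuis_nablaEndo hx) (h.nablaEndo_closed hs hx) u v

end IsLocalSStructure
end LocalSStructure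
-- Curvature of 𝒮-space forms
/-- A Kähler curvature-like tensor whose holomorphic sectional curvature vanishes has vanishing
Jacobi operators. -/
theorem kahler_tensor_eq_zero {V : Type*} [AddCommGroup V] (K : V → V → V → V → ℝ) (J : V → V)
    (add : ∀ a a' b c d, K (a + a') b c d = K a b c d + K a' b c d)
    (antisymm : ∀ a b c d, K a b c d = -K b a c d)
    (pair : ∀ a b c d, K a b c d = K c d a b)
    (bianchi : ∀ a b c d, K a b c d + K b c a d + K c a b d = 0)
    (J_add : ∀ a b, J (a + b) = J a + J b) (J_J : ∀ a, J (J a) = -a)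
    (K_J : ∀ a b c d, K a b (J c) (J d) = K a b c d)
    (hol : ∀ a, K a (J a) a (J a) = 0) (x y w : V) : K x y x w = 0 := by
  have neg1 : ∀ a b c d, K (-a) b c d = -K a b c d := by
    intro a b c d
    have h0 : K 0 b c d = 0 := by
      have := add 0 0 b c d
      rw [add_zero] at this
      linarith
    have := add a (-a) b c d
    rw [add_neg_cancel, h0] at this
    linarith
  have add2 : ∀ a b b' c d, K a (b + b') c d = K a b c d + K a b' c d := by
    intro a b b' c d
    rw [antisymm, add, antisymm b, antisymm b']; ring
  have neg2 : ∀ a b c d, K a (-b) c d = -K a b c d := by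
    intro a b c d
    rw [antisymm, neg1, antisymm b, neg_neg]
  have add3 : ∀ a b c c' d, K a b (c + c') d = K a b c d + K a b c' d := by
    intro a b c c' d
    rw [pair, add, pair c, pair c']
  have neg3 : ∀ a b c d, K a b (-c) d = -K a b c d := by
    intro a b c d
    rw [pair, neg1, ← pair]
  have add4 : ∀ a b c d d', K a b c (d + d') = K a b c d + K a b c d' := by
    intro a b c d d'
    rw [pair, add2, pair c d, pair c d']
  have neg4 : ∀ a b c d, K a b c (-d) = -K a b c d := by
    intro a b c d
    rw [pair, neg2, ← pair]
  have K_J' : ∀ a b c d, K (J a) (J b) c d = K a b c d := fun a b c d => by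
    rw [pair, K_J, ← pair]
  have J_neg : ∀ a, J (-a) = -J a := by
    intro a
    have := J_J (J a)
    rw [J_J a] at this
    exact this
  have anti4 : ∀ a b c d, K a b c d = -K a b d c := fun a b c d => by
    rw [pair, antisymm, ← pair]
  -- Adding the hypothesis at x + y and at x - y keeps only the terms of even degree in y.
  have polar : ∀ x y, K x (J x) y (J y) + 2 * K x (J y) x (J y) = 0 := by
    intro x y
    have h1 := hol (x + y)
    have h2 := hol (x + -y)
    have h3 := hol x
    have h4 := hol y
    simp only [J_add, J_neg, add, add2, add3, add4, neg1, neg2, neg3, neg4] at h1 h2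
    have e1 : K y (J y) x (J x) = K x (J x) y (J y) := pair _ _ _ _
    have e2 : K y (J x) y (J x) = K x (J y) x (J y) := by
      rw [← K_J' y, ← K_J, J_J, neg2, neg4, antisymm, anti4]; ring
    have e3 : K y (J x) x (J y) = K x (J y) x (J y) := by
      rw [← K_J' y, J_J, neg2, antisymm]; ring
    have e4 : K x (J y) y (J x) = K x (J y) x (J y) := by
      rw [pair, e3]
    linarith
  -- Bianchi turns K(x, Jx, y, Jy) into K(x, Jy, x, Jy) + K(x, y, x, y).
  have relation : ∀ x y, 3 * K x (J y) x (J y) + K x y x y = 0 := by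
    intro x y
    have h1 := polar x y
    have h2 := bianchi x (J x) y (J y)
    have e1 : K (J x) y x (J y) = -K x (J y) x (J y) := by
      rw [← K_J' (J x), J_J, neg1]
    have e2 : K y x (J x) (J y) = - K x y x y := by
      rw [K_J, antisymm]
    linarith
  -- Replacing y by Jy exchanges the two terms of `relation`; the system 3p + q = 0, p + 3q = 0 has
  -- only the zero solution. Polarizing in y then finishes the proof.
  have sec : ∀ x y, K x y x y = 0 := by
    intro x y
    have h1 := relation x y
    have h2 := relation x (J y)
    rw [J_J, neg2, neg4] at h2
    linarith
  have h1 := sec x (y + w)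
  simp only [add2, add4, sec] at h1
  have := pair x y x w
  linarith

section SpaceForm

set_option maxSynthPendingDepth 3

variable {E : Type*} [NormedAddCommGroup E] [NormedSpace ℝ E] {s : ℕ}

namespace IsLocalMetric

variable {G : E → E →L[ℝ] E →L[ℝ] ℝ} {U : Set E} {x : E}

theorem covField_congr {X Y : E → E} (h : X =ᶠ[nhds x] Y) (u : E) :
    covField G X x u = covField G Y x u := by
  rw [covField, covField, h.fderiv_eq, h.self_of_nhds]

theorem covField_add {X Y : E → E} (hX : DifferentiableAt ℝ X x) (hY : DifferentiableAt ℝ Y x)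
    (u : E) : covField G (fun y => X y + Y y) x u = covField G X x u + covField G Y x u := by
  simp only [covField, fderiv_fun_add hX hY, add_apply, ← christoffelL_apply, map_add]
  abel

theorem covField_sum {ι : Type*} {t : Finset ι} {X : ι → E → E}
    (hX : ∀ i ∈ t, DifferentiableAt ℝ (X i) x) (u : E) :
    covField G (fun y => ∑ i ∈ t, X i y) x u = ∑ i ∈ t, covField G (X i) x u := by
  simp only [covField, fderiv_fun_sum hX, _root_.sum_apply, ← christoffelL_apply, map_sum,
    Finset.sum_add_distrib]

theorem covField_smul {f : E → ℝ} {X : E → E} (hf : DifferentiableAt ℝ f x)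
    (hX : DifferentiableAt ℝ X x) (u : E) :
    covField G (fun y => f y • X y) x u = fderiv ℝ f x u • X x + f x • covField G X x u := by
  simp only [covField, fderiv_fun_smul hf hX, add_apply, smul_apply, ← christoffelL_apply,
    map_smul, ContinuousLinearMap.smulRight_apply, smul_add]
  abel

theorem covField_neg (X : E → E) (u : E) :
    covField G (fun y => -X y) x u = -covField G X x u := by
  simp only [covField, fderiv_fun_neg, neg_apply, ← christoffelL_apply, map_neg]
  abel

end IsLocalMetric

namespace IsLocalSStructure

open IsLocalMetric

variable {G : E → E →L[ℝ] E →L[ℝ] ℝ} {A : E → E →L[ℝ] E} {ξ : Fin s → E → E}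
  {η : Fin s → E → E →L[ℝ] ℝ} {U : Set E} {x : E}

theorem covField_A (h : IsLocalSStructure G A ξ η U) (hx : x ∈ U) {X : E → E}
    (hX : DifferentiableAt ℝ X x) (u : E) :
    covField G (fun y => A y (X y)) x u = nablaEndo G A x u (X x) + A x (covField G X x u) := by
  have d : HasFDerivAt (fun y => A y (X y)) _ x := (h.hasFDerivAt_A hx).clm_apply hX.hasFDerivAt
  simp only [covField, d.fderiv, nablaEndo_apply, map_add, add_apply,
    ContinuousLinearMap.comp_apply, ContinuousLinearMap.flip_apply]
  abel

variable [FiniteDimensional ℝ E]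

/-- `R(u, v)ξ_α = ∑_β (η_β(u) φ²v - η_β(v) φ²u)`. -/
theorem curvature_ξ (h : IsLocalSStructure G A ξ η U) (hs : 1 ≤ s) (hx : x ∈ U) (α : Fin s)
    (u v : E) : coordCurvature G x u v (ξ α x) =
      ∑ β, (η β x u • A x (A x v) - η β x v • A x (A x u)) := by
  have key : ∀ a b, covField G (fun y => covField G (ξ α) y a) x b =
      -(nablaEndo G A x b a + A x (christoffel G x b a)) := by
    intro a b
    have e : (fun y => covField G (ξ α) y a) =ᶠ[nhds x] fun y => -A y a := by
      filter_upwards [h.mem_nhds hx] with y hy using h.nablaVec_ξ_eq hs hy α a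
    rw [covField_congr e, covField_neg, h.covField_A hx (differentiableAt_const a)]
    simp [covField]
  rw [h.metric.ricci_identity hx (h.contDiffAt_ξ hx α), key, key, h.nablaEndo_eq hs hx,
    h.nablaEndo_eq hs hx, h.metric.christoffel_symm hx v u, h.metric.symm x hx (A x v)]
  simp only [Finset.sum_add_distrib, Finset.sum_sub_distrib]
  abel

/-- The commutator of `R(u, v)` and `φ` on the orthogonal complement of the `ξ_α`. -/
theorem riemann_φ (h : IsLocalSStructure G A ξ η U) (hs : 1 ≤ s) (hx : x ∈ U) {u v w z : E}
    (hu : ∀ α, η α x u = 0) (hv : ∀ α, η α x v = 0) (hw : ∀ α, η α x w = 0)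
    (hz : ∀ α, η α x z = 0) :
    riemann G x u v (A x w) z + riemann G x u v w (A x z) =
      s * (G x u w * G x (A x v) z - G x v w * G x (A x u) z + G x (A x u) w * G x v z
        - G x (A x v) w * G x u z) := by
  have alg := h.algebra x hx
  have hξz : ∀ α, G x (ξ α x) z = 0 := fun α => by rw [alg.symm, ← alg.η_eq, hz]
  have hAA : ∀ a, (∀ α, η α x a = 0) → A x (A x a) = -a := fun a ha => by
    rw [alg.φ_φ]; simp [ha]
  have hP : ∀ a b, (∀ α, η α x a = 0) →
      G x (nablaEndo G A x a b) z = -((∑ α, η α x b) * G x a z) := by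
    intro a b ha
    rw [h.nablaEndo_eq hs hx]
    simp only [map_sum, map_add, map_smul, add_apply, smul_apply, _root_.sum_apply, smul_eq_mul,
      hξz, hAA a ha, map_neg, neg_apply, mul_zero, zero_add, Finset.sum_mul, mul_neg,
      Finset.sum_neg_distrib]
  have hΓ : ∀ b : E, DifferentiableAt ℝ (fun y => christoffel G y b w) x := fun b =>
    ((h.metric.differentiableAt_christoffelL hx).clm_apply (differentiableAt_const b)).clm_apply
      (differentiableAt_const w)
  -- The constant extension of w need not stay orthogonal to the ξ_α, so sums of η_α(Γ) appear. They
  -- are symmetric in a and b and drop out of the commutator.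
  have key : ∀ a b, (∀ α, η α x a = 0) → (∀ α, η α x b = 0) →
      G x (covField G (fun y => covField G (fun y' => A y' w) y b) x a) z =
        -(s * (G x b w * G x (A x a) z)) - (∑ α, η α x (christoffel G x a w)) * G x b z
          + s * (G x (A x a) w * G x b z) - (∑ α, η α x (christoffel G x b w)) * G x a z
          + G x (A x (covField G (fun y => christoffel G y b w) x a)) z := by
    intro a b ha hb
    have e : (fun y => covField G (fun y' => A y' w) y b) =ᶠ[nhds x] fun y =>
        (∑ α, (G y (A y b) (A y w) • ξ α y + η α y w • A y (A y b)))
          + A y (christoffel G y b w) := by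
      filter_upwards [h.mem_nhds hx] with y hy
      rw [h.covField_A hy (differentiableAt_const w), h.nablaEndo_eq hs hy]
      simp [covField]
    have dA := h.differentiableAt_A_const hx
    have dAA : DifferentiableAt ℝ (fun y => A y (A y b)) x :=
      (h.hasFDerivAt_A hx).differentiableAt.clm_apply (dA b)
    have dg : DifferentiableAt ℝ (fun y => G y (A y b) (A y w)) x :=
      ((h.metric.differentiableAt hx).clm_apply (dA b)).clm_apply (dA w)
    have dη : ∀ α, DifferentiableAt ℝ (fun y => η α y w) x := fun α =>
      (h.hasFDerivAt_η hx α).differentiableAt.clm_apply (differentiableAt_const w)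
    have dξ := fun α => (h.hasFDerivAt_ξ hx α).differentiableAt
    have d1 : ∀ α, DifferentiableAt ℝ (fun y => G y (A y b) (A y w) • ξ α y) x := fun α =>
      dg.smul (dξ α)
    have d2 : ∀ α, DifferentiableAt ℝ (fun y => η α y w • A y (A y b)) x := fun α =>
      (dη α).smul dAA
    have hξ : ∀ α, covField G (ξ α) x a = -A x a := fun α => h.nablaVec_ξ_eq hs hx α a
    have d12 : ∀ α ∈ Finset.univ, DifferentiableAt ℝ
        (fun y => G y (A y b) (A y w) • ξ α y + η α y w • A y (A y b)) x :=
      fun α _ => (d1 α).add (d2 α)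
    rw [covField_congr e, covField_add (DifferentiableAt.fun_sum d12)
      ((h.hasFDerivAt_A hx).differentiableAt.clm_apply (hΓ b)),
      covField_sum d12, h.covField_A hx (hΓ b)]
    have e2 : ∀ α, covField G (fun y => G y (A y b) (A y w) • ξ α y + η α y w • A y (A y b)) x a =
        fderiv ℝ (fun y => G y (A y b) (A y w)) x a • ξ α x + G x (A x b) (A x w) • (-A x a)
          + (η α x (christoffel G x a w) - G x (A x a) w) • (-b) := by
      intro α
      rw [covField_add (d1 α) (d2 α), covField_smul dg (dξ α), covField_smul (dη α) dAA,
        h.fderiv_η_const hx, h.fderiv_η hx, h.nablaVec_ξ_eq hs hx, hξ, hw, hAA b hb]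
      simp [sub_eq_add_neg]
    have hc : G x (A x b) (A x w) = G x b w := by
      rw [alg.compat b w]; simp [hb]
    simp only [e2, map_sum, map_add, map_smul, add_apply, smul_apply, _root_.sum_apply,
      smul_eq_mul, hξz, hP a _ ha, map_neg, neg_apply, mul_zero, zero_add, hc, map_nsmul,
      Finset.sum_add_distrib, Finset.sum_const, Finset.card_univ, Fintype.card_fin, nsmul_eq_mul,
      mul_neg, Finset.sum_neg_distrib, ← Finset.sum_mul, Finset.sum_sub_distrib]
    ring
  have hR : coordCurvature G x u v w =
      covField G (fun y => christoffel G y v w) x u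
        - covField G (fun y => christoffel G y u w) x v := by
    simp only [coordCurvature, covField]
    abel
  have hR' : riemann G x u v w (A x z) =
      -(G x (A x (covField G (fun y => christoffel G y v w) x u)) z
        - G x (A x (covField G (fun y => christoffel G y u w) x v)) z) := by
    rw [riemann, hR, alg.skew, alg.skew]
    simp only [map_sub, _root_.sub_apply]
    ring
  have hX : ContDiffAt ℝ ∞ (fun y => A y w) x := (h.contDiffAt_A hx).clm_apply contDiffAt_const
  rw [hR', riemann, h.metric.ricci_identity hx hX, map_sub, _root_.sub_apply, key u v hu hv,
    key v u hv hu]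
  ring

/-- `R(u, v)u` for `v` orthogonal to `u` and to the `ξ_α`, when the `φ`-sections have curvature
`c`. -/
theorem curvature_eq (h : IsLocalSStructure G A ξ η U) (hs : 1 ≤ s) (hx : x ∈ U) {c : ℝ}
    (hc : ∀ u, (∀ α, η α x u = 0) → riemann G x u (A x u) (A x u) u = c * G x u u ^ 2)
    {u v : E} (hv : ∀ α, η α x v = 0) (huv : G x u v = 0) :
    coordCurvature G x u v u =
      -((∑ α, η α x u) ^ 2 + (c + 3 * s) / 4 * G x (A x u) (A x u)) • v
        - (3 * (c - s) / 4 * G x (A x u) v) • A x u := by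
  have alg := h.algebra x hx
  have hG := h.metric
  let L : Submodule ℝ E := ⨅ α, (η α x).ker
  have hL : ∀ a, a ∈ L ↔ ∀ α, η α x a = 0 := by
    intro a
    simp [L, Submodule.mem_iInf]
  have hAA : ∀ a, (∀ α, η α x a = 0) → A x (A x a) = -a := fun a ha => by
    rw [alg.φ_φ]; simp [ha]
  have hAg : ∀ a b, (∀ α, η α x a = 0) → G x (A x a) (A x b) = G x a b := fun a b ha => by
    rw [alg.compat a b]; simp [ha]
  have curv_lin : ∀ a a' b d, coordCurvature G x (a + a') b d =
      coordCurvature G x a b d + coordCurvature G x a' b d := by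
    intro a a' b d
    simp only [hG.coordCurvature_eq hx, map_add, add_apply]
    abel
  have curv_lin3 : ∀ a b (t : Fin s → ℝ), coordCurvature G x a b (∑ α, t α • ξ α x) =
      ∑ α, t α • coordCurvature G x a b (ξ α x) := by
    intro a b t
    simp only [hG.coordCurvature_eq hx, map_sum, map_smul, ← Finset.sum_sub_distrib,
      ← Finset.sum_add_distrib, smul_add, smul_sub]
  have curv_add3 : ∀ a b d d', coordCurvature G x a b (d + d') =
      coordCurvature G x a b d + coordCurvature G x a b d' := by
    intro a b d d'
    simp only [hG.coordCurvature_eq hx, map_add]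
    abel
  -- the Jacobi operators on the complement of the `ξ_α`
  have jacobi : ∀ a b d, (∀ α, η α x a = 0) → (∀ α, η α x b = 0) → (∀ α, η α x d = 0) →
      riemann G x a b a d = (c + 3 * s) / 4 * (G x a b * G x a d - G x a a * G x b d)
        - 3 * (c - s) / 4 * (G x b (A x a) * G x (A x a) d) := by
    intro a b d ha hb hd
    -- The model tensor subtracted from R has coefficients (c+3s)/4 and (c-s)/4. Their difference s
    -- matches the failure of R to commute with φ in `riemann_φ`, and (c+3s)/4 + 3(c-s)/4 = c is the
    -- holomorphic curvature. On L the restriction of φ squares to -1.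
    let K : L → L → L → L → ℝ := fun a b d e => riemann G x a b d e
      - ((c + 3 * s) / 4 * (G x b d * G x a e - G x a d * G x b e)
        + (c - s) / 4 * (G x a (A x d) * G x (A x b) e - G x b (A x d) * G x (A x a) e
          + 2 * G x a (A x b) * G x (A x d) e))
    let J : L → L := fun a => ⟨A x a, (hL _).2 fun α => alg.η_φ α _⟩
    have mem : ∀ a : L, ∀ α, η α x a = 0 := fun a => (hL _).1 a.2
    have sk := alg.skew
    have sy := alg.symm
    have sw : ∀ a b, G x a (A x b) = -G x b (A x a) := fun a b => by rw [sy, sk]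
    have main := kahler_tensor_eq_zero K J
      (by
        intro a a' b d e
        simp only [K, riemann, Submodule.coe_add, curv_lin, map_add, add_apply]
        ring)
      (by
        intro a b d e
        simp only [K]
        rw [riemann_antisymm_left, sw b a]
        ring)
      (by
        intro a b d e
        simp only [K, sk]
        rw [hG.riemann_pair_symm hx a b d e, sw d a, sw e b, sw e a, sw d b, sy e a, sy d b,
          sy d a, sy e b]
        ring)
      (by
        intro a b d e
        simp only [K, sk]
        rw [sy d a, sy b a, sy d b, sw b a, sw d a, sw d b]
        linear_combination hG.riemann_bianchi hx a b d e)
      (fun a b => by ext; simp [J])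
      (fun a => by ext; simp [J, hAA _ (mem a)])
      (by
        intro a b d e
        have r := h.riemann_φ hs hx (mem a) (mem b) (mem d) (mem (J e))
        simp only [J, hAA _ (mem e), riemann, map_neg, sk] at r
        simp only [K, J, hAA _ (mem e), hAA _ (mem d), riemann, map_neg, sk]
        linear_combination r)
      (by
        intro a
        have r := hc a (mem a)
        rw [hG.riemann_antisymm_right hx] at r
        have z : G x (a : E) (A x a) = 0 := by linarith [sw a a]
        simp only [K, J, hAA _ (mem a), map_neg, sk, z]
        linear_combination -r)
      ⟨a, (hL _).2 ha⟩ ⟨b, (hL _).2 hb⟩ ⟨d, (hL _).2 hd⟩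
    simp only [K] at main
    rw [sw a b] at main
    rw [sy a b]
    have z : G x a (A x a) = 0 := by linarith [sw a a]
    rw [z] at main
    linear_combination main
  -- Jacobi operators are known only for vectors orthogonal to the ξ_α. The u in the third slot is
  -- split as u₀ + Z; pair symmetry then brings the u of the first slot to the third one, where it
  -- is split in turn.
  let Z : E := ∑ α, η α x u • ξ α x
  let u₀ : E := u - Z
  have hu : u = u₀ + Z := by simp [u₀]
  have hu₀ : ∀ α, η α x u₀ = 0 := by
    intro α
    simp [u₀, Z, alg.η_ξ]
  have hAu : A x u₀ = A x u := by simp [u₀, Z, alg.φ_ξ]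
  have hZL : ∀ d, (∀ α, η α x d = 0) → G x Z d = 0 := by
    intro d hd
    simp only [Z, map_sum, map_smul, _root_.sum_apply, smul_apply, alg.symm (ξ _ x) d,
      ← alg.η_eq, hd, smul_zero, Finset.sum_const_zero]
  have hRZ : ∀ a b d, (∀ α, η α x b = 0) → riemann G x a b Z d =
      -((∑ α, η α x u) * (∑ α, η α x a) * G x b d) := by
    intro a b d hb
    simp only [riemann, Z, curv_lin3, h.curvature_ξ hs hx, hb, hAA b hb, zero_smul, sub_zero,
      map_sum, map_smul, _root_.sum_apply, smul_apply, smul_eq_mul, map_neg, neg_apply, mul_neg,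
      Finset.sum_neg_distrib, ← Finset.sum_mul]
    ring
  have hRu : ∀ a b d, riemann G x a b u d = riemann G x a b u₀ d + riemann G x a b Z d := by
    intro a b d
    conv_lhs => rw [hu, riemann, curv_add3, map_add, add_apply]
    rfl
  refine alg.ext' (fun w' => ?_) fun α => ?_
  · have hd : ∀ α, η α x (A x w') = 0 := fun α => alg.η_φ α w'
    generalize A x w' = d at hd
    have e1 := hRu u v d
    have e2 := hRu u₀ d v
    have e3 := hRZ u v d hv
    have e4 := hRZ u₀ d v hd
    have e5 := jacobi u₀ d v hu₀ hd hv
    have e6 : G x u₀ v = 0 := by simp only [u₀, map_sub, _root_.sub_apply, huv, hZL v hv, sub_zero]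
    have e7 : G x (A x u) (A x u) = G x u₀ u₀ := by rw [← hAu, hAg _ _ hu₀]
    rw [← hG.riemann_pair_symm hx] at e2
    simp only [hu₀, Finset.sum_const_zero, mul_zero, zero_mul, neg_zero] at e4
    rw [e6, hAu] at e5
    simp only [map_sub, map_smul, _root_.sub_apply, smul_apply, smul_eq_mul]
    rw [alg.symm v d] at e3
    rw [e7, alg.symm (A x u) d, alg.symm v d]
    change riemann G x u v u d = _
    rw [e1, e2, e3, e4, e5]
    ring
  · have e1 : riemann G x u v u (ξ α x) = 0 := by
      rw [hG.riemann_antisymm_right hx, riemann, h.curvature_ξ hs hx]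
      simp [hv, hAA v hv, alg.symm v u, huv]
    change riemann G x u v u (ξ α x) = _
    rw [e1]
    simp [alg.g_φ_ξ, ← alg.η_eq, hv]

end IsLocalSStructure
end SpaceForm
-- Charts and the coordinate expressions of tensors
section ChartExpressions

set_option maxSynthPendingDepth 3

variable {E : Type*} [NormedAddCommGroup E] [NormedSpace ℝ E]
  {M : Type*} [TopologicalSpace M] [ChartedSpace E M]

theorem exists_extChartAt_symm_eq (q : M) {p : M} (hp : p ∈ (extChartAt 𝓘(ℝ, E) q).source) :
    ∃ y ∈ (extChartAt 𝓘(ℝ, E) q).target, (extChartAt 𝓘(ℝ, E) q).symm y = p :=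
  ⟨_, (extChartAt 𝓘(ℝ, E) q).map_source hp, (extChartAt 𝓘(ℝ, E) q).left_inv hp⟩

theorem formIn_apply (η : ∀ p : M, TangentSpace 𝓘(ℝ, E) p →L[ℝ] ℝ) (q : M) (y u : E) :
    formIn η q y u = η _ (chartSymmD q y u) := rfl

theorem endoIn_apply
    (A : ∀ p : M, TangentSpace 𝓘(ℝ, E) p →L[ℝ] TangentSpace 𝓘(ℝ, E) p) (q : M) (y u : E) :
    endoIn A q y u = chartD q _ (A _ (chartSymmD q y u)) := rfl

theorem vectorIn_extChartAt (X : ∀ p : M, TangentSpace 𝓘(ℝ, E) p) (q : M) {p : M}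
    (hp : p ∈ (extChartAt 𝓘(ℝ, E) q).source) :
    vectorIn X q (extChartAt 𝓘(ℝ, E) q p) = chartD q p (X p) := by
  obtain ⟨y, hy, rfl⟩ := exists_extChartAt_symm_eq q hp
  rw [(extChartAt 𝓘(ℝ, E) q).right_inv hy, vectorIn]

variable [IsManifold 𝓘(ℝ, E) ∞ M]

theorem chartD_chartSymmD (q : M) {y : E} (hy : y ∈ (extChartAt 𝓘(ℝ, E) q).target) (u : E) :
    chartD q _ (chartSymmD q y u) = u := by
  have : IsManifold 𝓘(ℝ, E) 1 M := IsManifold.of_le (n := ∞) (by simp)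
  have h := mfderiv_extChartAt_comp_mfderivWithin_extChartAt_symm (I := 𝓘(ℝ, E)) hy
  rw [ModelWithCorners.range_eq_univ, mfderivWithin_univ] at h
  exact congrArg (fun l => l u) h

theorem chartSymmD_chartD (q : M) {y : E} (hy : y ∈ (extChartAt 𝓘(ℝ, E) q).target)
    (X : TangentSpace 𝓘(ℝ, E) ((extChartAt 𝓘(ℝ, E) q).symm y)) :
    chartSymmD q y (chartD q _ X) = X := by
  have : IsManifold 𝓘(ℝ, E) 1 M := IsManifold.of_le (n := ∞) (by simp)
  have h := mfderivWithin_extChartAt_symm_comp_mfderiv_extChartAt (I := 𝓘(ℝ, E)) hy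
  rw [ModelWithCorners.range_eq_univ, mfderivWithin_univ] at h
  exact congrArg (fun l => l X) h

theorem isInvertible_chartD (q : M) {p : M} (hp : p ∈ (extChartAt 𝓘(ℝ, E) q).source) :
    (chartD (E := E) q p).IsInvertible := by
  have : IsManifold 𝓘(ℝ, E) 1 M := IsManifold.of_le (n := ∞) (by simp)
  exact isInvertible_mfderiv_extChartAt hp

theorem chartD_inverse (q : M) {p : M} (hp : p ∈ (extChartAt 𝓘(ℝ, E) q).source) (u : E) :
    chartD q p ((chartD (E := E) q p).inverse u) = u := by
  obtain ⟨e, he⟩ := isInvertible_chartD q hp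
  rw [← he, ContinuousLinearMap.inverse_equiv]
  simp

theorem chartD_injective (q : M) {p : M} (hp : p ∈ (extChartAt 𝓘(ℝ, E) q).source)
    {X Y : TangentSpace 𝓘(ℝ, E) p} (h : chartD q p X = chartD q p Y) : X = Y := by
  obtain ⟨e, he⟩ := isInvertible_chartD q hp
  rw [← he] at h
  exact e.injective h

theorem metricIn_apply (g : Metric E M) (q : M) (y u v : E) :
    metricIn g q y u v =
      g.inner ((extChartAt 𝓘(ℝ, E) q).symm y) (chartSymmD q y u) (chartSymmD q y v) := rfl

theorem metricIn_chartD (g : Metric E M) (q : M) {p : M}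
    (hp : p ∈ (extChartAt 𝓘(ℝ, E) q).source) (X Y : TangentSpace 𝓘(ℝ, E) p) :
    metricIn g q (extChartAt 𝓘(ℝ, E) q p) (chartD q p X) (chartD q p Y) = g.inner p X Y := by
  obtain ⟨y, hy, rfl⟩ := exists_extChartAt_symm_eq q hp
  rw [(extChartAt 𝓘(ℝ, E) q).right_inv hy, metricIn_apply, chartSymmD_chartD q hy,
    chartSymmD_chartD q hy]

theorem formIn_chartD (η : ∀ p : M, TangentSpace 𝓘(ℝ, E) p →L[ℝ] ℝ) (q : M) {p : M}
    (hp : p ∈ (extChartAt 𝓘(ℝ, E) q).source) (X : TangentSpace 𝓘(ℝ, E) p) :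
    formIn η q (extChartAt 𝓘(ℝ, E) q p) (chartD q p X) = η p X := by
  obtain ⟨y, hy, rfl⟩ := exists_extChartAt_symm_eq q hp
  rw [(extChartAt 𝓘(ℝ, E) q).right_inv hy, formIn_apply, chartSymmD_chartD q hy]

theorem endoIn_chartD
    (A : ∀ p : M, TangentSpace 𝓘(ℝ, E) p →L[ℝ] TangentSpace 𝓘(ℝ, E) p) (q : M) {p : M}
    (hp : p ∈ (extChartAt 𝓘(ℝ, E) q).source) (X : TangentSpace 𝓘(ℝ, E) p) :
    endoIn A q (extChartAt 𝓘(ℝ, E) q p) (chartD q p X) = chartD q p (A p X) := by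
  obtain ⟨y, hy, rfl⟩ := exists_extChartAt_symm_eq q hp
  rw [(extChartAt 𝓘(ℝ, E) q).right_inv hy, endoIn_apply, chartSymmD_chartD q hy]

/-- The fibre component of a tangent vector in the trivialization at `q`. -/
theorem trivializationAt_apply_snd (q : M) {p : M} (hp : p ∈ (chartAt E q).source)
    (X : TangentSpace 𝓘(ℝ, E) p) :
    (trivializationAt E (TangentSpace 𝓘(ℝ, E)) q (⟨p, X⟩ : TangentBundle 𝓘(ℝ, E) M)).2
      = chartD q p X := by
  have : IsManifold 𝓘(ℝ, E) 1 M := IsManifold.of_le (n := ∞) (by simp)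
  have h := TangentBundle.continuousLinearMapAt_trivializationAt (𝕜 := ℝ) (I := 𝓘(ℝ, E)) hp
  have h2 := congrArg (fun l => l X) h
  have hb : p ∈ (trivializationAt E (TangentSpace 𝓘(ℝ, E)) q).baseSet := hp
  rw [Bundle.Trivialization.continuousLinearMapAt_apply,
    Bundle.Trivialization.coe_linearMapAt_of_mem _ hb] at h2
  exact h2

theorem isLocalMetric_metricIn [FiniteDimensional ℝ E] (g : Metric E M) (q : M) :
    IsLocalMetric (metricIn g q) (extChartAt 𝓘(ℝ, E) q).target where
  isOpen := isOpen_extChartAt_target q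
  symm := fun x _ u v => g.symm _ _ _
  pos := fun x hx u hu => by
    refine g.pos _ _ fun h0 => hu ?_
    change chartSymmD q x u = 0 at h0
    rw [← chartD_chartSymmD q hx u, h0, map_zero]
  smooth := by
    rw [contDiffOn_clm_apply]
    intro u
    rw [contDiffOn_clm_apply]
    intro v y hy
    -- The coordinate field with constant value w is a smooth section, being constant in the
    -- trivialization at q; the metric paired with two such sections gives the coefficients.
    have hsection : ∀ w : E, ContMDiffWithinAt 𝓘(ℝ, E) 𝓘(ℝ, E).tangent ∞
        (fun z => (⟨(extChartAt 𝓘(ℝ, E) q).symm z, chartSymmD q z w⟩ : TangentBundle 𝓘(ℝ, E) M))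
        (extChartAt 𝓘(ℝ, E) q).target y := by
      intro w
      have hsrc : ∀ z ∈ (extChartAt 𝓘(ℝ, E) q).target,
          (extChartAt 𝓘(ℝ, E) q).symm z ∈ (chartAt E q).source := by
        intro z hz
        have := (extChartAt 𝓘(ℝ, E) q).map_target hz
        rwa [extChartAt_source] at this
      rw [(trivializationAt E (TangentSpace 𝓘(ℝ, E)) q).contMDiffWithinAt_iff]
      · refine ⟨contMDiffOn_extChartAt_symm q y hy, ?_⟩
        refine (contMDiffWithinAt_const (c := w)).congr (fun z hz => ?_) ?_
        · rw [trivializationAt_apply_snd q (hsrc z hz), chartD_chartSymmD q hz]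
        · rw [trivializationAt_apply_snd q (hsrc y hy), chartD_chartSymmD q hy]
      · exact ((trivializationAt E (TangentSpace 𝓘(ℝ, E)) q).mem_source).2 (hsrc y hy)
    have hsymm : ContMDiffWithinAt 𝓘(ℝ, E) 𝓘(ℝ, E) ∞ (extChartAt 𝓘(ℝ, E) q).symm
        (extChartAt 𝓘(ℝ, E) q).target y := contMDiffOn_extChartAt_symm q y hy
    have key := ContMDiffWithinAt.clm_bundle_apply₂ (F₁ := E) (F₂ := E) (F₃ := ℝ)
      (E₁ := fun p : M => TangentSpace 𝓘(ℝ, E) p) (E₂ := fun p : M => TangentSpace 𝓘(ℝ, E) p)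
      (E₃ := Bundle.Trivial M ℝ) (b := (extChartAt 𝓘(ℝ, E) q).symm)
      (ContMDiffAt.comp_contMDiffWithinAt y g.contMDiff.contMDiffAt hsymm)
      (hsection u) (hsection v)
    rw [Bundle.contMDiffWithinAt_totalSpace] at key
    exact key.2.contDiffWithinAt

end ChartExpressions
-- Transfer of the curvature formula from charts to the manifold
section ManifoldToLocal

set_option maxSynthPendingDepth 3

variable {E : Type*} [NormedAddCommGroup E] [NormedSpace ℝ E] [FiniteDimensional ℝ E]
  {M : Type*} [TopologicalSpace M] [ChartedSpace E M] [IsManifold 𝓘(ℝ, E) ∞ M] {m s : ℕ}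

open FramedMetricStructure IsLocalMetric IsLocalSStructure

/-- The expression of an 𝒮-structure in a chart. -/
theorem FramedMetricStructure.IsSStructure.isLocalSStructure
    {S : FramedMetricStructure E M m s} (hS : S.IsSStructure) (q : M) :
    IsLocalSStructure (metricIn S.g q) (endoIn S.φ q) (fun α => vectorIn (S.ξ α) q)
      (fun α => formIn (S.η α) q) (extChartAt 𝓘(ℝ, E) q).target where
  metric := isLocalMetric_metricIn S.g q
  smooth_A := S.smooth_φ q
  smooth_ξ := fun α => S.smooth_ξ α q
  smooth_η := fun α => S.smooth_η α q
  d_η := fun α => S.d_η α q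
  nijenhuis := hS q
  algebra := fun x hx => by
    have hA : ∀ u, chartSymmD q x (endoIn S.φ q x u) = S.φ _ (chartSymmD q x u) := fun u => by
      rw [endoIn_apply, chartSymmD_chartD q hx]
    have hξ : ∀ α, chartSymmD q x (vectorIn (S.ξ α) q x) = S.ξ α _ := fun α => by
      rw [vectorIn, chartSymmD_chartD q hx]
    refine
    { symm := fun u v => S.g.symm _ _ _
      pos := (isLocalMetric_metricIn S.g q).pos x hx
      φ_φ := fun u => ?_
      η_φ := fun α u => ?_
      η_ξ := fun α β => ?_
      φ_ξ := fun α => ?_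
      compat := fun u v => ?_
      η_eq := fun α u => ?_ }
    · rw [endoIn_apply, hA, S.φ_φ, map_add, map_neg, chartD_chartSymmD q hx, map_sum]
      simp only [map_smul, formIn_apply, vectorIn]
    · rw [formIn_apply, hA, S.η_φ]
    · rw [formIn_apply, hξ, S.η_ξ]
    · rw [endoIn_apply, hξ, S.φ_ξ, map_zero]
    · simp only [metricIn_apply, formIn_apply, hA]
      exact S.g_compat _ _ _
    · rw [formIn_apply, metricIn_apply, hξ, S.η_eq]

/-- The only curvature value that the bitension field requires: it is applied with u = T and v =
k₁V₂. -/
theorem curvature_smul_add {S : FramedMetricStructure E M m s} {c : ℝ} (hS : S.IsSSpaceForm c)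
    (hs : 1 ≤ s) (p : M) (u v : TangentSpace 𝓘(ℝ, E) p) (hv : ∀ α, S.η α p v = 0)
    (huv : S.g.inner p u v = 0) :
    curvature S.g p u v u =
      (-((∑ α, S.η α p u) ^ 2 + (c + 3 * s) / 4 * S.g.inner p (S.φ p u) (S.φ p u))) • v
        - (3 * (c - s) / 4 * S.g.inner p (S.φ p u) v) • S.φ p u := by
  have hp : p ∈ (extChartAt 𝓘(ℝ, E) p).source := mem_extChartAt_source p
  have hx : extChartAt 𝓘(ℝ, E) p p ∈ (extChartAt 𝓘(ℝ, E) p).target := mem_extChartAt_target p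
  have loc := hS.1.isLocalSStructure p
  have hD : ∀ u v w, chartD p p (curvature S.g p u v w) =
      coordCurvature (metricIn S.g p) (extChartAt 𝓘(ℝ, E) p p)
      (chartD p p u) (chartD p p v) (chartD p p w) := fun u v w => by
    rw [curvature, chartD_inverse p hp]
  have hc : ∀ u, (∀ α, formIn (S.η α) p (extChartAt 𝓘(ℝ, E) p p) u = 0) →
      riemann (metricIn S.g p) (extChartAt 𝓘(ℝ, E) p p) u
        (endoIn S.φ p (extChartAt 𝓘(ℝ, E) p p) u) (endoIn S.φ p (extChartAt 𝓘(ℝ, E) p p) u) u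
        = c * metricIn S.g p (extChartAt 𝓘(ℝ, E) p p) u u ^ 2 := by
    intro u' hu
    obtain ⟨X, rfl⟩ : ∃ X : TangentSpace 𝓘(ℝ, E) p, chartD p p X = u' :=
      ⟨_, chartD_inverse p hp u'⟩
    simp only [formIn_chartD _ _ hp] at hu
    rw [riemann, endoIn_chartD _ _ hp, ← hD, metricIn_chartD _ _ hp, metricIn_chartD _ _ hp]
    by_cases hX : X = 0
    · simp [hX]
    have h1 := hS.2 p X hX fun α => by rw [← S.η_eq, hu]
    have h2 : S.g.inner p X (S.φ p X) = 0 := by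
      have := (loc.algebra _ hx).skew (chartD p p X) (chartD p p X)
      rw [endoIn_chartD _ _ hp, metricIn_chartD _ _ hp, metricIn_chartD _ _ hp,
        S.g.symm] at this
      linarith
    have h3 : S.g.inner p (S.φ p X) (S.φ p X) = S.g.inner p X X := by
      rw [S.g_compat p X X]; simp [hu]
    have h4 := S.g.pos p X hX
    have h5 : S.g.inner p X X * S.g.inner p X X - 0 ^ 2 ≠ 0 := by
      have := mul_pos h4 h4
      rw [zero_pow two_ne_zero, sub_zero]
      exact this.ne'
    rw [sectionalCurvature, h2, h3, div_eq_iff h5] at h1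
    rw [h1]; ring
  apply chartD_injective p hp
  rw [hD, loc.curvature_eq hs hx hc (fun α => by rw [formIn_chartD _ _ hp, hv])
    (by rw [metricIn_chartD _ _ hp, huv])]
  simp only [map_sub, map_smul, formIn_chartD _ _ hp, endoIn_chartD _ _ hp,
    metricIn_chartD _ _ hp]

end ManifoldToLocal

/-! ### Covariant derivative along a curve -/

section Curves

set_option maxSynthPendingDepth 3

variable {E : Type*} [NormedAddCommGroup E] [NormedSpace ℝ E]
  {M : Type*} [TopologicalSpace M] [ChartedSpace E M]

/-- Differentiability at `t` of a vector field along a curve. -/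
def DifferentiableAlong (γ : ℝ → M) (V : ∀ t, TangentSpace 𝓘(ℝ, E) (γ t)) (t : ℝ) : Prop :=
  DifferentiableAt ℝ (fun τ => chartD (E := E) (γ t) (γ τ) (V τ)) t

variable {γ : ℝ → M} {V W : ∀ t, TangentSpace 𝓘(ℝ, E) (γ t)} {t : ℝ}

theorem DifferentiableAlong.congr (hW : DifferentiableAlong γ W t)
    (h : ∀ᶠ τ in nhds t, V τ = W τ) : DifferentiableAlong γ V t := by
  refine DifferentiableAt.congr_of_eventuallyEq hW ?_
  filter_upwards [h] with τ hτ
  rw [hτ]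

theorem DifferentiableAlong.add (hV : DifferentiableAlong γ V t)
    (hW : DifferentiableAlong γ W t) : DifferentiableAlong γ (fun τ => V τ + W τ) t := by
  simp only [DifferentiableAlong, map_add]
  exact DifferentiableAt.add hV hW

theorem DifferentiableAlong.smul {f : ℝ → ℝ} (hf : DifferentiableAt ℝ f t)
    (hV : DifferentiableAlong γ V t) : DifferentiableAlong γ (fun τ => f τ • V τ) t := by
  simp only [DifferentiableAlong, map_smul]
  exact DifferentiableAt.smul hf hV

theorem eventually_mem_extChartAt_source (hγ : ContinuousAt γ t) :
    ∀ᶠ τ in nhds t, γ τ ∈ (extChartAt 𝓘(ℝ, E) (γ t)).source :=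
  hγ.preimage_mem_nhds (extChartAt_source_mem_nhds (γ t))

variable [IsManifold 𝓘(ℝ, E) ∞ M]

theorem differentiableAlong_of_contMDiffOn {J : Set ℝ} (hJ : IsOpen J)
    (hV : ContMDiffOn 𝓘(ℝ, ℝ) 𝓘(ℝ, E).tangent ∞
      (fun t => (⟨γ t, V t⟩ : TangentBundle 𝓘(ℝ, E) M)) J) (ht : t ∈ J) :
    DifferentiableAlong γ V t := by
  have h := (hV t ht).contMDiffAt (hJ.mem_nhds ht)
  rw [Bundle.contMDiffAt_totalSpace] at h
  have h1 : ContinuousAt γ t := h.1.continuousAt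
  have h2 : (fun τ => chartD (E := E) (γ t) (γ τ) (V τ)) =ᶠ[nhds t] fun τ =>
      (trivializationAt E (TangentSpace 𝓘(ℝ, E)) (γ t)
        (⟨γ τ, V τ⟩ : TangentBundle 𝓘(ℝ, E) M)).2 := by
    filter_upwards [h1.preimage_mem_nhds
      ((chartAt E (γ t)).open_source.mem_nhds (mem_chart_source E (γ t)))] with τ hτ
    rw [trivializationAt_apply_snd _ hτ]
  exact ((h.2.contDiffAt).differentiableAt (by simp)).congr_of_eventuallyEq h2

/-- The coordinate velocity is the coordinate expression of the velocity. -/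
theorem hasDerivAt_extChartAt_comp (hγ : MDifferentiableAt 𝓘(ℝ, ℝ) 𝓘(ℝ, E) γ t) :
    HasDerivAt (fun τ => extChartAt 𝓘(ℝ, E) (γ t) (γ τ))
      (chartD (γ t) (γ t) (velocity E γ t)) t := by
  have : IsManifold 𝓘(ℝ, E) 1 M := IsManifold.of_le (n := ∞) (by simp)
  have h1 : MDifferentiableAt 𝓘(ℝ, E) 𝓘(ℝ, E) (extChartAt 𝓘(ℝ, E) (γ t)) (γ t) :=
    mdifferentiableAt_extChartAt (mem_chart_source E (γ t))
  let L : ℝ →L[ℝ] E := (mfderiv 𝓘(ℝ, E) 𝓘(ℝ, E) (extChartAt 𝓘(ℝ, E) (γ t)) (γ t)).comp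
    (mfderiv 𝓘(ℝ, ℝ) 𝓘(ℝ, E) γ t)
  have h2 : HasFDerivAt (fun τ => extChartAt 𝓘(ℝ, E) (γ t) (γ τ)) L t :=
    (h1.hasMFDerivAt.comp t hγ.hasMFDerivAt).hasFDerivAt
  exact h2.hasDerivAt

variable (g : Metric E M)

theorem chartD_covDeriv (hγ : MDifferentiableAt 𝓘(ℝ, ℝ) 𝓘(ℝ, E) γ t) :
    chartD (γ t) (γ t) (covDeriv g γ V t) =
      deriv (fun τ => chartD (E := E) (γ t) (γ τ) (V τ)) t
        + christoffel (metricIn g (γ t)) (extChartAt 𝓘(ℝ, E) (γ t) (γ t))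
          (chartD (γ t) (γ t) (velocity E γ t)) (chartD (γ t) (γ t) (V t)) := by
  rw [covDeriv, chartD_inverse _ (mem_extChartAt_source _), (hasDerivAt_extChartAt_comp hγ).deriv]

theorem covDeriv_congr (h : ∀ᶠ τ in nhds t, V τ = W τ) :
    covDeriv g γ V t = covDeriv g γ W t := by
  have h1 : (fun τ => chartD (E := E) (γ t) (γ τ) (V τ)) =ᶠ[nhds t]
      fun τ => chartD (E := E) (γ t) (γ τ) (W τ) := by
    filter_upwards [h] with τ hτ
    rw [hτ]
  simp only [covDeriv]
  rw [h1.deriv_eq, h.self_of_nhds]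

theorem covDeriv_add (hV : DifferentiableAlong γ V t) (hW : DifferentiableAlong γ W t) :
    covDeriv g γ (fun τ => V τ + W τ) t = covDeriv g γ V t + covDeriv g γ W t := by
  apply chartD_injective (γ t) (mem_extChartAt_source _)
  simp only [covDeriv, map_add, ← christoffelL_apply,
    chartD_inverse (γ t) (mem_extChartAt_source (γ t))]
  rw [deriv_fun_add hV hW]
  abel

theorem covDeriv_smul {f : ℝ → ℝ} (hf : DifferentiableAt ℝ f t)
    (hV : DifferentiableAlong γ V t) :
    covDeriv g γ (fun τ => f τ • V τ) t = deriv f t • V t + f t • covDeriv g γ V t := by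
  apply chartD_injective (γ t) (mem_extChartAt_source _)
  simp only [covDeriv, map_smul, map_add, ← christoffelL_apply,
    chartD_inverse (γ t) (mem_extChartAt_source (γ t))]
  rw [deriv_fun_smul hf hV, smul_add]
  abel

variable [FiniteDimensional ℝ E]

theorem hasDerivAt_inner (hγ : MDifferentiableAt 𝓘(ℝ, ℝ) 𝓘(ℝ, E) γ t)
    (hV : DifferentiableAlong γ V t) (hW : DifferentiableAlong γ W t) :
    HasDerivAt (fun τ => g.inner (γ τ) (V τ) (W τ))
      (g.inner (γ t) (covDeriv g γ V t) (W t) + g.inner (γ t) (V t) (covDeriv g γ W t)) t := by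
  have hp : γ t ∈ (extChartAt 𝓘(ℝ, E) (γ t)).source := mem_extChartAt_source (γ t)
  have hG := isLocalMetric_metricIn g (γ t)
  have hx := mem_extChartAt_target (I := 𝓘(ℝ, E)) (γ t)
  have e : (fun τ => g.inner (γ τ) (V τ) (W τ)) =ᶠ[nhds t] fun τ =>
      metricIn g (γ t) (extChartAt 𝓘(ℝ, E) (γ t) (γ τ)) (chartD (γ t) (γ τ) (V τ))
        (chartD (γ t) (γ τ) (W τ)) := by
    filter_upwards [eventually_mem_extChartAt_source (E := E) hγ.continuousAt] with τ hτ
    rw [metricIn_chartD g _ hτ]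
  have h1 := (hG.differentiableAt hx).hasFDerivAt.comp_hasDerivAt t (hasDerivAt_extChartAt_comp hγ)
  have h2 := (h1.clm_apply hV.hasDerivAt).clm_apply hW.hasDerivAt
  refine (h2.congr_of_eventuallyEq e).congr_deriv ?_
  rw [← metricIn_chartD g _ hp, ← metricIn_chartD g _ hp, chartD_covDeriv g hγ,
    chartD_covDeriv g hγ]
  simp only [Function.comp_apply, hG.fderiv_eq hx, map_add, add_apply]
  ring

variable {m s : ℕ} {S : FramedMetricStructure E M m s}

open FramedMetricStructure IsLocalMetric IsLocalSStructure

/-- The differentiability half is what `hasDerivAt_inner` requires in order to differentiate g(T,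
ξ_α). -/
theorem covDeriv_ξ (hS : S.IsSStructure) (hs : 1 ≤ s)
    (hγ : MDifferentiableAt 𝓘(ℝ, ℝ) 𝓘(ℝ, E) γ t) (α : Fin s) :
    DifferentiableAlong γ (fun τ => S.ξ α (γ τ)) t ∧
    covDeriv S.g γ (fun τ => S.ξ α (γ τ)) t = -S.φ (γ t) (velocity E γ t) := by
  have hp : γ t ∈ (extChartAt 𝓘(ℝ, E) (γ t)).source := mem_extChartAt_source (γ t)
  have hx := mem_extChartAt_target (I := 𝓘(ℝ, E)) (γ t)
  have loc := hS.isLocalSStructure (γ t)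
  have e : (fun τ => chartD (E := E) (γ t) (γ τ) (S.ξ α (γ τ))) =ᶠ[nhds t] fun τ =>
      vectorIn (S.ξ α) (γ t) (extChartAt 𝓘(ℝ, E) (γ t) (γ τ)) := by
    filter_upwards [eventually_mem_extChartAt_source (E := E) hγ.continuousAt] with τ hτ
    rw [vectorIn_extChartAt _ _ hτ]
  have h1 := ((loc.hasFDerivAt_ξ hx α).comp_hasDerivAt t
    (hasDerivAt_extChartAt_comp hγ)).congr_of_eventuallyEq e
  refine ⟨h1.differentiableAt, chartD_injective (γ t) hp ?_⟩
  rw [chartD_covDeriv S.g hγ, h1.deriv, map_neg, ← endoIn_chartD S.φ _ hp,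
    ← loc.nablaVec_ξ_eq hs hx α, nablaVec_apply, vectorIn_extChartAt _ _ hp]

theorem covDeriv_φ (hS : S.IsSStructure) (hs : 1 ≤ s)
    (hγ : MDifferentiableAt 𝓘(ℝ, ℝ) 𝓘(ℝ, E) γ t) (hV : DifferentiableAlong γ V t) :
    DifferentiableAlong γ (fun τ => S.φ (γ τ) (V τ)) t ∧
    covDeriv S.g γ (fun τ => S.φ (γ τ) (V τ)) t =
      ∑ α, (S.g.inner (γ t) (S.φ (γ t) (velocity E γ t)) (S.φ (γ t) (V t)) • S.ξ α (γ t)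
        + S.η α (γ t) (V t) • S.φ (γ t) (S.φ (γ t) (velocity E γ t)))
      + S.φ (γ t) (covDeriv S.g γ V t) := by
  have hp : γ t ∈ (extChartAt 𝓘(ℝ, E) (γ t)).source := mem_extChartAt_source (γ t)
  have hx := mem_extChartAt_target (I := 𝓘(ℝ, E)) (γ t)
  have loc := hS.isLocalSStructure (γ t)
  have e : (fun τ => chartD (E := E) (γ t) (γ τ) (S.φ (γ τ) (V τ))) =ᶠ[nhds t] fun τ =>
      endoIn S.φ (γ t) (extChartAt 𝓘(ℝ, E) (γ t) (γ τ)) (chartD (γ t) (γ τ) (V τ)) := by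
    filter_upwards [eventually_mem_extChartAt_source (E := E) hγ.continuousAt] with τ hτ
    rw [endoIn_chartD _ _ hτ]
  have d1 : HasDerivAt (fun τ => endoIn S.φ (γ t) (extChartAt 𝓘(ℝ, E) (γ t) (γ τ)))
      (fderiv ℝ (endoIn S.φ (γ t)) (extChartAt 𝓘(ℝ, E) (γ t) (γ t))
        (chartD (γ t) (γ t) (velocity E γ t))) t := by
    have d0 : HasFDerivAt (endoIn S.φ (γ t)) _ (extChartAt 𝓘(ℝ, E) (γ t) (γ t)) :=
      loc.hasFDerivAt_A hx
    exact d0.comp_hasDerivAt t (hasDerivAt_extChartAt_comp hγ)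
  have d2 : HasDerivAt (fun τ => chartD (E := E) (γ t) (γ τ) (V τ))
      (deriv (fun τ => chartD (E := E) (γ t) (γ τ) (V τ)) t) t := DifferentiableAt.hasDerivAt hV
  have h1 := (d1.clm_apply d2).congr_of_eventuallyEq e
  refine ⟨h1.differentiableAt, chartD_injective (γ t) hp ?_⟩
  have h2 := loc.nablaEndo_eq hs hx (chartD (γ t) (γ t) (velocity E γ t))
    (chartD (γ t) (γ t) (V t))
  rw [nablaEndo_apply] at h2
  simp only [formIn_chartD _ _ hp, endoIn_chartD _ _ hp, metricIn_chartD _ _ hp,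
    vectorIn_extChartAt _ _ hp] at h2
  rw [chartD_covDeriv S.g hγ, h1.deriv, map_add, map_sum, ← endoIn_chartD S.φ _ hp (covDeriv _ _ _ _),
    chartD_covDeriv S.g hγ]
  simp only [map_add, map_smul]
  rw [← h2]
  abel

end Curves
-- Bitension field of a slant Frenet curve and its frame components
section FrenetCurves

set_option maxSynthPendingDepth 3

variable {E : Type*} [NormedAddCommGroup E] [NormedSpace ℝ E]
  {M : Type*} [TopologicalSpace M] [ChartedSpace E M] [IsManifold 𝓘(ℝ, E) ∞ M]

namespace IsFrenetCurve

variable {g : Metric E M} {γ : ℝ → M} {J : Set ℝ} {r : ℕ}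
  {V : ℕ → ∀ t, TangentSpace 𝓘(ℝ, E) (γ t)} {k : ℕ → ℝ → ℝ} {t : ℝ}

theorem mdifferentiableAt (hF : IsFrenetCurve g γ J r V k) (hJ : IsOpen J) (ht : t ∈ J) :
    MDifferentiableAt 𝓘(ℝ, ℝ) 𝓘(ℝ, E) γ t :=
  ((hF.smooth t ht).contMDiffAt (hJ.mem_nhds ht)).mdifferentiableAt (by simp)

theorem differentiableAlong (hF : IsFrenetCurve g γ J r V k) (hJ : IsOpen J) (ht : t ∈ J)
    {j : ℕ} (hj : 1 ≤ j) : DifferentiableAlong γ (V j) t := by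
  rcases le_or_gt j r with h | h
  · exact differentiableAlong_of_contMDiffOn hJ (hF.smooth_V j hj h) ht
  · have h0 : DifferentiableAlong γ (fun τ => (0 : TangentSpace 𝓘(ℝ, E) (γ τ))) t := by
      simp only [DifferentiableAlong, map_zero]
      exact differentiableAt_const _
    exact h0.congr (by filter_upwards [hJ.mem_nhds ht] with τ hτ using hF.V_eq_zero j h τ hτ)

theorem differentiableAt_k (hF : IsFrenetCurve g γ J r V k) (hJ : IsOpen J) (ht : t ∈ J)
    {j : ℕ} (hj : 1 ≤ j) : DifferentiableAt ℝ (k j) t := by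
  rcases lt_or_ge j r with h | h
  · exact (((hF.smooth_k j hj h) t ht).contDiffAt (hJ.mem_nhds ht)).differentiableAt (by simp)
  · refine (differentiableAt_const (0 : ℝ)).congr_of_eventuallyEq ?_
    filter_upwards [hJ.mem_nhds ht] with τ hτ using hF.k_eq_zero j h τ hτ

theorem differentiableAt_deriv_k (hF : IsFrenetCurve g γ J r V k) (hJ : IsOpen J) (ht : t ∈ J)
    {j : ℕ} (hj : 1 ≤ j) (hjr : j < r) : DifferentiableAt ℝ (deriv (k j)) t := by
  have h : ContDiffOn ℝ ∞ (deriv (k j)) J := (hF.smooth_k j hj hjr).deriv_of_isOpen hJ (by simp)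
  exact ((h t ht).contDiffAt (hJ.mem_nhds ht)).differentiableAt (by simp)

theorem inner_eq_zero (hF : IsFrenetCurve g γ J r V k) (ht : t ∈ J) {i j : ℕ} (hi : 1 ≤ i)
    (hj : 1 ≤ j) (hij : i ≠ j) : g.inner (γ t) (V i t) (V j t) = 0 := by
  rcases le_or_gt i r with h | h
  · rcases le_or_gt j r with h' | h'
    · rw [hF.orthonormal i j hi h hj h' t ht, if_neg hij]
    · rw [hF.V_eq_zero j h' t ht, map_zero]
  · rw [hF.V_eq_zero i h t ht, map_zero, zero_apply]

theorem inner_self (hF : IsFrenetCurve g γ J r V k) (ht : t ∈ J) {i : ℕ} (hi : 1 ≤ i)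
    (hir : i ≤ r) : g.inner (γ t) (V i t) (V i t) = 1 := by
  rw [hF.orthonormal i i hi hir hi hir t ht, if_pos rfl]

/-- `X = ⟨X, V⟩ V` for a multiple `X` of a member `V` of the frame, which may vanish. -/
theorem inner_mul_inner_self (hF : IsFrenetCurve g γ J r V k) (ht : t ∈ J) {i : ℕ} (hi : 1 ≤ i)
    (X : TangentSpace 𝓘(ℝ, E) (γ t)) :
    g.inner (γ t) X (V i t) * g.inner (γ t) (V i t) (V i t) = g.inner (γ t) X (V i t) := by
  rcases le_or_gt i r with h | h
  · rw [hF.inner_self ht hi h, mul_one]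
  · rw [hF.V_eq_zero i h t ht]; simp

theorem covDeriv_V_one (hF : IsFrenetCurve g γ J r V k) (ht : t ∈ J) :
    covDeriv g γ (V 1) t = k 1 t • V 2 t := by
  rw [hF.frenet 1 le_rfl hF.one_le t ht]
  -- `V 0` is arbitrary; it disappears because its coefficient `k 0` is zero.
  simp [hF.k_zero t ht]

theorem tension_eq (hF : IsFrenetCurve g γ J r V k) (hJ : IsOpen J) (ht : t ∈ J) :
    tension g γ t = k 1 t • V 2 t := by
  rw [← hF.covDeriv_V_one ht]
  refine covDeriv_congr g ?_
  filter_upwards [hJ.mem_nhds ht] with τ hτ using (hF.V_one τ hτ).symm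

theorem covDeriv_tension (hF : IsFrenetCurve g γ J r V k) (hr : 2 ≤ r) (hJ : IsOpen J)
    (ht : t ∈ J) : covDeriv g γ (tension g γ) t =
      (-(k 1 t) ^ 2) • V 1 t + deriv (k 1) t • V 2 t + (k 1 t * k 2 t) • V 3 t := by
  have e : ∀ᶠ τ in nhds t, tension g γ τ = k 1 τ • V 2 τ := by
    filter_upwards [hJ.mem_nhds ht] with τ hτ using hF.tension_eq hJ hτ
  rw [covDeriv_congr g e, covDeriv_smul g (hF.differentiableAt_k hJ ht le_rfl)
    (hF.differentiableAlong hJ ht one_le_two), hF.frenet 2 one_le_two hr t ht]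
  simp only [Nat.add_one_sub_one]
  module

theorem covDeriv_covDeriv_tension (hF : IsFrenetCurve g γ J r V k) (hr : 3 ≤ r) (hJ : IsOpen J)
    (ht : t ∈ J) : covDeriv g γ (covDeriv g γ (tension g γ)) t =
      (-3 * k 1 t * deriv (k 1) t) • V 1 t
        + (deriv (deriv (k 1)) t - k 1 t ^ 3 - k 1 t * k 2 t ^ 2) • V 2 t
        + (2 * deriv (k 1) t * k 2 t + k 1 t * deriv (k 2) t) • V 3 t
        + (k 1 t * k 2 t * k 3 t) • V 4 t := by
  have e : ∀ᶠ τ in nhds t, covDeriv g γ (tension g γ) τ =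
      (-(k 1 τ) ^ 2) • V 1 τ + deriv (k 1) τ • V 2 τ + (k 1 τ * k 2 τ) • V 3 τ := by
    filter_upwards [hJ.mem_nhds ht] with τ hτ using hF.covDeriv_tension (by omega) hJ hτ
  have d1 := hF.differentiableAt_k hJ ht (j := 1) le_rfl
  have d2 := hF.differentiableAt_k hJ ht (j := 2) one_le_two
  have d1' := hF.differentiableAt_deriv_k hJ ht (j := 1) le_rfl (by omega)
  have v1 := hF.differentiableAlong hJ ht (j := 1) le_rfl
  have v2 := hF.differentiableAlong hJ ht (j := 2) one_le_two
  have v3 := hF.differentiableAlong hJ ht (j := 3) (by omega)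
  have q1 : HasDerivAt (fun τ => -(k 1 τ) ^ 2) (-(2 * k 1 t * deriv (k 1) t)) t :=
    (d1.hasDerivAt.fun_pow 2).fun_neg.congr_deriv (by simp)
  have q2 : HasDerivAt (fun τ => k 1 τ * k 2 τ)
      (deriv (k 1) t * k 2 t + k 1 t * deriv (k 2) t) t := d1.hasDerivAt.mul d2.hasDerivAt
  rw [covDeriv_congr g e,
    covDeriv_add g ((v1.smul q1.differentiableAt).add (v2.smul d1'))
      (v3.smul q2.differentiableAt),
    covDeriv_add g (v1.smul q1.differentiableAt) (v2.smul d1'),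
    covDeriv_smul g q1.differentiableAt v1, covDeriv_smul g d1' v2,
    covDeriv_smul g q2.differentiableAt v3, hF.covDeriv_V_one ht,
    hF.frenet 2 one_le_two (by omega) t ht, hF.frenet 3 (by omega) (by omega) t ht,
    q1.deriv, q2.deriv]
  simp only [Nat.add_one_sub_one, Nat.reduceAdd]
  module

end IsFrenetCurve

variable {m s : ℕ} {S : FramedMetricStructure E M m s} {γ : ℝ → M}
  {J : Set ℝ} {r : ℕ} {V : ℕ → ∀ t, TangentSpace 𝓘(ℝ, E) (γ t)} {k : ℕ → ℝ → ℝ} {t : ℝ}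

theorem FramedMetricStructure.inner_φ_left (S : FramedMetricStructure E M m s) (p : M)
    (X Y : TangentSpace 𝓘(ℝ, E) p) :
    S.g.inner p (S.φ p X) Y = -S.g.inner p X (S.φ p Y) := by
  rw [S.g_compat p (S.φ p X) Y, S.φ_φ]
  have h : ∀ α, S.g.inner p (S.ξ α p) (S.φ p Y) = 0 := fun α => by
    rw [S.g.symm, ← S.η_eq, S.η_φ]
  simp [h, S.η_φ]

theorem FramedMetricStructure.inner_φ_self (S : FramedMetricStructure E M m s) (p : M)
    (X : TangentSpace 𝓘(ℝ, E) p) : S.g.inner p (S.φ p X) X = 0 := by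
  have h := S.inner_φ_left p X X
  rw [S.g.symm p X] at h
  linarith

theorem inner_φ_φ_V_one (hF : IsFrenetCurve S.g γ J r V k) {θ : Fin s → ℝ}
    (hθ : S.IsSlant γ J θ) (ht : t ∈ J) :
    S.g.inner (γ t) (S.φ (γ t) (V 1 t)) (S.φ (γ t) (V 1 t)) = 1 - ∑ α, Real.cos (θ α) ^ 2 := by
  have h := S.g_compat (γ t) (V 1 t) (V 1 t)
  have h1 : ∀ α, S.η α (γ t) (V 1 t) = Real.cos (θ α) := fun α => by
    rw [hF.V_one t ht, hθ α t ht]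
  rw [hF.inner_self ht le_rfl hF.one_le] at h
  simp only [h1, ← sq] at h
  linarith

variable [FiniteDimensional ℝ E]

/-- The components of the second Frenet vector of a slant curve along the `ξ_α` vanish. -/
theorem η_V_two (hS : S.IsSStructure) (hs : 1 ≤ s) (hJ : IsOpen J)
    (hF : IsFrenetCurve S.g γ J r V k) (hr : 2 ≤ r) {θ : Fin s → ℝ} (hθ : S.IsSlant γ J θ)
    (ht : t ∈ J) (α : Fin s) : S.η α (γ t) (V 2 t) = 0 := by
  have hγ := hF.mdifferentiableAt hJ ht
  obtain ⟨dξ, cξ⟩ := covDeriv_ξ hS hs hγ α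
  have h1 := hasDerivAt_inner S.g hγ (hF.differentiableAlong hJ ht le_rfl) dξ
  have h2 : (fun τ => S.g.inner (γ τ) (V 1 τ) (S.ξ α (γ τ))) =ᶠ[nhds t]
      fun _ => Real.cos (θ α) := by
    filter_upwards [hJ.mem_nhds ht] with τ hτ
    rw [← S.η_eq, hF.V_one τ hτ, hθ α τ hτ]
  have h3 := h1.unique ((hasDerivAt_const t (Real.cos (θ α))).congr_of_eventuallyEq h2)
  -- The term g(T, ∇_T ξ_α) = -g(T, φT) is zero, so k₁ η_α(V₂) = 0.
  rw [cξ, hF.covDeriv_V_one ht, ← hF.V_one t ht, map_neg, S.g.symm _ (V 1 t), S.inner_φ_self,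
    neg_zero, add_zero, ← S.η_eq, map_smul, smul_eq_mul] at h3
  exact (mul_eq_zero.1 h3).resolve_left (hF.k_pos 1 le_rfl hr t ht).ne'

/-- `d/dt g(φT, V₂) = k₂ g(φT, V₃)` along a slant curve. -/
theorem hasDerivAt_inner_φ_V_two (hS : S.IsSStructure) (hs : 1 ≤ s) (hJ : IsOpen J)
    (hF : IsFrenetCurve S.g γ J r V k) (hr : 2 ≤ r) {θ : Fin s → ℝ} (hθ : S.IsSlant γ J θ)
    (ht : t ∈ J) :
    HasDerivAt (fun τ => S.g.inner (γ τ) (S.φ (γ τ) (V 1 τ)) (V 2 τ))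
      (k 2 t * S.g.inner (γ t) (S.φ (γ t) (V 1 t)) (V 3 t)) t := by
  have hγ := hF.mdifferentiableAt hJ ht
  obtain ⟨dφ, cφ⟩ := covDeriv_φ hS hs hγ (hF.differentiableAlong hJ ht (j := 1) le_rfl)
  have h1 := hasDerivAt_inner S.g hγ dφ (hF.differentiableAlong hJ ht (j := 2) one_le_two)
  refine h1.congr_deriv ?_
  have hη := η_V_two hS hs hJ hF hr hθ ht
  have hξ : ∀ α, S.g.inner (γ t) (S.ξ α (γ t)) (V 2 t) = 0 := fun α => by
    rw [S.g.symm, ← S.η_eq, hη]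
  have h12 : S.g.inner (γ t) (V 1 t) (V 2 t) = 0 :=
    hF.inner_eq_zero ht le_rfl one_le_two (by omega)
  have hφφ : S.g.inner (γ t) (S.φ (γ t) (S.φ (γ t) (V 1 t))) (V 2 t) = 0 := by
    rw [S.φ_φ]
    simp [hξ, h12]
  rw [cφ, hF.covDeriv_V_one ht, hF.frenet 2 one_le_two hr t ht, ← hF.V_one t ht]
  simp only [map_add, map_sum, map_smul, add_apply, _root_.sum_apply, smul_apply, hξ, hφφ,
    S.inner_φ_self, add_zero, Finset.sum_const_zero, zero_add, smul_eq_mul,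
    Nat.add_one_sub_one, mul_zero, Nat.reduceAdd]

/-- With j = 4 this gives the constant sign of g(φT, V₄) on the interval. -/
theorem continuousOn_inner_φ (hS : S.IsSStructure) (hs : 1 ≤ s) (hJ : IsOpen J)
    (hF : IsFrenetCurve S.g γ J r V k) {j : ℕ} (hj : 1 ≤ j) :
    ContinuousOn (fun τ => S.g.inner (γ τ) (S.φ (γ τ) (V 1 τ)) (V j τ)) J := by
  intro t ht
  have hγ := hF.mdifferentiableAt hJ ht
  obtain ⟨dφ, -⟩ := covDeriv_φ hS hs hγ (hF.differentiableAlong hJ ht (j := 1) le_rfl)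
  exact (hasDerivAt_inner S.g hγ dφ
    (hF.differentiableAlong hJ ht hj)).continuousAt.continuousWithinAt

/-- The curvature term -R(T, k₁V₂)T adds a multiple of V₂ and a multiple of φT to the third
derivative of T. The formula applies because η_α(V₂) = 0. -/
theorem bitension_eq {c : ℝ} (hS : S.IsSSpaceForm c) (hs : 1 ≤ s) (hJ : IsOpen J)
    (hF : IsFrenetCurve S.g γ J r V k) (hr : 3 ≤ r) {θ : Fin s → ℝ} (hθ : S.IsSlant γ J θ)
    (ht : t ∈ J) :
    bitension S.g γ t = (-3 * k 1 t * deriv (k 1) t) • V 1 t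
      + (deriv (deriv (k 1)) t - k 1 t ^ 3 - k 1 t * k 2 t ^ 2
        + k 1 t * ((∑ α, Real.cos (θ α)) ^ 2
          + (c + 3 * s) / 4 * (1 - ∑ α, Real.cos (θ α) ^ 2))) • V 2 t
      + (2 * deriv (k 1) t * k 2 t + k 1 t * deriv (k 2) t) • V 3 t
      + (k 1 t * k 2 t * k 3 t) • V 4 t
      + (3 * (c - s) / 4 * k 1 t * S.g.inner (γ t) (S.φ (γ t) (V 1 t)) (V 2 t))
        • S.φ (γ t) (V 1 t) := by
  have hη := η_V_two hS.1 hs hJ hF (by omega) hθ ht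
  rw [bitension, hF.covDeriv_covDeriv_tension hr hJ ht, hF.tension_eq hJ ht, ← hF.V_one t ht,
    curvature_smul_add hS hs (γ t) (V 1 t) (k 1 t • V 2 t) (fun α => by simp [hη])
      (by simp [hF.inner_eq_zero ht (i := 1) (j := 2) le_rfl one_le_two (by omega)]),
    inner_φ_φ_V_one hF hθ ht]
  have h1 : ∀ α, S.η α (γ t) (V 1 t) = Real.cos (θ α) := fun α => by
    rw [hF.V_one t ht, hθ α t ht]
  simp only [h1, map_smul, smul_eq_mul]
  module

/-- The `f`-biharmonic equation in terms of its components in the Frenet frame. -/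
theorem fBiharmonic_iff_components {c : ℝ} (hS : S.IsSSpaceForm c) (hs : 1 ≤ s) (hc : c ≠ s)
    (hJ : IsOpen J) (hF : IsFrenetCurve S.g γ J r V k) (hr : 3 ≤ r) {θ : Fin s → ℝ}
    (hθ : S.IsSlant γ J θ) (ht : t ∈ J) {f₀ f₁ f₂ : ℝ} (hf₀ : 0 < f₀)
    (hne : S.g.inner (γ t) (S.φ (γ t) (V 1 t)) (V 2 t) ≠ 0) (x : ℕ → ℝ)
    (hx : ∀ j, x j = S.g.inner (γ t) (S.φ (γ t) (V 1 t)) (V j t)) :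
    f₀ • bitension S.g γ t + (2 * f₁) • covDeriv S.g γ (tension S.g γ) t
        + f₂ • tension S.g γ t = 0 ↔
      S.φ (γ t) (V 1 t) = x 2 • V 2 t + x 3 • V 3 t + x 4 • V 4 t ∧
      3 * k 1 t * deriv (k 1) t * f₀ + 2 * f₁ * k 1 t ^ 2 = 0 ∧
      f₀ * (deriv (deriv (k 1)) t - k 1 t ^ 3 - k 1 t * k 2 t ^ 2
        + k 1 t * ((∑ α, Real.cos (θ α)) ^ 2
          + (c + 3 * s) / 4 * (1 - ∑ α, Real.cos (θ α) ^ 2)))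
        + 2 * f₁ * deriv (k 1) t + f₂ * k 1 t
        + f₀ * (3 * (c - s) / 4 * k 1 t * x 2) * x 2 = 0 ∧
      f₀ * (2 * deriv (k 1) t * k 2 t + k 1 t * deriv (k 2) t) + 2 * f₁ * (k 1 t * k 2 t)
        + f₀ * (3 * (c - s) / 4 * k 1 t * x 2) * x 3 = 0 ∧
      k 2 t * k 3 t + 3 * (c - s) / 4 * x 2 * x 4 = 0 := by
  have hk1 := hF.k_pos 1 le_rfl (by omega) t ht
  rw [bitension_eq hS hs hJ hF hr hθ ht, hF.covDeriv_tension (by omega) hJ ht,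
    hF.tension_eq hJ ht, ← hx 2]
  rw [← hx 2] at hne
  have hx1 : S.g.inner (γ t) (S.φ (γ t) (V 1 t)) (V 1 t) = 0 := S.inner_φ_self _ _
  have o := fun i j => hF.inner_eq_zero ht (i := i) (j := j)
  have n := fun i => hF.inner_self ht (i := i)
  -- For r = 3 the fourth frame vector is zero by convention, and pairing with it gives no
  -- information; the fourth equation then holds because k₃ = 0 and g(φT, V₄) = 0.
  have n4 : V 4 t = 0 ∧ k 3 t = 0 ∨ S.g.inner (γ t) (V 4 t) (V 4 t) = 1 := by
    rcases Nat.lt_or_ge r 4 with h | h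
    · exact Or.inl ⟨hF.V_eq_zero 4 h t ht, hF.k_eq_zero 3 (by omega) t ht⟩
    · exact Or.inr (n 4 (by omega) h)
  constructor
  · intro h
    have hin := fun Y => congrArg (fun X => S.g.inner (γ t) X Y) h
    simp only [map_add, map_smul, add_apply, smul_apply, smul_eq_mul, map_zero,
      zero_apply] at hin
    have h1 := hin (V 1 t)
    have h2 := hin (V 2 t)
    have h3 := hin (V 3 t)
    have h4 := hin (V 4 t)
    simp only [hx1, ← hx, n 1 (by omega) (by omega), n 2 (by omega) (by omega),
      n 3 (by omega) (by omega), o 1 2, o 1 3, o 1 4, o 2 1, o 2 3, o 2 4, o 3 1, o 3 2, o 3 4,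
      o 4 1, o 4 2, o 4 3, le_refl, ne_eq, Nat.reduceEqDiff,
      not_false_eq_true, mul_zero, mul_one, add_zero, zero_add, Nat.one_le_ofNat,
      OfNat.ofNat_ne_one, OfNat.one_ne_ofNat] at h1 h2 h3 h4
    have e4 : k 2 t * k 3 t + 3 * (c - s) / 4 * x 2 * x 4 = 0 := by
      rcases n4 with ⟨hV, hk⟩ | hV
      · rw [hx 4, hV, hk]; simp
      · rw [hV] at h4
        have : f₀ * k 1 t * (k 2 t * k 3 t + 3 * (c - s) / 4 * x 2 * x 4) = 0 := by linarith
        exact (mul_eq_zero.1 this).resolve_left (mul_pos hf₀ hk1).ne'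
    have e1 : 3 * k 1 t * deriv (k 1) t * f₀ + 2 * f₁ * k 1 t ^ 2 = 0 := by linarith
    refine ⟨?_, e1, by linarith, by linarith, e4⟩
    -- The coefficient of φT is nonzero, so the vector equation can be solved for φT. This is where
    -- c ≠ s and g(φT, V₂) ≠ 0 enter.
    have hQ : f₀ * (3 * (c - s) / 4 * k 1 t * x 2) ≠ 0 := by
      have : c - s ≠ 0 := sub_ne_zero.2 hc
      positivity
    refine smul_right_injective _ hQ ?_
    linear_combination (norm := module) h + e1 • V 1 t - h2 • V 2 t - h3 • V 3 t
      - (f₀ * k 1 t * e4) • V 4 t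
  · rintro ⟨hφ, e1, e2, e3, e4⟩
    linear_combination (norm := module) (f₀ * (3 * (c - s) / 4 * k 1 t * x 2)) • hφ
      - e1 • V 1 t + e2 • V 2 t + e3 • V 3 t + (f₀ * k 1 t * e4) • V 4 t

end FrenetCurves
-- Ordinary differential equations for f, k₁, k₂ and β
section ScalarEquations

variable {J : Set ℝ}

theorem exists_eq_const_of_hasDerivAt_zero (hJ : IsOpen J) (hJp : IsPreconnected J)
    (hJn : J.Nonempty) {h : ℝ → ℝ} (hh : ∀ t ∈ J, HasDerivAt h 0 t) :
    ∃ t₀ ∈ J, ∀ t ∈ J, h t = h t₀ := by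
  obtain ⟨t₀, ht₀⟩ := hJn
  exact ⟨t₀, ht₀, fun t ht => hJ.is_const_of_deriv_eq_zero hJp
    (fun x hx => (hh x hx).differentiableAt.differentiableWithinAt)
    (fun x hx => (hh x hx).deriv) ht ht₀⟩

theorem rpow_sq_mul_cube {y : ℝ} (hy : 0 < y) : (y ^ (-(3 / 2) : ℝ)) ^ 2 * y ^ 3 = 1 := by
  rw [← Real.rpow_natCast, ← Real.rpow_mul hy.le, ← Real.rpow_natCast y 3, ← Real.rpow_add hy]
  norm_num

/-- The first component equation, multiplied by fκ, is the vanishing of the derivative of f²κ³. -/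
theorem eq_const_mul_rpow_iff (hJ : IsOpen J) (hJp : IsPreconnected J) (hJn : J.Nonempty)
    {f κ : ℝ → ℝ} (hf : ∀ t ∈ J, DifferentiableAt ℝ f t) (hκ : ∀ t ∈ J, DifferentiableAt ℝ κ t)
    (hf0 : ∀ t ∈ J, 0 < f t) (hκ0 : ∀ t ∈ J, 0 < κ t) :
    (∀ t ∈ J, 3 * κ t * deriv κ t * f t + 2 * deriv f t * κ t ^ 2 = 0) ↔
      ∃ c₁ : ℝ, 0 < c₁ ∧ ∀ t ∈ J, f t = c₁ * κ t ^ (-(3 / 2) : ℝ) := by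
  have hd : ∀ t ∈ J, HasDerivAt (fun τ => f τ ^ 2 * κ τ ^ 3)
      (f t * κ t * (3 * κ t * deriv κ t * f t + 2 * deriv f t * κ t ^ 2)) t := by
    intro t ht
    refine (((hf t ht).hasDerivAt.fun_pow 2).fun_mul
      ((hκ t ht).hasDerivAt.fun_pow 3)).congr_deriv ?_
    simp only [Nat.cast_ofNat, Nat.add_one_sub_one, pow_one]
    ring
  constructor
  · intro h
    obtain ⟨t₀, ht₀, hC⟩ := exists_eq_const_of_hasDerivAt_zero hJ hJp hJn fun t ht =>
      (hd t ht).congr_deriv (by rw [h t ht, mul_zero])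
    have hpos : 0 < f t₀ ^ 2 * κ t₀ ^ 3 := by
      have := hf0 t₀ ht₀; have := hκ0 t₀ ht₀; positivity
    refine ⟨√(f t₀ ^ 2 * κ t₀ ^ 3), Real.sqrt_pos.2 hpos, fun t ht => ?_⟩
    have hu := Real.rpow_pos_of_pos (hκ0 t ht) (-(3 / 2))
    rw [← sq_eq_sq₀ (hf0 t ht).le (mul_pos (Real.sqrt_pos.2 hpos) hu).le, mul_pow,
      Real.sq_sqrt hpos.le, ← hC t ht]
    linear_combination -(f t ^ 2) * rpow_sq_mul_cube (hκ0 t ht)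
  · rintro ⟨c₁, hc₁, h⟩ t ht
    have e : (fun τ => f τ ^ 2 * κ τ ^ 3) =ᶠ[nhds t] fun _ => c₁ ^ 2 := by
      filter_upwards [hJ.mem_nhds ht] with τ hτ
      rw [h τ hτ]
      linear_combination c₁ ^ 2 * rpow_sq_mul_cube (hκ0 τ hτ)
    have h1 := (hd t ht).unique ((hasDerivAt_const t (c₁ ^ 2)).congr_of_eventuallyEq e)
    have h2 : f t * κ t ≠ 0 := (mul_pos (hf0 t ht) (hκ0 t ht)).ne'
    exact (mul_eq_zero.1 h1).resolve_left h2

/-- The derivative of the first component equation. -/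
theorem second_deriv_relation (hJ : IsOpen J) {f κ : ℝ → ℝ} (hf : ContDiffOn ℝ 2 f J)
    (hκ : ∀ t ∈ J, DifferentiableAt ℝ κ t) (hκ' : ∀ t ∈ J, DifferentiableAt ℝ (deriv κ) t)
    (h : ∀ t ∈ J, 3 * κ t * deriv κ t * f t + 2 * deriv f t * κ t ^ 2 = 0) {t : ℝ} (ht : t ∈ J) :
    3 * deriv κ t ^ 2 * f t + 3 * κ t * deriv (deriv κ) t * f t + 7 * κ t * deriv κ t * deriv f t
      + 2 * deriv (deriv f) t * κ t ^ 2 = 0 := by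
  have hf1 := ((hf t ht).contDiffAt (hJ.mem_nhds ht)).differentiableAt (by simp)
  have hf2 : DifferentiableAt ℝ (deriv f) t := by
    have h' : ContDiffOn ℝ 1 (deriv f) J := hf.deriv_of_isOpen hJ (by norm_num)
    exact ((h' t ht).contDiffAt (hJ.mem_nhds ht)).differentiableAt (by simp)
  have d := ((((hκ t ht).hasDerivAt.const_mul 3).fun_mul (hκ' t ht).hasDerivAt).fun_mul
    hf1.hasDerivAt).fun_add
    ((hf2.hasDerivAt.const_mul 2).fun_mul ((hκ t ht).hasDerivAt.fun_pow 2))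
  have e : (fun τ => 3 * κ τ * deriv κ τ * f τ + 2 * deriv f τ * κ τ ^ 2) =ᶠ[nhds t]
      fun _ => 0 := by
    filter_upwards [hJ.mem_nhds ht] with τ hτ using h τ hτ
  have := d.unique ((hasDerivAt_const t (0 : ℝ)).congr_of_eventuallyEq e)
  simp only [Nat.cast_ofNat, Nat.add_one_sub_one, pow_one] at this
  linear_combination this

/-- Elimination of `f` from the second and third component equations. -/
theorem component_equations_iff {f f' f'' κ κ' κ'' τ τ' P Q x y : ℝ} (hf : 0 < f) (hκ : 0 < κ)
    (h1 : 3 * κ * κ' * f + 2 * f' * κ ^ 2 = 0)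
    (h2 : 3 * κ' ^ 2 * f + 3 * κ * κ'' * f + 7 * κ * κ' * f' + 2 * f'' * κ ^ 2 = 0) :
    (f * (κ'' - κ ^ 3 - κ * τ ^ 2 + κ * P) + 2 * f' * κ' + f'' * κ + f * (Q * κ * x) * x = 0 ↔
      3 * κ' ^ 2 - 2 * κ * κ'' = 4 * κ ^ 2 * (κ ^ 2 + τ ^ 2 - P - Q * x ^ 2)) ∧
    (f * (2 * κ' * τ + κ * τ') + 2 * f' * (κ * τ) + f * (Q * κ * x) * y = 0 ↔
      κ * τ' - κ' * τ + Q * κ * x * y = 0) := by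
  have h3 : 3 * κ' * f + 2 * f' * κ = 0 := by
    have : κ * (3 * κ' * f + 2 * f' * κ) = 0 := by linear_combination h1
    exact (mul_eq_zero.1 this).resolve_left hκ.ne'
  refine ⟨⟨fun h => ?_, fun h => ?_⟩, ⟨fun h => ?_, fun h => ?_⟩⟩
  -- Multiplying by 4κ allows f'' to be eliminated through `h2`; the remaining f'κ'-term is removed
  -- by `h3`.
  · have : f * (3 * κ' ^ 2 - 2 * κ * κ'' - 4 * κ ^ 2 * (κ ^ 2 + τ ^ 2 - P - Q * x ^ 2)) = 0 := by
      linear_combination 4 * κ * h - 2 * h2 + 3 * κ' * h3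
    exact sub_eq_zero.1 ((mul_eq_zero.1 this).resolve_left hf.ne')
  · refine (mul_eq_zero.1 (?_ : (4 * κ) * _ = 0)).resolve_left (by positivity)
    linear_combination f * h + 2 * h2 - 3 * κ' * h3
  · refine (mul_eq_zero.1 (?_ : f * _ = 0)).resolve_left hf.ne'
    linear_combination h - τ * h3
  · linear_combination f * h + τ * h3

theorem exists_sign_of_abs (hJp : IsPreconnected J) {h : ℝ → ℝ} (hc : ContinuousOn h J)
    (h0 : ∀ t ∈ J, h t ≠ 0) : ∃ ε : ℝ, (ε = 1 ∨ ε = -1) ∧ ∀ t ∈ J, h t = ε * |h t| := by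
  rcases hJp.eq_or_eq_neg_of_sq_eq hc hc.abs (fun t _ => by simp) (fun {t} ht => by
    simpa using h0 t ht) with h1 | h1
  · exact ⟨1, Or.inl rfl, fun t ht => by rw [one_mul]; exact h1 ht⟩
  · exact ⟨-1, Or.inr rfl, fun t ht => by rw [neg_one_mul]; exact h1 ht⟩

/-- The ratio of the first two curvatures. -/
theorem deriv_ratio_relation (hJ : IsOpen J) {κ τ β μ : ℝ → ℝ} {A t : ℝ} (ht : t ∈ J)
    (hκ0 : κ t ≠ 0) (hκ : DifferentiableAt ℝ κ t) (hτ : DifferentiableAt ℝ τ t)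
    (hβ : DifferentiableAt ℝ β t)
    (hμ : HasDerivAt μ (-(2 * A) * (Real.cos (β t) ^ 2 * deriv κ t / κ t ^ 3)) t)
    (h : ∀ u ∈ J, τ u ^ 2 = -A * Real.cos (β u) ^ 2 + μ u * κ u ^ 2) :
    τ t * (κ t * deriv τ t - deriv κ t * τ t) =
      A * κ t * Real.cos (β t) * Real.sin (β t) * deriv β t := by
  have d1 := hτ.hasDerivAt.fun_pow 2
  have d2 := ((hβ.hasDerivAt.cos.fun_pow 2).const_mul (-A)).fun_add
    (hμ.fun_mul (hκ.hasDerivAt.fun_pow 2))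
  have e : (fun u => τ u ^ 2) =ᶠ[nhds t]
      fun u => -A * Real.cos (β u) ^ 2 + μ u * κ u ^ 2 := by
    filter_upwards [hJ.mem_nhds ht] with u hu using h u hu
  have h1 := d1.unique (d2.congr_of_eventuallyEq e)
  simp only [Nat.cast_ofNat, Nat.add_one_sub_one, pow_one] at h1
  have h2 := h t ht
  have h3 : -(2 * A) * (Real.cos (β t) ^ 2 * deriv κ t / κ t ^ 3) * κ t ^ 2 * κ t =
      -(2 * A) * Real.cos (β t) ^ 2 * deriv κ t := by
    field_simp
  linear_combination κ t / 2 * h1 + h3 / 2 - deriv κ t * h2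

/-- The converse direction to `deriv_ratio_relation`: the quotient is the function μ of the
nonconstant case, with A = 3(c-s)(1-a)/4. -/
theorem hasDerivAt_ratio {κ τ β : ℝ → ℝ} {A t : ℝ} (hκ0 : κ t ≠ 0)
    (hκ : DifferentiableAt ℝ κ t) (hτ : DifferentiableAt ℝ τ t) (hβ : DifferentiableAt ℝ β t)
    (h : τ t * (κ t * deriv τ t - deriv κ t * τ t) =
      A * κ t * Real.cos (β t) * Real.sin (β t) * deriv β t) :
    HasDerivAt (fun u => (τ u ^ 2 + A * Real.cos (β u) ^ 2) / κ u ^ 2)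
      (-(2 * A) * (Real.cos (β t) ^ 2 * deriv κ t / κ t ^ 3)) t := by
  refine (((hτ.hasDerivAt.fun_pow 2).fun_add ((hβ.hasDerivAt.cos.fun_pow 2).const_mul A)).fun_div
    (hκ.hasDerivAt.fun_pow 2) (pow_ne_zero 2 hκ0)).congr_deriv ?_
  simp only [Nat.cast_ofNat, Nat.add_one_sub_one, pow_one]
  field_simp
  linear_combination h

end ScalarEquations

/-! ### The angle between V₃ and a vector of span{V₃, V₄} -/

section Angle

variable {E : Type*} [NormedAddCommGroup E] [NormedSpace ℝ E]
  {M : Type*} [TopologicalSpace M] [ChartedSpace E M] [IsManifold 𝓘(ℝ, E) ∞ M]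

/-- The angle between a unit vector `u` and `x u + y v`, where `v` is orthogonal to `u`. -/
theorem cos_sin_angle (g : Metric E M) (p : M) {u v : TangentSpace 𝓘(ℝ, E) p} {x y ρ : ℝ}
    (hu : g.inner p u u = 1) (huv : g.inner p u v = 0) (hv : y ^ 2 * g.inner p v v = y ^ 2)
    (hρ : 0 < ρ) (h : x ^ 2 + y ^ 2 = ρ ^ 2) :
    Real.cos (angle g p u (x • u + y • v)) = x / ρ ∧
      Real.sin (angle g p u (x • u + y • v)) = |y| / ρ := by
  have h1 : g.inner p u (x • u + y • v) = x := by simp [hu, huv]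
  have h2 : g.inner p (x • u + y • v) (x • u + y • v) = ρ ^ 2 := by
    have hvu : g.inner p v u = 0 := by rw [g.symm, huv]
    simp only [map_add, map_smul, add_apply, smul_apply, smul_eq_mul, hu, huv, hvu]
    linear_combination hv + h
  have h3 : |x| ≤ ρ := abs_le_of_sq_le_sq (by nlinarith [sq_nonneg y]) hρ.le
  have h4 := abs_le.1 h3
  rw [angle, h1, h2, hu, Real.sqrt_one, one_mul, Real.sqrt_sq hρ.le]
  refine ⟨Real.cos_arccos ?_ ?_, ?_⟩
  · rw [le_div_iff₀ hρ]; linarith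
  · rw [div_le_iff₀ hρ]; linarith
  · rw [Real.sin_arccos]
    have : 1 - (x / ρ) ^ 2 = (|y| / ρ) ^ 2 := by
      rw [div_pow, div_pow, sq_abs]
      field_simp
      linarith
    rw [this, Real.sqrt_sq (by positivity)]

end Angle
end SSpaceForm

end

/-! ### Characterization of proper f-biharmonic slant curves -/

theorem theorem4p6 (m s : ℕ) (hs : 1 ≤ s)
    {M : Type*} [TopologicalSpace M] [ChartedSpace (EuclideanSpace ℝ (Fin (2 * m + s))) M]
    [IsManifold 𝓘(ℝ, EuclideanSpace ℝ (Fin (2 * m + s))) ∞ M]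
    -- an 𝒮-space form `M(c)` of dimension `2m + s` with `c ≠ s`
    (S : SSpaceForm.FramedMetricStructure (EuclideanSpace ℝ (Fin (2 * m + s))) M m s)
    (c : ℝ) (hS : S.IsSSpaceForm c) (hc : c ≠ s)
    -- a `θ_α`-slant Frenet curve of osculating order `r ≥ 3` on the open interval `J`
    (J : Set ℝ) (hJo : IsOpen J) (hJc : J.OrdConnected) (hJn : J.Nonempty)
    (γ : ℝ → M) (r : ℕ) (hr : 3 ≤ r)
    (V : ℕ → ∀ t, TangentSpace 𝓘(ℝ, EuclideanSpace ℝ (Fin (2 * m + s))) (γ t)) (k : ℕ → ℝ → ℝ)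
    (hF : SSpaceForm.IsFrenetCurve S.g γ J r V k)
    (θ : Fin s → ℝ) (hθ : S.IsSlant γ J θ)
    (a b : ℝ) (ha : a = ∑ α, Real.cos (θ α) ^ 2) (hb : b = ∑ α, Real.cos (θ α))
    -- the angle function `β`
    (β : ℝ → ℝ) (hβd : DifferentiableOn ℝ β J)
    (hβ : ∀ t ∈ J, S.g.inner (γ t) (S.φ (γ t) (V 1 t)) (V 2 t) = √(1 - a) * Real.cos (β t))
    (hβ0 : ∀ t ∈ J, S.g.inner (γ t) (S.φ (γ t) (V 1 t)) (V 2 t) ≠ 0)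
    (hβ1 : ∀ t ∈ J, S.g.inner (γ t) (S.φ (γ t) (V 1 t)) (V 2 t) ≠ √(1 - a))
    (hβ2 : ∀ t ∈ J, S.g.inner (γ t) (S.φ (γ t) (V 1 t)) (V 2 t) ≠ -√(1 - a))
    -- the positive function `f`
    (f : ℝ → ℝ) (hf : ContDiffOn ℝ 2 f J) (hfpos : ∀ t ∈ J, 0 < f t)
    -- the angle function `w` between `V₃` and the projection of `φT` onto `span {V₃, V₄}`
    (w : ℝ → ℝ)
    (hw : ∀ t, w t = SSpaceForm.angle S.g (γ t) (V 3 t)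
      (S.g.inner (γ t) (S.φ (γ t) (V 1 t)) (V 3 t) • V 3 t
        + S.g.inner (γ t) (S.φ (γ t) (V 1 t)) (V 4 t) • V 4 t)) :
    SSpaceForm.IsProperFBiharmonic S.g γ f J ↔
      (¬ ∃ C : ℝ, ∀ t ∈ J, k 1 t = C) ∧
      (∃ c₁ : ℝ, 0 < c₁ ∧ ∀ t ∈ J, f t = c₁ * (k 1 t) ^ (-(3 / 2) : ℝ)) ∧
      -- (i) constant `β`
      ((∃ β₀ : ℝ, ∀ t ∈ J, β t = β₀) →
        ∃ c₂ ε : ℝ, 0 < c₂ ∧ (ε = 1 ∨ ε = -1) ∧ ∀ t ∈ J,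
          k 2 t / k 1 t = c₂ ∧
          3 * (deriv (k 1) t) ^ 2 - 2 * k 1 t * deriv (deriv (k 1)) t =
            4 * (k 1 t) ^ 2 * ((1 + c₂ ^ 2) * (k 1 t) ^ 2
              - (b ^ 2 + (c + 3 * s + 3 * (c - s) * Real.cos (β t) ^ 2) / 4 * (1 - a))) ∧
          k 2 t * k 3 t = -ε * (3 * (c - s) * Real.sin (2 * β t) / 8 * (1 - a)) ∧
          S.φ (γ t) (V 1 t) =
            √(1 - a) • (Real.cos (β t) • V 2 t + (ε * Real.sin (β t)) • V 4 t)) ∧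
      -- (ii) non-constant `β`
      ((¬ ∃ β₀ : ℝ, ∀ t ∈ J, β t = β₀) →
        ∃ (μ : ℝ → ℝ) (ε₁ ε₂ : ℝ), (ε₁ = 1 ∨ ε₁ = -1) ∧ (ε₂ = 1 ∨ ε₂ = -1) ∧ ∀ t ∈ J,
          HasDerivAt μ (-(3 * (c - s) / 2) * (1 - a)
            * (Real.cos (β t) ^ 2 * deriv (k 1) t / (k 1 t) ^ 3)) t ∧
          (k 2 t) ^ 2 = -(3 * (c - s) / 4) * (1 - a) * Real.cos (β t) ^ 2 + μ t * (k 1 t) ^ 2 ∧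
          3 * (deriv (k 1) t) ^ 2 - 2 * k 1 t * deriv (deriv (k 1)) t =
            4 * (k 1 t) ^ 2 * ((1 + μ t) * (k 1 t) ^ 2
              - (b ^ 2 + (c + 3 * s + 6 * (c - s) * Real.cos (β t) ^ 2) / 4 * (1 - a))) ∧
          k 2 t * k 3 t =
            -ε₂ * (3 * (c - s) * Real.sin (2 * β t) * Real.sin (w t) / 8 * (1 - a)) ∧
          S.φ (γ t) (V 1 t) =
            √(1 - a) • (Real.cos (β t) • V 2 t
              + (ε₁ * Real.sin (β t) * Real.cos (w t)) • V 3 t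
              + (ε₂ * Real.sin (β t) * Real.sin (w t)) • V 4 t) ∧
          Real.cos (w t) = -ε₁ * deriv β t / k 2 t) := by
  have hJp : IsPreconnected J := hJc.isPreconnected
  have hr2 : 2 ≤ r := by omega
  have hk1 := hF.k_pos 1 le_rfl (by omega)
  have hk2 := hF.k_pos 2 one_le_two (by omega)
  have d1 := fun t (ht : t ∈ J) => hF.differentiableAt_k hJo ht (j := 1) le_rfl
  have d2 := fun t (ht : t ∈ J) => hF.differentiableAt_k hJo ht (j := 2) one_le_two
  have d1' := fun t (ht : t ∈ J) =>
    hF.differentiableAt_deriv_k hJo ht (j := 1) le_rfl (by omega)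
  have dβ := fun t (ht : t ∈ J) => (hβd t ht).differentiableAt (hJo.mem_nhds ht)
  have df := fun t (ht : t ∈ J) =>
    ((hf t ht).contDiffAt (hJo.mem_nhds ht)).differentiableAt (by simp)
  have hsin : ∀ t ∈ J, Real.sin (β t) ≠ 0 := by
    intro t ht h0
    rcases Real.sin_eq_zero_iff_cos_eq.1 h0 with h | h
    · exact hβ1 t ht (by rw [hβ t ht, h, mul_one])
    · exact hβ2 t ht (by rw [hβ t ht, h, mul_neg_one])
  have hσ : 0 < √(1 - a) := by
    obtain ⟨t, ht⟩ := hJn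
    refine (Real.sqrt_nonneg _).lt_of_ne fun h0 => hβ0 t ht ?_
    rw [hβ t ht, ← h0, zero_mul]
  have hσ2 : √(1 - a) ^ 2 = 1 - a := Real.sq_sqrt (Real.sqrt_pos.1 hσ).le
  obtain ⟨x, hx⟩ : ∃ x : ℕ → ℝ → ℝ, ∀ j t,
      x j t = S.g.inner (γ t) (S.φ (γ t) (V 1 t)) (V j t) := ⟨_, fun _ _ => rfl⟩
  -- In these terms R(T, V₂)T = -P V₂ - Q g(φT, V₂) φT.
  obtain ⟨Q, hQ⟩ : ∃ Q : ℝ, Q = 3 * (c - s) / 4 := ⟨_, rfl⟩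
  obtain ⟨P, hP⟩ : ∃ P : ℝ, P = b ^ 2 + (c + 3 * s) / 4 * (1 - a) := ⟨_, rfl⟩
  have hx2 : ∀ t ∈ J, x 2 t = √(1 - a) * Real.cos (β t) := fun t ht => by rw [hx, hβ t ht]
  -- The coefficients stay free so that the same equivalence serves for (f, f', f'') and, in the
  -- biharmonic case, for (1, 0, 0).
  have hcomp : ∀ t ∈ J, ∀ {f₀ f₁ f₂ : ℝ}, 0 < f₀ →
      (f₀ • SSpaceForm.bitension S.g γ t
        + (2 * f₁) • SSpaceForm.covDeriv S.g γ (SSpaceForm.tension S.g γ) t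
        + f₂ • SSpaceForm.tension S.g γ t = 0 ↔
      S.φ (γ t) (V 1 t) = x 2 t • V 2 t + x 3 t • V 3 t + x 4 t • V 4 t ∧
      3 * k 1 t * deriv (k 1) t * f₀ + 2 * f₁ * k 1 t ^ 2 = 0 ∧
      f₀ * (deriv (deriv (k 1)) t - k 1 t ^ 3 - k 1 t * k 2 t ^ 2 + k 1 t * P)
        + 2 * f₁ * deriv (k 1) t + f₂ * k 1 t + f₀ * (Q * k 1 t * x 2 t) * x 2 t = 0 ∧
      f₀ * (2 * deriv (k 1) t * k 2 t + k 1 t * deriv (k 2) t) + 2 * f₁ * (k 1 t * k 2 t)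
        + f₀ * (Q * k 1 t * x 2 t) * x 3 t = 0 ∧
      k 2 t * k 3 t + Q * x 2 t * x 4 t = 0) := by
    intro t ht f₀ f₁ f₂ hf₀
    have h := SSpaceForm.fBiharmonic_iff_components hS hs hc hJo hF hr hθ ht hf₀ (f₁ := f₁)
      (f₂ := f₂) (hβ0 t ht) (fun j => x j t) (fun j => hx j t)
    rw [← ha, ← hb, ← hP, ← hQ] at h
    exact h
  have step1 : SSpaceForm.IsProperFBiharmonic S.g γ f J ↔
      (¬ ∃ C : ℝ, ∀ t ∈ J, k 1 t = C) ∧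
      (∃ c₁ : ℝ, 0 < c₁ ∧ ∀ t ∈ J, f t = c₁ * (k 1 t) ^ (-(3 / 2) : ℝ)) ∧
      ∀ t ∈ J, S.φ (γ t) (V 1 t) = x 2 t • V 2 t + x 3 t • V 3 t + x 4 t • V 4 t ∧
        3 * deriv (k 1) t ^ 2 - 2 * k 1 t * deriv (deriv (k 1)) t =
          4 * k 1 t ^ 2 * (k 1 t ^ 2 + k 2 t ^ 2 - P - Q * x 2 t ^ 2) ∧
        k 1 t * deriv (k 2) t - deriv (k 1) t * k 2 t + Q * k 1 t * x 2 t * x 3 t = 0 ∧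
        k 2 t * k 3 t + Q * x 2 t * x 4 t = 0 := by
    rw [← SSpaceForm.eq_const_mul_rpow_iff hJo hJp hJn df d1 hfpos hk1]
    have hFB : SSpaceForm.IsFBiharmonic S.g γ f J ↔
        (∀ t ∈ J, 3 * k 1 t * deriv (k 1) t * f t + 2 * deriv f t * k 1 t ^ 2 = 0) ∧
        ∀ t ∈ J, S.φ (γ t) (V 1 t) = x 2 t • V 2 t + x 3 t • V 3 t + x 4 t • V 4 t ∧
        3 * deriv (k 1) t ^ 2 - 2 * k 1 t * deriv (deriv (k 1)) t =
          4 * k 1 t ^ 2 * (k 1 t ^ 2 + k 2 t ^ 2 - P - Q * x 2 t ^ 2) ∧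
        k 1 t * deriv (k 2) t - deriv (k 1) t * k 2 t + Q * k 1 t * x 2 t * x 3 t = 0 ∧
        k 2 t * k 3 t + Q * x 2 t * x 4 t = 0 := by
      constructor
      · intro h
        have h' := fun t ht => (hcomp t ht (hfpos t ht)).1 (h t ht)
        have e1 := fun t ht => (h' t ht).2.1
        refine ⟨e1, fun t ht => ?_⟩
        obtain ⟨q1, q2, q3, q4, q5⟩ := h' t ht
        have q := SSpaceForm.component_equations_iff (τ := k 2 t) (τ' := deriv (k 2) t) (P := P)
          (Q := Q) (x := x 2 t) (y := x 3 t) (hfpos t ht) (hk1 t ht) q2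
          (SSpaceForm.second_deriv_relation hJo hf d1 d1' e1 ht)
        exact ⟨q1, q.1.1 q3, q.2.1 q4, q5⟩
      · rintro ⟨e1, h⟩ t ht
        obtain ⟨q1, q3, q4, q5⟩ := h t ht
        have q := SSpaceForm.component_equations_iff (τ := k 2 t) (τ' := deriv (k 2) t) (P := P)
          (Q := Q) (x := x 2 t) (y := x 3 t) (hfpos t ht) (hk1 t ht) (e1 t ht)
          (SSpaceForm.second_deriv_relation hJo hf d1 d1' e1 ht)
        exact (hcomp t ht (hfpos t ht)).2 ⟨q1, e1 t ht, q.1.2 q3, q.2.2 q4, q5⟩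
    have hbi : SSpaceForm.IsBiharmonic S.g γ J → ∃ C : ℝ, ∀ t ∈ J, k 1 t = C := by
      intro h
      obtain ⟨t₀, -, ht₀⟩ := SSpaceForm.exists_eq_const_of_hasDerivAt_zero hJo hJp hJn (h := k 1)
        fun t ht => by
          have h1 := ((hcomp t ht (f₀ := 1) (f₁ := 0) (f₂ := 0) one_pos).1
            (by simp [h t ht])).2.1
          have h2 : deriv (k 1) t = 0 := by
            have : k 1 t * deriv (k 1) t = 0 := by linear_combination h1 / 3
            exact (mul_eq_zero.1 this).resolve_left (hk1 t ht).ne'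
          exact (d1 t ht).hasDerivAt.congr_deriv h2
      exact ⟨_, ht₀⟩
    -- Constant k₁ forces f' = 0 by the V₁-equation, and then f times the bitension field is zero.
    have hconst : SSpaceForm.IsFBiharmonic S.g γ f J → (∃ C : ℝ, ∀ t ∈ J, k 1 t = C) →
        SSpaceForm.IsBiharmonic S.g γ J := by
      rintro h ⟨C, hC⟩ t ht
      have hf1 : ∀ τ ∈ J, deriv f τ = 0 := by
        intro τ hτ
        have e : k 1 =ᶠ[nhds τ] fun _ => C := by
          filter_upwards [hJo.mem_nhds hτ] with u hu using hC u hu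
        have h1 := (hFB.1 h).1 τ hτ
        rw [e.deriv_eq, deriv_const, mul_zero, zero_mul, zero_add] at h1
        have h2 : k 1 τ ^ 2 ≠ 0 := pow_ne_zero 2 (hk1 τ hτ).ne'
        have h3 := (mul_eq_zero.1 h1).resolve_right h2
        linarith
      have hf2 : deriv (deriv f) t = 0 := by
        have e : deriv f =ᶠ[nhds t] fun _ => 0 := by
          filter_upwards [hJo.mem_nhds ht] with u hu using hf1 u hu
        rw [e.deriv_eq, deriv_const]
      have h1 := h t ht
      rw [hf1 t ht, hf2, mul_zero, zero_smul, zero_smul, add_zero, add_zero] at h1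
      exact (smul_eq_zero.1 h1).resolve_left (hfpos t ht).ne'
    rw [SSpaceForm.IsProperFBiharmonic]
    constructor
    · rintro ⟨h1, h2⟩
      exact ⟨fun h => h2 (hconst h1 h), hFB.1 h1⟩
    · rintro ⟨h1, h2⟩
      exact ⟨hFB.2 h2, fun h => h1 (hbi h)⟩
  rw [step1]
  refine and_congr_right fun _ => and_congr_right fun _ => ?_
  -- Two expressions for the derivative of g(φT, V₂): from √(1-a) cos β and from the Frenet
  -- equations.
  have hdx : ∀ t ∈ J, -(√(1 - a) * Real.sin (β t) * deriv β t) = k 2 t * x 3 t := by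
    intro t ht
    have h1 := SSpaceForm.hasDerivAt_inner_φ_V_two hS.1 hs hJo hF hr2 hθ ht
    have e : (fun τ => S.g.inner (γ τ) (S.φ (γ τ) (V 1 τ)) (V 2 τ)) =ᶠ[nhds t]
        fun τ => √(1 - a) * Real.cos (β τ) := by
      filter_upwards [hJo.mem_nhds ht] with u hu using hβ u hu
    have h2 := h1.unique (((dβ t ht).hasDerivAt.cos.const_mul _).congr_of_eventuallyEq e)
    rw [hx, h2]; ring
  have hnorm : ∀ t ∈ J, S.φ (γ t) (V 1 t) = x 2 t • V 2 t + x 3 t • V 3 t + x 4 t • V 4 t →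
      x 3 t ^ 2 + x 4 t ^ 2 = (√(1 - a) * |Real.sin (β t)|) ^ 2 := by
    intro t ht h
    have h1 := SSpaceForm.inner_φ_φ_V_one hF hθ ht
    rw [← ha] at h1
    have h2 := congrArg (fun X => S.g.inner (γ t) X (S.φ (γ t) (V 1 t))) h
    simp only [h1, map_add, map_smul, add_apply, smul_apply, smul_eq_mul, S.g.symm _ (V _ t),
      ← hx] at h2
    rw [mul_pow, sq_abs, hσ2]
    linear_combination (-1 : ℝ) * h2 - (1 - a) * Real.sin_sq_add_cos_sq (β t)
      - (x 2 t + √(1 - a) * Real.cos (β t)) * hx2 t ht - Real.cos (β t) ^ 2 * hσ2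
  -- This replaces the normalization of V₄, which fails for r = 3; there both sides are zero.
  have hV4 : ∀ t ∈ J, x 4 t * S.g.inner (γ t) (V 4 t) (V 4 t) = x 4 t := by
    intro t ht
    rw [hx]
    exact hF.inner_mul_inner_self ht (by norm_num) _
  have hangle : ∀ t ∈ J, S.φ (γ t) (V 1 t) = x 2 t • V 2 t + x 3 t • V 3 t + x 4 t • V 4 t →
      Real.cos (w t) = x 3 t / (√(1 - a) * |Real.sin (β t)|) ∧
      Real.sin (w t) = |x 4 t| / (√(1 - a) * |Real.sin (β t)|) := by
    intro t ht h
    rw [hw t, ← hx, ← hx]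
    refine SSpaceForm.cos_sin_angle S.g (γ t) (hF.inner_self ht (by norm_num) hr)
      (hF.inner_eq_zero ht (by norm_num) (by norm_num) (by norm_num))
      (by linear_combination x 4 t * hV4 t ht) (mul_pos hσ (abs_pos.2 (hsin t ht)))
      (hnorm t ht h)
  have hsinc : ContinuousOn (fun t => Real.sin (β t)) J :=
    Real.continuous_sin.comp_continuousOn hβd.continuousOn
  obtain ⟨ε₁, hε₁, hε₁'⟩ := SSpaceForm.exists_sign_of_abs hJp hsinc hsin
  have hε₁2 : ε₁ ^ 2 = 1 := by rcases hε₁ with h | h <;> rw [h] <;> norm_num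
  -- For r ≥ 4 the equation k₂k₃ + Q x₂x₄ = 0 with k₂k₃ > 0 prevents x₄ from vanishing; for r = 3 it
  -- is identically zero and either sign will do.
  have hx4 : (∀ t ∈ J, k 2 t * k 3 t + Q * x 2 t * x 4 t = 0) →
      ∃ ε : ℝ, (ε = 1 ∨ ε = -1) ∧ ∀ t ∈ J, x 4 t = ε * |x 4 t| := by
    intro h
    rcases Nat.lt_or_ge r 4 with hr4 | hr4
    · refine ⟨1, Or.inl rfl, fun t ht => ?_⟩
      rw [hx, hF.V_eq_zero 4 hr4 t ht]
      simp
    · have hc4 : ContinuousOn (x 4) J := by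
        have : x 4 = fun τ => S.g.inner (γ τ) (S.φ (γ τ) (V 1 τ)) (V 4 τ) := funext (hx 4)
        rw [this]
        exact SSpaceForm.continuousOn_inner_φ hS.1 hs hJo hF (by norm_num)
      refine SSpaceForm.exists_sign_of_abs hJp hc4 fun t ht h0 => ?_
      have h1 := h t ht
      rw [h0, mul_zero, add_zero] at h1
      exact (mul_pos (hk2 t ht) (hF.k_pos 3 (by norm_num) hr4 t ht)).ne' h1
  constructor
  · intro h
    obtain ⟨ε₂, hε₂, hε₂'⟩ := hx4 fun t ht => (h t ht).2.2.2
    have hε₂2 : ε₂ ^ 2 = 1 := by rcases hε₂ with h | h <;> rw [h] <;> norm_num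
    have hε : ε₂ * ε₁ = 1 ∨ ε₂ * ε₁ = -1 := by
      rcases hε₁ with h | h <;> rcases hε₂ with h' | h' <;> rw [h, h'] <;> norm_num
    -- Since w lies in [0, π], sin w only records |x₄|/(√(1-a)|sin β|). The sign in the theorem is
    -- therefore the product of the signs of x₄ and of sin β.
    have hx4' : ∀ t ∈ J, x 4 t = (ε₂ * ε₁) * (√(1 - a) * Real.sin (β t) * Real.sin (w t)) := by
      intro t ht
      have h1 := (hangle t ht (h t ht).1).2
      rw [eq_div_iff (mul_pos hσ (abs_pos.2 (hsin t ht))).ne'] at h1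
      rw [hε₂' t ht, ← h1]
      nth_rewrite 2 [hε₁' t ht]
      linear_combination -ε₂ * Real.sin (w t) * √(1 - a) * |Real.sin (β t)| * hε₁2
    have habs : ∀ t ∈ J, |Real.sin (β t)| = ε₁ * Real.sin (β t) := by
      intro t ht
      conv_rhs => rw [hε₁' t ht]
      linear_combination -|Real.sin (β t)| * hε₁2
    refine ⟨?_, fun _ => ?_⟩
    · rintro ⟨β₀, hβ₀⟩
      have hβ' : ∀ t ∈ J, deriv β t = 0 := by
        intro t ht
        have e : β =ᶠ[nhds t] fun _ => β₀ := by
          filter_upwards [hJo.mem_nhds ht] with u hu using hβ₀ u hu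
        rw [e.deriv_eq, deriv_const]
      have hx3 : ∀ t ∈ J, x 3 t = 0 := by
        intro t ht
        have h1 := hdx t ht
        rw [hβ' t ht, mul_zero, neg_zero] at h1
        exact (mul_eq_zero.1 h1.symm).resolve_left (hk2 t ht).ne'
      -- With x₃ = 0 the V₃-equation says that the numerator of (k₂/k₁)' is zero.
      obtain ⟨t₀, ht₀, hc₂⟩ := SSpaceForm.exists_eq_const_of_hasDerivAt_zero hJo hJp hJn
        (h := fun t => k 2 t / k 1 t) fun t ht => by
          refine ((d2 t ht).hasDerivAt.fun_div (d1 t ht).hasDerivAt (hk1 t ht).ne').congr_deriv ?_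
          have h1 := (h t ht).2.2.1
          rw [hx3 t ht] at h1
          rw [div_eq_zero_iff]
          left
          linear_combination h1
      have hx4'' : ∀ t ∈ J, x 4 t = ε₂ * ε₁ * (√(1 - a) * Real.sin (β t)) := by
        intro t ht
        have h1 := hnorm t ht (h t ht).1
        rw [hx3 t ht, zero_pow two_ne_zero, zero_add, sq_eq_sq_iff_abs_eq_abs, abs_mul, abs_abs,
          abs_of_pos hσ] at h1
        rw [hε₂' t ht, h1, habs t ht]
        ring
      refine ⟨k 2 t₀ / k 1 t₀, ε₂ * ε₁, div_pos (hk2 t₀ ht₀) (hk1 t₀ ht₀), hε, fun t ht => ?_⟩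
      obtain ⟨q1, q2, q3, q4⟩ := h t ht
      refine ⟨hc₂ t ht, ?_, ?_, ?_⟩
      · rw [← hc₂ t ht, q2, hx2 t ht, mul_pow, hσ2, hP, hQ]
        have : (k 2 t / k 1 t) ^ 2 * k 1 t ^ 2 = k 2 t ^ 2 := by
          have := (hk1 t ht).ne'
          field_simp
        linear_combination -4 * k 1 t ^ 2 * this
      · rw [hx2 t ht, hx4'' t ht, hQ] at q4
        rw [Real.sin_two_mul, ← hσ2]
        linear_combination q4
      · rw [q1, hx2 t ht, hx3 t ht, hx4'' t ht]
        module
    -- The witness μ is obtained by solving the required formula for k₂² for μ; its derivative comes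
    -- from k₂ times the V₃-equation, with k₂x₃ replaced through `hdx`.
    · refine ⟨fun t => (k 2 t ^ 2 + Q * (1 - a) * Real.cos (β t) ^ 2) / k 1 t ^ 2, ε₁, ε₂ * ε₁,
        hε₁, hε, fun t ht => ?_⟩
      obtain ⟨q1, q2, q3, q4⟩ := h t ht
      have hcw := (hangle t ht q1).1
      rw [eq_div_iff (mul_pos hσ (abs_pos.2 (hsin t ht))).ne', habs t ht] at hcw
      have hμ : (k 2 t ^ 2 + Q * (1 - a) * Real.cos (β t) ^ 2) / k 1 t ^ 2 * k 1 t ^ 2 =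
          k 2 t ^ 2 + Q * (1 - a) * Real.cos (β t) ^ 2 :=
        div_mul_cancel₀ _ (pow_ne_zero 2 (hk1 t ht).ne')
      refine ⟨?_, ?_, ?_, ?_, ?_, ?_⟩
      · refine (SSpaceForm.hasDerivAt_ratio (hk1 t ht).ne' (d1 t ht) (d2 t ht) (dβ t ht)
          ?_).congr_deriv ?_
        · rw [← hσ2]
          rw [hx2 t ht] at q3
          linear_combination k 2 t * q3
            + Q * k 1 t * √(1 - a) * Real.cos (β t) * hdx t ht
        · rw [hQ]; ring
      · simp only [hμ]
        rw [hQ]; ring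
      · rw [q2, hx2 t ht, mul_pow, hσ2, hP]
        simp only
        rw [hQ] at hμ ⊢
        linear_combination -4 * k 1 t ^ 2 * hμ
      · rw [hx2 t ht, hx4' t ht, hQ] at q4
        rw [Real.sin_two_mul, ← hσ2]
        linear_combination q4
      · rw [q1, hx2 t ht, hx4' t ht, ← hcw]
        module
      · rw [eq_div_iff (hk2 t ht).ne']
        have h1 : (√(1 - a) * Real.sin (β t)) * (Real.cos (w t) * k 2 t - -ε₁ * deriv β t) = 0 := by
          linear_combination ε₁ * k 2 t * hcw - ε₁ * hdx t ht
            - √(1 - a) * Real.sin (β t) * Real.cos (w t) * k 2 t * hε₁2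
        exact sub_eq_zero.1 ((mul_eq_zero.1 h1).resolve_left (mul_ne_zero hσ.ne' (hsin t ht)))
  · rintro ⟨hi, hii⟩ t ht
    -- The coefficient z of V₄ in the given formula for φT equals x₄ if r ≥ 4. If r = 3 it is not
    -- determined, but V₄ = 0 and k₃ = 0 make both conclusions true.
    have hx4z : ∀ p q z : ℝ, S.φ (γ t) (V 1 t) = p • V 2 t + q • V 3 t + z • V 4 t →
        k 2 t * k 3 t + Q * x 2 t * z = 0 →
        z • V 4 t = x 4 t • V 4 t ∧ k 2 t * k 3 t + Q * x 2 t * x 4 t = 0 := by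
      intro p q z h1 h2
      rcases Nat.lt_or_ge r 4 with hr4 | hr4
      · have hV := hF.V_eq_zero 4 hr4 t ht
        rw [hx, hV, hF.k_eq_zero 3 (by omega) t ht]
        simp
      · have h3 : x 4 t = z := by
          rw [hx, h1]
          simp [hF.inner_eq_zero ht (i := 2) (j := 4), hF.inner_eq_zero ht (i := 3) (j := 4),
            hF.inner_self ht (i := 4) (by norm_num) hr4]
        rw [h3]
        exact ⟨rfl, h2⟩
    by_cases hconst : ∃ β₀ : ℝ, ∀ t ∈ J, β t = β₀
    · obtain ⟨c₂, ε, hc₂, hε, h⟩ := hi hconst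
      obtain ⟨q1, q2, q3, q4⟩ := h t ht
      obtain ⟨β₀, hβ₀⟩ := hconst
      have hk : ∀ u ∈ J, k 2 u = c₂ * k 1 u := fun u hu =>
        (div_eq_iff (hk1 u hu).ne').1 (h u hu).1
      have hk' : deriv (k 2) t = c₂ * deriv (k 1) t := by
        have e : k 2 =ᶠ[nhds t] fun u => c₂ * k 1 u := by
          filter_upwards [hJo.mem_nhds ht] with u hu using hk u hu
        rw [e.deriv_eq]
        exact ((d1 t ht).hasDerivAt.const_mul c₂).deriv
      have hβ' : deriv β t = 0 := by
        have e : β =ᶠ[nhds t] fun _ => β₀ := by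
          filter_upwards [hJo.mem_nhds ht] with u hu using hβ₀ u hu
        rw [e.deriv_eq, deriv_const]
      have hx3 : x 3 t = 0 := by
        have h1 := hdx t ht
        rw [hβ', mul_zero, neg_zero] at h1
        exact (mul_eq_zero.1 h1.symm).resolve_left (hk2 t ht).ne'
      have h4 := hx4z (√(1 - a) * Real.cos (β t)) 0 (√(1 - a) * (ε * Real.sin (β t)))
        (by rw [q4]; module) (by
          rw [q3, hx2 t ht, hQ, Real.sin_two_mul]
          linear_combination (3 * (c - s) / 4 * ε * Real.sin (β t) * Real.cos (β t)) * hσ2)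
      refine ⟨?_, ?_, ?_, h4.2⟩
      · rw [← h4.1, q4, hx2 t ht, hx3]
        module
      · rw [q2, hx2 t ht, mul_pow, hσ2, hP, hQ, hk t ht]
        ring
      · rw [hx3, hk', hk t ht]
        ring
    · obtain ⟨μ, ε₁, ε₂, hε₁, hε₂, h⟩ := hii hconst
      obtain ⟨q1, q2, q3, q4, q5, q6⟩ := h t ht
      have hε₁2 : ε₁ ^ 2 = 1 := by rcases hε₁ with h | h <;> rw [h] <;> norm_num
      have hx3 : x 3 t = √(1 - a) * (ε₁ * Real.sin (β t) * Real.cos (w t)) := by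
        have h1 := hdx t ht
        rw [eq_div_iff (hk2 t ht).ne'] at q6
        refine mul_left_cancel₀ (hk2 t ht).ne' ?_
        linear_combination (-1 : ℝ) * h1 - √(1 - a) * ε₁ * Real.sin (β t) * q6
          + √(1 - a) * Real.sin (β t) * deriv β t * hε₁2
      have h4 := hx4z (√(1 - a) * Real.cos (β t)) (x 3 t)
        (√(1 - a) * (ε₂ * Real.sin (β t) * Real.sin (w t)))
        (by rw [q5, hx3]; module) (by
          rw [q4, hx2 t ht, hQ, Real.sin_two_mul]
          linear_combination
            (3 * (c - s) / 4 * ε₂ * Real.sin (β t) * Real.cos (β t) * Real.sin (w t)) * hσ2)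
      have h5 := SSpaceForm.deriv_ratio_relation (A := Q * (1 - a)) hJo ht (hk1 t ht).ne'
        (d1 t ht) (d2 t ht) (dβ t ht) (q1.congr_deriv (by rw [hQ]; ring)) fun u hu => by
          rw [(h u hu).2.1, hQ]; ring
      refine ⟨?_, ?_, ?_, h4.2⟩
      · rw [← h4.1, q5, hx2 t ht, hx3]
        module
      · rw [q3, hx2 t ht, mul_pow, hσ2, hP, q2, hQ]
        ring
      -- The relation for μ recovers the V₃-equation only after multiplication by k₂, which is
      -- positive.
      · refine (mul_eq_zero.1 (?_ : k 2 t * _ = 0)).resolve_left (hk2 t ht).ne'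
        rw [← hσ2] at h5
        rw [hx2 t ht]
        linear_combination h5 - Q * k 1 t * √(1 - a) * Real.cos (β t) * hdx t ht
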